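/- Throughout, rings are commutative and local rings are Noetherian. Let $(R,\mathfrak m)$ be a local ring. Every bounded below complex $M$ of finitely generated $R$-modules has a minimal free resolution $F\xrightarrow{\simeq}M$, unique up to isomorphism: $F$ is a bounded below complex of free modules of finite rank with $d(F)\subseteq\mathfrak m F$. For an $R$-linear map $g$ between free modules of finite rank, let $\mathbf I^r(g)$ be the ideal generated by its $r\times r$ minors, with $\mathbf I^r(g)=R$ if the source or the target of $g$ is $0$, and $\mathbf I^r(g)=0$ if both are nonzero and $r$ exceeds the rank of one of them. For $r\ge 1$, and with $\inf(F)=\min\{i: F_i\ne 0\}$, put $$\mathbf I^{\rm tot}(F_{\ge n},r)=\sum_{i>n}\mathbf I^r(F_i\to F_{i-1}),\qquad \mathbf I^{\rm tot}(M,r)=\mathbf I^{\rm tot}(F_{\ge \inf(F)},r),\qquad \mathbf I^{\rm stab}(M,r)=\bigcap_{n\ge\inf(F)}\mathbf I^{\rm tot}(F_{\ge n},r)$$ (all these ideals are $R$ if $F=0$). Let $\mathbf I^{\rm stab}(\mathrm C^{+,f}(\mathrm{mod}\,R),r)$ be the intersection of the ideals $\mathbf I^{\rm tot}(M,r)$ over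 all bounded below complexes $M$ of finitely generated $R$-modules with bounded homology, and $\mathbf I^{\rm stab}(\mathrm{mod}(R),r)$ the intersection of the ideals $\mathbf I^{\rm tot}(N,r)$ over all finitely generated $R$-modules $N$ (viewed as complexes in degree $0$). The conductor of a reduced ring $R$ is $\mathfrak c_R=\{r\in R: r\overline R\subseteq R\}$, where $\overline R$ is the integral closure of $R$ in its total ring of fractions. A local ring is analytically unramified if its $\mathfrak m$-adic completion $\widehat R$ is reduced, and an abstract hypersurface if $\widehat R\cong S/(f)$ with $S$ a regular local ring and $f$ a nonzero element of the maximal ideal of $S$. The multiplicity of $R$ is $\lim_{n\to\infty} d!\,\ell(R/\mathfrak m^n)/n^d$ with $d=\dim R$. **Theorem.** Let $(R,\mathfrak m)$ be a $1$-dimensional analytically unramified local ring. 1. For every bounded below complex $M$ of finitely generated $R$-modules with bounded homology, $\mathfrak c_R\subseteq \mathbf I^{\rm stab}(M,1)$. Consequently, $$\mathfrak c_R\subseteq \mathbf I^{\rm stab}(\mathrm C^{+,f}(\mathrm{mod}\,R),1)=\mathbf I^{\rm stab}(\mathrm{mod}(R),1).$$ 2. Assume moreover that $R$ is Gorenstein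 with infinite residue field. The following are equivalent: (a) there is a finitely generated $R$-module $N$ with $\mathbf I^{\rm stab}(N,1)=\mathfrak c_R$; (b) $R$ is regular or an abstract hypersurface of multiplicity $2$. -/

import Mathlib

universe u

open CategoryTheory IsLocalRing Filter Topology

noncomputable section

namespace StableMinors

/-! ### Ideals of minors -/

/-- The ideal `I^r(g)` generated by the `r × r` minors of a linear map `g : F → G` between free
modules of finite rank, with the convention that it is the unit ideal if `F` or `G` is zero.
The generators are the minors of the matrices of `g`; as the ideal of minors of a matrix does not
change when the bases do, all pairs of (finite) bases are allowed.
If `r` exceeds the rank of `F` or of `G` there are no `r × r` minors and the ideal is zero. -/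
def minorsIdeal {R : Type u} [CommRing R] {F G : Type u} [AddCommGroup F] [Module R F]
    [AddCommGroup G] [Module R G] (r : ℕ) (g : F →ₗ[R] G) : Ideal R :=
  open Classical in
  if Subsingleton F ∨ Subsingleton G then ⊤ else
    Ideal.span {x : R | ∃ (m n : ℕ) (b : Module.Basis (Fin n) R F) (c : Module.Basis (Fin m) R G)
      (rows : Fin r ↪ Fin m) (cols : Fin r ↪ Fin n),
        x = ((LinearMap.toMatrix b c g).submatrix rows cols).det}

/-! ### Complexes and minimal free resolutions (homological indexing by `ℤ`) -/

section Complexes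

variable {R : Type u} [CommRing R]

/-- `M` is a bounded below complex of finitely generated modules. -/
structure IsBoundedBelowFG (M : ChainComplex (ModuleCat.{u} R) ℤ) : Prop where
  finite : ∀ i, Module.Finite R (M.X i)
  bounded : ∃ a : ℤ, ∀ i < a, Subsingleton (M.X i)

/-- `M` is a bounded below complex of finitely generated modules with bounded homology. -/
structure IsBoundedBelowFGHomologyBounded (M : ChainComplex (ModuleCat.{u} R) ℤ) : Prop extends
    IsBoundedBelowFG M where
  homology_bounded : ∃ b : ℤ, ∀ i > b, Subsingleton (M.homology i)

/-- `F` is a minimal free resolution of the complex `M`: a bounded below complex of free modules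
of finite rank with `d(F) ⊆ 𝔪 F` and a quasi-isomorphism `F ⟶ M`. -/
structure IsMinimalFreeResolution [IsLocalRing R] (F M : ChainComplex (ModuleCat.{u} R) ℤ) :
    Prop extends IsBoundedBelowFG F where
  free : ∀ i, Module.Free R (F.X i)
  minimal : ∀ i, LinearMap.range (F.d i (i - 1)).hom ≤
    (maximalIdeal R) • (⊤ : Submodule R (F.X (i - 1)))
  quasiIso : ∃ π : F ⟶ M, QuasiIso π

/-- `inf(F) = min {i | F_i ≠ 0}` for a nonzero bounded below complex (the value for the zero
complex, `0`, plays no role: all its ideals of minors are the unit ideal). -/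
def infDegree (F : ChainComplex (ModuleCat.{u} R) ℤ) : ℤ :=
  sInf {i : ℤ | Nontrivial (F.X i)}

/-- The sum of the ideals of `r × r` minors of the differentials `F_i → F_{i-1}`, `i > n`, i.e. of
the differentials of the truncation `⋯ → F_{n+1} → F_n → 0`. -/
def tailIdeal (F : ChainComplex (ModuleCat.{u} R) ℤ) (n : ℤ) (r : ℕ) : Ideal R :=
  ⨆ (i : ℤ) (_ : n < i), minorsIdeal r (F.d i (i - 1)).hom

variable [IsLocalRing R]

/-- `I^tot(M, r)`: the sum of the ideals of `r × r` minors of the differentials of the minimal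
free resolution `F` of `M`. As `F` exists and is unique up to isomorphism whenever `M` is a
bounded below complex of finitely generated modules over a Noetherian local ring, the infimum
over `F` is that of a single ideal. -/
def totalIdeal (M : ChainComplex (ModuleCat.{u} R) ℤ) (r : ℕ) : Ideal R :=
  ⨅ (F : ChainComplex (ModuleCat.{u} R) ℤ) (_ : IsMinimalFreeResolution F M),
    tailIdeal F (infDegree F) r

/-- `I^stab(M, r) = ⋂_{n ≥ inf F} I^tot(F_{≥ n}, r)`, with `F` the minimal free resolution of `M`
(as in `totalIdeal`, the infimum over `F` is that of a single ideal). -/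
def stableIdeal (M : ChainComplex (ModuleCat.{u} R) ℤ) (r : ℕ) : Ideal R :=
  ⨅ (F : ChainComplex (ModuleCat.{u} R) ℤ) (_ : IsMinimalFreeResolution F M),
    ⨅ (n : ℤ) (_ : infDegree F ≤ n), tailIdeal F n r

/-- A module as a complex concentrated in degree `0`. -/
abbrev moduleComplex (N : ModuleCat.{u} R) : ChainComplex (ModuleCat.{u} R) ℤ :=
  (HomologicalComplex.single (ModuleCat.{u} R) (ComplexShape.down ℤ) 0).obj N

end Complexes

section Rings

variable (R : Type u) [CommRing R] [IsLocalRing R]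

/-- `I^stab(C^{+,f}(mod R), r)`: the intersection of the ideals `I^tot(M, r)` over all bounded below
complexes `M` of finitely generated modules with bounded homology. -/
def stableIdealComplexes (r : ℕ) : Ideal R :=
  ⨅ (M : ChainComplex (ModuleCat.{u} R) ℤ) (_ : IsBoundedBelowFGHomologyBounded M), totalIdeal M r

/-- `I^stab(mod R, r)`: the intersection of the ideals `I^tot(N, r)` over all finitely generated
modules `N`. -/
def stableIdealModules (r : ℕ) : Ideal R :=
  ⨅ (N : ModuleCat.{u} R) (_ : Module.Finite R N), totalIdeal (moduleComplex N) r

/-! ### Ring-theoretic notions -/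

/-- The local ring `R` is analytically unramified: its completion is reduced. -/
def IsAnalyticallyUnramified : Prop :=
  IsReduced (AdicCompletion (maximalIdeal R) R)

/-- The Noetherian local ring `R` is Gorenstein: it has finite injective dimension as a module over
itself. -/
def IsGorensteinLocal : Prop :=
  ∃ n : ℕ, HasInjectiveDimensionLE (ModuleCat.of R R) n

/-- `R` is an abstract hypersurface: its completion is isomorphic to `S / (f)`, with `S` a regular
local ring and `f` a nonzero element of the maximal ideal of `S`. -/
def IsAbstractHypersurface : Prop :=
  ∃ (S : Type u) (_ : CommRing S) (_ : IsRegularLocalRing S) (f : S),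
    f ∈ maximalIdeal S ∧ f ≠ 0 ∧
      Nonempty (AdicCompletion (maximalIdeal R) R ≃+* S ⧸ Ideal.span {f})

/-- The (Hilbert-Samuel) multiplicity of the Noetherian local ring `R` is `e`:
`d! · ℓ(R / 𝔪ⁿ) / n ^ d` tends to `e`, where `d` is the Krull dimension. -/
def HasMultiplicity (e : ℕ) : Prop :=
  ∃ d : ℕ, ringKrullDim R = d ∧
    Tendsto (fun n : ℕ => ((d.factorial : ℝ) *
      ((Module.length R (R ⧸ (maximalIdeal R) ^ n)).toNat : ℝ)) / (n : ℝ) ^ d) atTop (𝓝 (e : ℝ))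

end Rings

/-- The conductor `{r ∈ R | r · R̄ ⊆ R}` of a reduced ring `R`, where `R̄` is the integral closure of
`R` in its total ring of fractions. -/
def conductorIdeal (R : Type u) [CommRing R] : Ideal R where
  carrier := {r : R | ∀ x ∈ integralClosure R (FractionRing R),
    r • x ∈ Set.range (algebraMap R (FractionRing R))}
  add_mem' := by
    intro a b ha hb x hx
    obtain ⟨s, hs⟩ := ha x hx
    obtain ⟨t, ht⟩ := hb x hx
    exact ⟨s + t, by rw [map_add, hs, ht, add_smul]⟩
  zero_mem' := fun x _ => ⟨0, by simp⟩
  smul_mem' := by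
    intro c a ha x hx
    obtain ⟨s, hs⟩ := ha x hx
    exact ⟨c * s, by rw [map_mul, hs, smul_eq_mul, mul_smul, Algebra.smul_def c]⟩

end StableMinors

end

/-!
# Stable ideals of entries of minimal resolutions over one-dimensional rings

Let `R` be a one-dimensional analytically unramified local ring with maximal ideal `𝔪`, integral
closure `B` and conductor `𝔠`.

**The conductor is contained in every stable ideal.** As the completion of `R` is reduced, `B` is
finite over `R` (`exists_forall_mem_span_pow_of_isIntegral`), so that `𝔠` contains a
non-zero-divisor and `B` is Noetherian; being integrally closed of dimension one, `B` has
projective ideals, and all finitely generated submodules of free `B`-modules are projective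
(`projective_submodule_pi`). Hence for a differential `d` of a minimal free resolution `F` the
`B`-linear extension of `d` has a section on its image, and multiplying that section by `x ∈ 𝔠`
brings its values on the image of `d` back into `F` (`exists_lift_smul_of_mem_conductor`). In high
degrees `F` is exact, and the partial lift extends to a null-homotopy of multiplication by `x`. Its
existence shows that `x` lies in the ideal generated by the entries of two consecutive
differentials (`mem_minorsIdeal_sup_of_lift`). High truncations of `F` are, up to a shift, minimal
resolutions of modules, whence the equality of the two intersections over complexes and over
modules.

Suppose now that the residue field is infinite. Then any regular ideal `I` contains a
non-zero-divisor `u` with `I B = u B`, and so `I 𝔠 = u 𝔠`; let `x` and `u` belong to `𝔪` and to `𝔠`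
respectively. The multiplicity of `R` is then the length of `R ⧸ (x)` (`hasMultiplicity_iff`).

**Stable ideals equal to the conductor bound the multiplicity.** If the stable ideal of a module is
a proper ideal `𝔠`, then in high degrees the entries of the differentials `d i : F i → F (i - 1)`
lie in `𝔠`. For `K = ker (d i)` and `I` either `𝔠` or `𝔪`, and `u` as above for that `I`, this
gives `K + u F i = I F i`, and counting lengths gives `(rank F i + rank F (i + 1)) ℓ(R ⧸ I) = (rank
F i) ℓ(R ⧸ (u))` (`finrank_add_finrank_mul_length`). If `R` is Gorenstein, duality yields `ℓ(R ⧸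
(u)) ≤ 2 ℓ(R ⧸ 𝔠)` for the `u` belonging to `𝔠` (`length_quotient_span_singleton_le_two_mul`). The
case `I = 𝔠` therefore bounds `rank F (i + 1)` by `rank F i`, and the case `I = 𝔪` then shows that
`ℓ(R ⧸ (x)) ≤ 2`.

**Multiplicity two.** If `ℓ(R ⧸ (x)) = 2`, then `𝔠` is generated by `u` and one more element `v`,
with `v² = u w` and `w ∈ 𝔠`. A proper `𝔠` then has a minimal resolution with all differentials
given by the matrix with rows `(-v, -w)` and `(u, v)`, and its stable ideal is `𝔠`
(`stableIdeal_conductorIdeal_le`). Moreover `𝔪` is principal or generated by `x` and one more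
element.

**Hypersurfaces.** In the last case the completion `A` has to be presented as the quotient of a
regular local ring by one element. The usual appeal to coefficient rings is replaced by a direct
construction. Map the polynomial ring `ℤ[X_a : a ∈ A]` onto `A`, let `q` be the inverse image of
the maximal ideal, and let `J` be generated by elements of the kernel that lift a basis of the
image of the kernel in `q / q²`. Relations involve finitely many variables, and polynomial rings in
finitely many variables over `ℤ` are regular; this makes the forms in two variables mapping to
generators of the maximal ideal of `A` independent modulo `J` (`mem_of_sum_mem_sup_pow`). The
completion `S` of `ℤ[X_a] / J` at `q` is then a complete ring whose maximal ideal is generated by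
two elements `X`, `Y` with independent forms; every element of `S` is, modulo `X`, zero or a unit
times a power of `Y`. It follows that `S` is Noetherian and regular of dimension two, and that the
kernel of `S → A` is principal (`exists_ringEquiv_quotient_span_singleton`).
-/

noncomputable section

namespace StableMinors

/-! ### Ideals generated by the entries of a matrix -/

section Entries

variable {R : Type u} [CommRing R] {F G : Type u} [AddCommGroup F] [Module R F]
  [AddCommGroup G] [Module R G]

lemma toMatrix_mem_minorsIdeal_one {m n : ℕ} (g : F →ₗ[R] G) (b : Module.Basis (Fin n) R F)
    (c : Module.Basis (Fin m) R G) (i : Fin m) (j : Fin n) :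
    LinearMap.toMatrix b c g i j ∈ minorsIdeal 1 g := by
  unfold minorsIdeal
  split_ifs with h
  · trivial
  · refine Ideal.subset_span ⟨m, n, b, c, ⟨fun _ ↦ i, fun _ _ _ ↦ Subsingleton.elim _ _⟩,
      ⟨fun _ ↦ j, fun _ _ _ ↦ Subsingleton.elim _ _⟩, ?_⟩
    rw [Matrix.det_fin_one]
    rfl

lemma apply_mem_minorsIdeal_one [Nontrivial R] [Module.Free R F] [Module.Finite R F] [Module.Free R G]
    [Module.Finite R G] (g : F →ₗ[R] G) (φ : G →ₗ[R] R) (v : F) :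
    φ (g v) ∈ minorsIdeal 1 g := by
  let b := Module.finBasis R F
  let c := Module.finBasis R G
  have hb : ∀ j, φ (g (b j)) ∈ minorsIdeal 1 g := fun j ↦ by
    rw [← c.sum_repr (g (b j)), map_sum]
    refine Ideal.sum_mem _ fun i _ ↦ ?_
    rw [map_smul, smul_eq_mul]
    refine Ideal.mul_mem_right _ _ ?_
    simpa [LinearMap.toMatrix_apply] using toMatrix_mem_minorsIdeal_one g b c i j
  rw [← b.sum_repr v, map_sum, map_sum]
  refine Ideal.sum_mem _ fun j _ ↦ ?_
  rw [map_smul, map_smul, smul_eq_mul]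
  exact Ideal.mul_mem_left _ _ (hb j)

lemma minorsIdeal_one_le [Nontrivial F] [Nontrivial G] (g : F →ₗ[R] G) (I : Ideal R)
    (h : ∀ (φ : G →ₗ[R] R) (v : F), φ (g v) ∈ I) : minorsIdeal 1 g ≤ I := by
  unfold minorsIdeal
  rw [if_neg (by simp [not_subsingleton_iff_nontrivial, *])]
  rw [Ideal.span_le]
  rintro x ⟨m, n, b, c, rows, cols, rfl⟩
  rw [Matrix.det_fin_one]
  simpa [LinearMap.toMatrix_apply] using h (c.coord (rows 0)) (b (cols 0))

lemma minorsIdeal_eq_top {R : Type u} [CommRing R] {F G : Type u} [AddCommGroup F] [Module R F]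
    [AddCommGroup G] [Module R G] (r : ℕ) (g : F →ₗ[R] G) (h : Subsingleton F ∨ Subsingleton G) :
    minorsIdeal r g = ⊤ := by
  unfold minorsIdeal
  exact if_pos h

end Entries

/-! ### Exactness, tails of complexes, and resolutions of modules -/

section Complexes

variable {R : Type u} [CommRing R]

lemma exact_of_subsingleton_homology (F : ChainComplex (ModuleCat.{u} R) ℤ) (i : ℤ)
    (h : Subsingleton (F.homology i)) :
    Function.Exact (F.d (i + 1) i).hom (F.d i (i - 1)).hom := by
  have h1 : F.ExactAt i := by
    rw [HomologicalComplex.exactAt_iff_isZero_homology]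
    exact ModuleCat.isZero_of_subsingleton _
  rw [HomologicalComplex.exactAt_iff' F (i + 1) i (i - 1) (by simp) (by simp),
    ShortComplex.moduleCat_exact_iff] at h1
  intro x
  constructor
  · exact fun hx ↦ h1 x hx
  · rintro ⟨y, rfl⟩
    have := F.d_comp_d (i + 1) i (i - 1)
    exact congrArg (fun f ↦ f.hom y) this

lemma subsingleton_homology_of_quasiIso {F M : ChainComplex (ModuleCat.{u} R) ℤ} (π : F ⟶ M)
    [QuasiIso π] (i : ℤ) (h : Subsingleton (M.homology i)) : Subsingleton (F.homology i) := by
  have e : F.homology i ≅ M.homology i := asIso (HomologicalComplex.homologyMap π i)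
  exact e.toLinearEquiv.toEquiv.subsingleton

lemma subsingleton_homology_moduleComplex (N : ModuleCat.{u} R) (i : ℤ) (hi : i ≠ 0) :
    Subsingleton ((moduleComplex N).homology i) := by
  have := (HomologicalComplex.exactAt_single_obj (ComplexShape.down ℤ) 0 N i hi).isZero_homology
  exact ModuleCat.subsingleton_of_isZero this

lemma tailIdeal_anti (F : ChainComplex (ModuleCat.{u} R) ℤ) (r : ℕ) {m n : ℤ} (h : m ≤ n) :
    tailIdeal F n r ≤ tailIdeal F m r :=
  iSup_mono fun _ ↦ iSup_const_mono fun hi ↦ lt_of_le_of_lt h hi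

lemma minorsIdeal_le_tailIdeal (F : ChainComplex (ModuleCat.{u} R) ℤ) (r : ℕ) {n i : ℤ}
    (h : n ≤ i) : minorsIdeal r (F.d (i + 1) i).hom ≤ tailIdeal F n r := by
  have h1 : minorsIdeal r (F.d (i + 1) (i + 1 - 1)).hom ≤ tailIdeal F n r :=
    le_iSup₂_of_le (i + 1) (by lia) le_rfl
  rwa [add_sub_cancel_right] at h1

lemma tailIdeal_le (F : ChainComplex (ModuleCat.{u} R) ℤ) (r : ℕ) (n : ℤ) (I : Ideal R)
    (h : ∀ i, n ≤ i → minorsIdeal r (F.d (i + 1) i).hom ≤ I) : tailIdeal F n r ≤ I := by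
  refine iSup₂_le fun i hi ↦ ?_
  obtain ⟨j, rfl⟩ : ∃ j, i = j + 1 := ⟨i - 1, by ring⟩
  rw [add_sub_cancel_right]
  exact h j (by lia)

lemma tailIdeal_eq_top (F : ChainComplex (ModuleCat.{u} R) ℤ) (r : ℕ) {n i : ℤ} (h : n < i)
    [Subsingleton (F.X i)] : tailIdeal F n r = ⊤ :=
  top_le_iff.mp (le_iSup₂_of_le i h (minorsIdeal_eq_top r _ (.inl inferInstance)).ge)

variable [IsLocalRing R]

lemma stableIdeal_le_totalIdeal (M : ChainComplex (ModuleCat.{u} R) ℤ) (r : ℕ) :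
    stableIdeal M r ≤ totalIdeal M r :=
  iInf₂_mono fun _ _ ↦ iInf₂_le _ le_rfl

/-- The modules of the complex on `ℤ` obtained from a sequence of modules by adding zeros in
negative degrees. -/
def extendX (G : ℕ → ModuleCat.{u} R) : ℤ → ModuleCat.{u} R
  | .ofNat n => G n
  | .negSucc _ => ModuleCat.of R PUnit.{u + 1}

/-- The differentials of the complex on `ℤ` obtained from a sequence of maps by adding zeros in
negative degrees. -/
def extendD (G : ℕ → ModuleCat.{u} R) (d : ∀ k, G (k + 1) ⟶ G k) :
    ∀ n : ℤ, extendX G (n + 1) ⟶ extendX G n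
  | .ofNat n => d n
  | .negSucc _ => 0

/-- A sequence of free modules with minimal differentials that is exact, together with an
augmentation to `N`, is a minimal free resolution of `N` in the sense of complexes. -/
lemma exists_isMinimalFreeResolution (G : ℕ → ModuleCat.{u} R) (d : ∀ k, G (k + 1) ⟶ G k)
    (N : ModuleCat.{u} R) (ε : G 0 ⟶ N) (hfin : ∀ k, Module.Finite R (G k))
    (hfree : ∀ k, Module.Free R (G k))
    (hmin : ∀ k, LinearMap.range (d k).hom ≤ maximalIdeal R • (⊤ : Submodule R (G k)))
    (hex : ∀ k, Function.Exact (d (k + 1)).hom (d k).hom) (hε : Function.Surjective ε.hom)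
    (hex0 : Function.Exact (d 0).hom ε.hom) (h0 : Nontrivial (G 0)) :
    ∃ F, IsMinimalFreeResolution F (moduleComplex N) ∧ infDegree F = 0 ∧
      ∀ r, tailIdeal F 0 r ≤ ⨆ k, minorsIdeal r (d k).hom := by
  have hneg (n : ℕ) : Subsingleton (extendX G (.negSucc n)) :=
    inferInstanceAs (Subsingleton PUnit.{u + 1})
  have sq : ∀ n, extendD G d (n + 1) ≫ extendD G d n = 0 := by
    rintro (n | n)
    · ext x
      exact (hex n).apply_apply_eq_zero x
    · exact Limits.comp_zero
  let F := ChainComplex.of (extendX G) (extendD G d) sq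
  have hd (n : ℤ) : F.d (n + 1) n = extendD G d n := ChainComplex.of_d _ _ _
  have hlt (i : ℤ) (hi : i < 0) : Subsingleton (F.X i) := by
    obtain ⟨n, rfl⟩ := Int.eq_negSucc_of_lt_zero hi
    exact hneg n
  have hinf : infDegree F = 0 := by
    have hmem : (0 : ℤ) ∈ {i : ℤ | Nontrivial (F.X i)} := h0
    have hbd : BddBelow {i : ℤ | Nontrivial (F.X i)} := by
      refine ⟨0, fun i hi ↦ ?_⟩
      by_contra! h
      exact not_subsingleton_iff_nontrivial.mpr hi (hlt i h)
    refine le_antisymm (csInf_le hbd hmem) (le_csInf ⟨0, hmem⟩ fun i hi ↦ ?_)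
    by_contra! h
    exact not_subsingleton_iff_nontrivial.mpr hi (hlt i h)
  have hε0 : F.d 1 0 ≫ ε = 0 := by
    have := hd 0
    ext x
    change ε.hom ((F.d (0 + 1) 0).hom x) = 0
    rw [this]
    exact hex0.apply_apply_eq_zero x
  have hε' : ∀ i, (ComplexShape.down ℤ).Rel i 0 → F.d i 0 ≫ ε = 0 := by
    intro i hi
    obtain rfl : i = 1 := by simpa using hi.symm
    exact hε0
  let π : F ⟶ moduleComplex N := HomologicalComplex.mkHomToSingle ε hε'
  have hπ : QuasiIso π := by
    refine ⟨fun i ↦ ?_⟩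
    by_cases hi : i = 0
    · subst hi
      rw [quasiIsoAt_iff' π 1 0 (-1) (by simp) (by simp), ShortComplex.quasiIso_iff_of_zeros']
      · have hτ : ((HomologicalComplex.shortComplexFunctor' (ModuleCat.{u} R)
            (ComplexShape.down ℤ) 1 0 (-1)).map π).τ₂ = ε ≫
            (HomologicalComplex.singleObjXSelf (ComplexShape.down ℤ) 0 N).inv :=
          by
          exact HomologicalComplex.mkHomToSingle_f (K := F) (j := 0) (A := N) ε hε'
        constructor
        · rw [ShortComplex.moduleCat_exact_iff]
          intro x hx
          have hx0 : ε.hom x = 0 := by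
            have hx' : (HomologicalComplex.singleObjXSelf (ComplexShape.down ℤ) 0 N).inv.hom
                (ε.hom x) = 0 := (congrArg (fun f ↦ f.hom x) hτ).symm.trans hx
            have := congrArg
              (HomologicalComplex.singleObjXSelf (ComplexShape.down ℤ) 0 N).hom.hom hx'
            simpa using this
          obtain ⟨y, hy⟩ := (hex0 x).mp hx0
          refine ⟨y, ?_⟩
          change (F.d (0 + 1) 0).hom y = x
          rw [hd]
          exact hy
        · rw [hτ]
          have : Epi ε := (ModuleCat.epi_iff_surjective _).mpr hε
          exact epi_comp ε (HomologicalComplex.singleObjXSelf (ComplexShape.down ℤ) 0 N).inv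
      · ext x
        exact @Subsingleton.elim _ (hneg 0) _ _
      · exact HomologicalComplex.single_obj_d (ComplexShape.down ℤ) 0 N _ _
      · exact HomologicalComplex.single_obj_d (ComplexShape.down ℤ) 0 N _ _
    · rw [quasiIsoAt_iff_exactAt']
      · rw [HomologicalComplex.exactAt_iff' F (i + 1) i (i - 1) (by simp) (by simp),
          ShortComplex.moduleCat_exact_iff]
        intro x hx
        obtain ⟨j, rfl⟩ : ∃ j, i = j + 1 := ⟨i - 1, by ring⟩
        rcases j with n | n
        · change (F.d (.ofNat n + 1) (.ofNat n + 1 - 1)).hom x = 0 at hx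
          change ∃ y, (F.d (.ofNat n + 1 + 1) (.ofNat n + 1)).hom y = x
          rw [add_sub_cancel_right, hd] at hx
          rw [hd]
          exact ((hex n) x).mp hx
        · have : Subsingleton (F.X (Int.negSucc n + 1)) := hlt _ (by lia)
          exact ⟨0, Subsingleton.elim (α := F.X (Int.negSucc n + 1)) _ _⟩
      · exact HomologicalComplex.exactAt_single_obj _ _ _ _ hi
  refine ⟨F, ⟨⟨?_, 0, hlt⟩, ?_, ?_, π, hπ⟩, hinf, fun r ↦ ?_⟩
  · rintro (n | n)
    · exact hfin n
    · exact inferInstanceAs (Module.Finite R PUnit.{u + 1})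
  · rintro (n | n)
    · exact hfree n
    · exact inferInstanceAs (Module.Free R PUnit.{u + 1})
  · intro i
    obtain ⟨j, rfl⟩ : ∃ j, i = j + 1 := ⟨i - 1, by ring⟩
    rw [add_sub_cancel_right, hd]
    rcases j with n | n
    · exact hmin n
    · rintro x ⟨y, rfl⟩
      exact Submodule.zero_mem _
  · refine tailIdeal_le _ _ _ _ fun i hi ↦ ?_
    rw [hd]
    obtain ⟨n, rfl⟩ := Int.eq_ofNat_of_zero_le hi
    exact le_iSup (fun k ↦ minorsIdeal r (d k).hom) n

end Complexes

/-! ### The integral closure of a one-dimensional reduced ring -/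

section IntegralClosure

variable {R B K : Type*} [CommRing R] [CommRing B] [CommRing K] [Algebra R B] [Algebra B K]
  [Algebra R K] [IsScalarTower R B K] [IsFractionRing R K] [IsIntegralClosure B R K]

omit [IsIntegralClosure B R K] in
include K in
lemma algebraMap_integralClosure_injective : Function.Injective (algebraMap R B) :=
  .of_comp (f := algebraMap B K) <| by
    rw [← RingHom.coe_comp, ← IsScalarTower.algebraMap_eq]
    exact IsFractionRing.injective R K

include K in
/-- A non-zero-divisor of the integral closure divides a non-zero-divisor of the base ring. -/
lemma exists_dvd_algebraMap_of_mem_nonZeroDivisors {s : B} (hs : s ∈ nonZeroDivisors B) :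
    ∃ a ∈ nonZeroDivisors R, s ∣ algebraMap R B a := by
  have hinj := IsIntegralClosure.algebraMap_injective B R K
  have hRK := IsFractionRing.injective R K
  obtain ⟨⟨a, t⟩, h⟩ := IsLocalization.surj (nonZeroDivisors R) (algebraMap B K s)
  have hst : s * algebraMap R B t = algebraMap R B a := hinj <| by
    rw [map_mul, ← IsScalarTower.algebraMap_apply, ← IsScalarTower.algebraMap_apply]
    exact h
  refine ⟨a, ?_, ⟨_, hst.symm⟩⟩
  rw [mem_nonZeroDivisors_iff_right]
  intro r hr
  have h1 : algebraMap R B (r * t) * s = 0 := by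
    rw [map_mul, mul_assoc, mul_comm (algebraMap R B t), hst, ← map_mul, hr, map_zero]
  have h2 := (mem_nonZeroDivisors_iff_right.mp hs) _ h1
  have h3 : r * t = 0 := algebraMap_integralClosure_injective (K := K) (h2.trans (map_zero _).symm)
  exact (mem_nonZeroDivisors_iff_right.mp t.2) _ h3

include R in
lemma isUnit_algebraMap_of_mem_nonZeroDivisors {s : B} (hs : s ∈ nonZeroDivisors B) :
    IsUnit (algebraMap B K s) := by
  obtain ⟨a, ha, t, ht⟩ := exists_dvd_algebraMap_of_mem_nonZeroDivisors (R := R) (K := K) hs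
  have h1 : IsUnit (algebraMap R K a) := IsLocalization.map_units K ⟨a, ha⟩
  rw [IsScalarTower.algebraMap_apply R B K, ht, map_mul] at h1
  exact isUnit_of_mul_isUnit_left h1

include K in
lemma isMaximal_of_mem_nonZeroDivisors
    (hreg : ∀ p : Ideal R, p.IsPrime → ∀ a ∈ p, a ∈ nonZeroDivisors R → p.IsMaximal)
    (q : Ideal B) [q.IsPrime] {s : B} (hsq : s ∈ q) (hs : s ∈ nonZeroDivisors B) :
    q.IsMaximal := by
  obtain ⟨a, ha, hsa⟩ := exists_dvd_algebraMap_of_mem_nonZeroDivisors (R := R) (K := K) hs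
  have := IsIntegralClosure.isIntegral_algebra R (A := B) K
  exact Ideal.isMaximal_of_isIntegral_of_isMaximal_comap (R := R) q
    (hreg _ inferInstance a (Ideal.mem_of_dvd q hsa hsq) ha)

include R in
/-- An element of the fraction ring mapping a regular finitely generated ideal of the integral
closure to itself is integral. -/
lemma mem_range_of_mul_mem [IsNoetherianRing B] (I : Ideal B) {s : B} (hsI : s ∈ I)
    (hs : s ∈ nonZeroDivisors B) (w : K)
    (hw : ∀ z ∈ I, ∃ z' ∈ I, algebraMap B K z' = w * algebraMap B K z) :
    w ∈ Set.range (algebraMap B K) := by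
  have hinj := IsIntegralClosure.algebraMap_injective B R K
  choose! f hfI hf using hw
  let φ : I →ₗ[B] I :=
    { toFun := fun z ↦ ⟨f z, hfI z z.2⟩
      map_add' := fun x y ↦ Subtype.ext <| hinj <| by
        simp [hf _ (I.add_mem x.2 y.2), hf _ x.2, hf _ y.2, mul_add]
      map_smul' := fun c x ↦ Subtype.ext <| hinj <| by
        simp [hf _ (I.mul_mem_left c x.2), hf _ x.2, mul_left_comm] }
  have key (p : Polynomial B) (z : I) :
      algebraMap B K (Polynomial.aeval φ p z : I) = Polynomial.aeval w p * algebraMap B K z := by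
    induction p using Polynomial.induction_on' with
    | add p q hp hq => simp [hp, hq, add_mul]
    | monomial n a =>
      have hn (n : ℕ) : algebraMap B K ((φ ^ n) z : I) = w ^ n * algebraMap B K z := by
        induction n with
        | zero => simp
        | succ n ih =>
          rw [pow_succ', pow_succ', Module.End.mul_apply, mul_assoc, ← ih]
          exact hf _ ((φ ^ n) z).2
      simp [Polynomial.aeval_monomial, hn, mul_assoc]
  obtain ⟨p, hp, hp0⟩ := (Module.End.isIntegral (R := B) (M := I)).isIntegral φ
  have h0 : Polynomial.aeval w p = 0 := by
    have h1 := key p ⟨s, hsI⟩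
    rw [Polynomial.aeval_def, hp0] at h1
    simpa using ((isUnit_algebraMap_of_mem_nonZeroDivisors (R := R) (K := K) hs).mul_left_eq_zero).mp
      (by simpa using h1.symm)
  have := IsIntegralClosure.isIntegral_algebra R (A := B) K
  have hint : IsIntegral R w := isIntegral_trans (A := B) w ⟨p, hp, h0⟩
  exact (IsIntegralClosure.isIntegral_iff (A := B)).mp hint

/-- The regular ideals of the integral closure are invertible. -/
theorem exists_coeSubmodule_mul_eq_one [IsNoetherianRing B]
    (hreg : ∀ p : Ideal R, p.IsPrime → ∀ a ∈ p, a ∈ nonZeroDivisors R → p.IsMaximal)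
    (I : Ideal B) (hI : ∃ s ∈ I, s ∈ nonZeroDivisors B) :
    ∃ J : Submodule B K, IsLocalization.coeSubmodule K I * J = 1 := by
  have hinj := IsIntegralClosure.algebraMap_injective B R K
  induction I using IsNoetherian.induction with
  | hgt I ih =>
  by_cases hI1 : I = ⊤
  · exact ⟨1, by rw [hI1, IsLocalization.coeSubmodule_top, one_mul]⟩
  obtain ⟨s, hsI, hs⟩ := hI
  obtain ⟨q, hq, hIq⟩ := Ideal.exists_le_maximal I hI1
  -- The prime `q` is minimal over `s`, hence associated to `B ⧸ (s)`.
  have hqmin : q ∈ (Module.annihilator B (B ⧸ Ideal.span {s})).minimalPrimes := by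
    rw [Ideal.annihilator_quotient]
    refine ⟨⟨hq.isPrime, by simpa [Ideal.span_le] using hIq hsI⟩, fun p hp hpq ↦ ?_⟩
    have := hp.1
    have hpm := isMaximal_of_mem_nonZeroDivisors (K := K) hreg p
      (hp.2 (Ideal.mem_span_singleton_self s)) hs
    exact (hpm.eq_of_le hq.ne_top hpq).ge
  obtain ⟨-, x, hx⟩ := isAssociatedPrime_iff.mp
    (Module.associatedPrimes.minimalPrimes_annihilator_subset_associatedPrimes B _ hqmin)
  obtain ⟨b, rfl⟩ := Ideal.Quotient.mk_surjective x
  have hqb : ∀ z ∈ q, s ∣ z * b := fun z hz ↦ by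
    rw [hx, Submodule.mem_colon_singleton, Submodule.mem_bot, ← Ideal.Quotient.mk_eq_mk,
      ← Submodule.Quotient.mk_smul, Submodule.Quotient.mk_eq_zero, smul_eq_mul,
      Ideal.mem_span_singleton] at hz
    exact hz
  have hb : ¬ s ∣ b := fun h ↦ hq.ne_top <| by
    rw [Ideal.eq_top_iff_one, hx, Submodule.mem_colon_singleton, Submodule.mem_bot, one_smul,
      Ideal.Quotient.eq_zero_iff_mem, Ideal.mem_span_singleton]
    exact h
  obtain ⟨u, hu⟩ := isUnit_algebraMap_of_mem_nonZeroDivisors (R := R) (K := K) hs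
  -- The element `w = b / s` does not belong to `B`, but multiplies `q` into `B`.
  let w : K := algebraMap B K b * ↑u⁻¹
  have hws : w * algebraMap B K s = algebraMap B K b := by
    rw [← hu]; simp [w]
  have hwq : ∀ z ∈ q, ∃ z', algebraMap B K z' = w * algebraMap B K z := fun z hz ↦ by
    obtain ⟨z', hz'⟩ := hqb z hz
    refine ⟨z', ?_⟩
    rw [← u.mul_right_inj, hu, ← map_mul, ← hz', mul_left_comm, ← mul_assoc, hws, map_mul,
      mul_comm]
  have hw : w ∉ Set.range (algebraMap B K) := by
    rintro ⟨z, hz⟩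
    refine hb ⟨z, hinj ?_⟩
    rw [map_mul, hz, mul_comm, hws]
  let W : Submodule B K := 1 ⊔ Submodule.span B {w}
  let I' : Ideal B := (IsLocalization.coeSubmodule K I * W).comap (Algebra.linearMap B K)
  have hI' : IsLocalization.coeSubmodule K I' = IsLocalization.coeSubmodule K I * W := by
    refine Submodule.map_comap_eq_of_le ?_
    rw [Submodule.mul_sup, mul_one, sup_le_iff]
    constructor
    · rintro _ ⟨y, -, rfl⟩
      exact ⟨y, rfl⟩
    · rw [Submodule.mul_le]
      rintro _ ⟨y, hy, rfl⟩ z hz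
      obtain ⟨c, rfl⟩ := Submodule.mem_span_singleton.mp hz
      obtain ⟨z', hz'⟩ := hwq y (hIq hy)
      refine ⟨c * z', ?_⟩
      rw [Algebra.linearMap_apply, map_mul, hz', Algebra.linearMap_apply, Algebra.smul_def]
      ring
  have hII' : I ≤ I' := fun z hz ↦ by
    change algebraMap B K z ∈ IsLocalization.coeSubmodule K I * W
    rw [Submodule.mul_sup, mul_one]
    exact Submodule.mem_sup_left ⟨z, hz, rfl⟩
  have hne : I ≠ I' := fun h ↦ hw <| by
    refine mem_range_of_mul_mem (R := R) I hsI hs w fun z hz ↦ ?_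
    obtain ⟨z', hz'⟩ := hwq z (hIq hz)
    refine ⟨z', ?_, hz'⟩
    rw [h]
    change algebraMap B K z' ∈ IsLocalization.coeSubmodule K I * W
    rw [hz', Submodule.mul_sup, mul_comm w]
    exact Submodule.mem_sup_right (Submodule.mul_mem_mul ⟨z, hz, rfl⟩
      (Submodule.mem_span_singleton_self w))
  obtain ⟨J, hJ⟩ := ih I' (lt_of_le_of_ne hII' hne) ⟨s, hII' hsI, hs⟩
  exact ⟨W * J, by rw [← mul_assoc, ← hI', hJ]⟩

/-- In a reduced Noetherian ring the ideal `I + ann I` is regular: it lies in no associated prime.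
-/
lemma exists_mem_sup_annihilator_mem_nonZeroDivisors {B : Type*} [CommRing B] [IsNoetherianRing B]
    [IsReduced B] (I : Ideal B) : ∃ s ∈ I ⊔ Submodule.annihilator I, s ∈ nonZeroDivisors B := by
  by_contra! h
  have h1 : ((I ⊔ Submodule.annihilator I : Ideal B) : Set B) ⊆
      ⋃ p ∈ ((associatedPrimes.finite B B).toFinset : Set (Ideal B)), (p : Set B) := by
    rw [Set.Finite.coe_toFinset]
    rw [biUnion_associatedPrimes_eq_compl_nonZeroDivisors]
    exact fun s hs ↦ h s hs
  rw [Ideal.subset_union_prime (f := fun p : Ideal B ↦ p) ⊥ ⊥ (fun p hp _ _ ↦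
    (((associatedPrimes.finite B B).mem_toFinset).mp hp).isPrime)] at h1
  obtain ⟨p, hp, hle⟩ := h1
  obtain ⟨hpp, z, rfl⟩ := isAssociatedPrime_iff.mp ((Set.Finite.mem_toFinset _).mp hp)
  have hz (x : B) (hx : x ∈ I ⊔ Submodule.annihilator I) : x * z = 0 := by
    simpa [Submodule.mem_colon_singleton] using hle hx
  have hz' : z ∈ Submodule.annihilator I := Submodule.mem_annihilator.mpr fun x hx ↦ by
    rw [smul_eq_mul, mul_comm]
    exact hz x (Ideal.mem_sup_left hx)
  have hz0 : z = 0 := IsReduced.eq_zero z ⟨2, by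
    rw [pow_two]; exact hz z (Ideal.mem_sup_right hz')⟩
  refine hpp.ne_top ?_
  rw [Ideal.eq_top_iff_one, Submodule.mem_colon_singleton, hz0]
  simp

include K in
/-- Every ideal of the reduced ring `B` is projective: regular ideals are invertible, and any ideal
is a direct summand of a regular one. -/
theorem projective_ideal [IsNoetherianRing B] [IsReduced B]
    (hreg : ∀ p : Ideal R, p.IsPrime → ∀ a ∈ p, a ∈ nonZeroDivisors R → p.IsMaximal)
    (I : Ideal B) : Module.Projective B I := by
  have hinj := IsIntegralClosure.algebraMap_injective B R K
  -- The ideal `I` is a direct summand of the regular ideal `I ⊕ ann I`.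
  let I' : Ideal B := Submodule.annihilator I
  have hmul {x y : B} (hx : x ∈ I) (hy : y ∈ I') : x * y = 0 := by
    rw [mul_comm]
    exact Submodule.mem_annihilator.mp hy x hx
  have hdisj {x : B} (hx : x ∈ I) (hy : x ∈ I') : x = 0 :=
    IsReduced.eq_zero x ⟨2, by rw [pow_two]; exact hmul hx hy⟩
  have hex := exists_mem_sup_annihilator_mem_nonZeroDivisors I
  obtain ⟨J, hJ⟩ := exists_coeSubmodule_mul_eq_one (K := K) hreg _ hex
  have : FaithfulSMul B K := (faithfulSMul_iff_algebraMap_injective B K).mpr hinj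
  have hproj : Module.Projective B (Submodule.map (Algebra.linearMap B K) (I ⊔ I')) :=
    Submodule.projective_of_isUnit (IsUnit.of_mul_eq_one J hJ)
  have hproj' : Module.Projective B (I ⊔ I' : Ideal B) :=
    Module.Projective.of_equiv
      (Submodule.equivMapOfInjective (Algebra.linearMap B K) hinj (I ⊔ I')).symm
  let e : (I × I') →ₗ[B] (I ⊔ I' : Ideal B) :=
    LinearMap.coprod (Submodule.inclusion le_sup_left) (Submodule.inclusion le_sup_right)
  have he (z : I × I') : (e z : B) = z.1 + z.2 := rfl
  have hbij : Function.Bijective e := by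
    constructor
    · rw [← LinearMap.ker_eq_bot, LinearMap.ker_eq_bot']
      rintro ⟨x, y⟩ hxy
      have h0 : (x : B) + y = 0 := congrArg Subtype.val hxy
      have hx : (x : B) = 0 := hdisj x.2 <| by
        rw [eq_neg_of_add_eq_zero_left h0]
        exact I'.neg_mem y.2
      have hy : (y : B) = 0 := by simpa [hx] using h0
      exact Prod.ext (Subtype.ext hx) (Subtype.ext hy)
    · rintro ⟨z, hz⟩
      obtain ⟨x, hx, y, hy, rfl⟩ := Submodule.mem_sup.mp hz
      exact ⟨(⟨x, hx⟩, ⟨y, hy⟩), rfl⟩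
  have : Module.Projective B (I × I') :=
    Module.Projective.of_equiv (LinearEquiv.ofBijective e hbij).symm
  exact Module.Projective.of_split (LinearMap.inl B I I') (LinearMap.fst B I I')
    (LinearMap.fst_comp_inl _ _ _)

/-- Over a hereditary ring all submodules of a free module of finite rank are projective. -/
theorem projective_submodule_pi (hB : ∀ I : Ideal B, Module.Projective B I) (n : ℕ)
    (L : Submodule B (Fin n → B)) : Module.Projective B L := by
  induction n with
  | zero =>
    have : Subsingleton L := ⟨fun x y ↦ Subtype.ext (Subsingleton.elim _ _)⟩
    infer_instance
  | succ n ih =>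
    let f : L →ₗ[B] B := LinearMap.proj 0 ∘ₗ L.subtype
    have h1 : Module.Projective B (LinearMap.range f) := hB _
    obtain ⟨s, hs⟩ := Module.projective_lifting_property f.rangeRestrict LinearMap.id
      f.surjective_rangeRestrict
    have hs' (y : LinearMap.range f) : f (s y) = y := congrArg Subtype.val (LinearMap.congr_fun hs y)
    let t : LinearMap.ker f →ₗ[B] (Fin n → B) :=
      LinearMap.funLeft B B Fin.succ ∘ₗ L.subtype ∘ₗ (LinearMap.ker f).subtype
    have ht : Function.Injective t := by
      intro x y hxy
      refine Subtype.ext (Subtype.ext (funext fun i ↦ ?_))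
      refine Fin.cases ?_ (fun j ↦ ?_) i
      · exact (show f x = 0 from x.2).trans (show f y = 0 from y.2).symm
      · exact congrFun hxy j
    have h2 : Module.Projective B (LinearMap.range t) := ih _
    have h3 : Module.Projective B (LinearMap.ker f) :=
      Module.Projective.of_equiv (LinearEquiv.ofInjective t ht).symm
    let i : L →ₗ[B] (LinearMap.ker f × LinearMap.range f) :=
      LinearMap.prod (LinearMap.codRestrict _ (LinearMap.id - s ∘ₗ f.rangeRestrict) fun z ↦ by
        simp [hs']) f.rangeRestrict
    refine Module.Projective.of_split i (LinearMap.coprod (LinearMap.ker f).subtype s) ?_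
    ext1 z
    simp [i]

include K in
/-- If `x` lies in the conductor, then multiplication by `x` on the image of a linear map `g`
between free modules of finite rank lifts through `g`: over the integral closure `g` becomes a
split surjection onto its image, and `x` times a splitting is defined over the base ring. -/
theorem exists_lift_smul_of_mem_conductor [Nontrivial R] [IsNoetherianRing B]
    [IsReduced B]
    (hreg : ∀ p : Ideal R, p.IsPrime → ∀ a ∈ p, a ∈ nonZeroDivisors R → p.IsMaximal)
    {x : R} (hx : ∀ b : B, ∃ r : R, algebraMap R B r = x • b) {F G : Type*} [AddCommGroup F]
    [Module R F] [Module.Free R F] [Module.Finite R F] [AddCommGroup G] [Module R G]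
    [Module.Free R G] [Module.Finite R G] (g : F →ₗ[R] G) :
    ∃ σ : LinearMap.range g →ₗ[R] F, ∀ z, g (σ z) = x • (z : G) := by
  have hinj : Function.Injective (algebraMap R B) := algebraMap_integralClosure_injective (K := K)
  choose h hh using hx
  let hx' : B →ₗ[R] R :=
    { toFun := h
      map_add' := fun a b ↦ hinj (by simp [hh])
      map_smul' := fun c a ↦ hinj (by simp [hh, Algebra.smul_def, mul_left_comm]) }
  let b := Module.Free.chooseBasis R F
  let c := Module.finBasis R G
  let n := Module.Free.ChooseBasisIndex R F
  let D := LinearMap.toMatrix b c g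
  let L := LinearMap.range (Matrix.mulVecLin (D.map (algebraMap R B)))
  have hL : Module.Projective B L := projective_submodule_pi (projective_ideal (K := K) hreg) _ L
  obtain ⟨s, hs⟩ := Module.projective_lifting_property
    (Matrix.mulVecLin (D.map (algebraMap R B))).rangeRestrict LinearMap.id
    (LinearMap.surjective_rangeRestrict _)
  have hs' (y : L) : (D.map (algebraMap R B)).mulVec (s y) = y :=
    congrArg Subtype.val (LinearMap.congr_fun hs y)
  have hg (v : F) (i) : (D.map (algebraMap R B)).mulVec (fun j ↦ algebraMap R B (b.repr v j)) i =
      algebraMap R B (c.repr (g v) i) := by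
    rw [← LinearMap.toMatrix_mulVec_repr b c g v]
    simp [Matrix.mulVec, dotProduct, D]
  -- The coordinates of the elements of the image of `g`, as elements of `L`.
  let ι : LinearMap.range g →ₗ[R] L :=
    { toFun := fun z ↦ ⟨fun i ↦ algebraMap R B (c.repr z i), by
        obtain ⟨_, v, rfl⟩ := z
        exact ⟨_, funext (hg v)⟩⟩
      map_add' := fun z w ↦ by ext i; simp
      map_smul' := fun r z ↦ by ext i; simp [Algebra.smul_def] }
  let σ : LinearMap.range g →ₗ[R] F := b.equivFun.symm.toLinearMap ∘ₗ
    LinearMap.pi fun j ↦ hx' ∘ₗ (LinearMap.proj j : (n → B) →ₗ[B] B).restrictScalars R ∘ₗ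
      s.restrictScalars R ∘ₗ ι
  have hσ (z : LinearMap.range g) (j) : b.repr (σ z) j = h (s (ι z) j) := by
    exact congrFun (b.equivFun.apply_symm_apply _) j
  refine ⟨σ, fun z ↦ c.ext_elem fun i ↦ hinj ?_⟩
  rw [← hg]
  simp only [hσ, hh]
  have : (fun j ↦ x • s (ι z) j) = x • s (ι z) := rfl
  rw [this, Matrix.mulVec_smul, hs']
  simp [ι, Algebra.smul_def]

end IntegralClosure

/-! ### Null-homotopies and tails of resolutions -/

section Homotopy

variable {R : Type u} [CommRing R]

lemma exists_comp_eq_of_exact {P M N L : Type*} [AddCommGroup P] [Module R P]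
    [Module.Projective R P] [AddCommGroup M] [Module R M] [AddCommGroup N] [Module R N]
    [AddCommGroup L] [Module R L] {f : N →ₗ[R] M} {g : M →ₗ[R] L} (hfg : Function.Exact f g)
    (h : P →ₗ[R] M) (hgh : ∀ v, g (h v) = 0) : ∃ τ : P →ₗ[R] N, ∀ v, f (τ v) = h v := by
  obtain ⟨τ, hτ⟩ := Module.projective_lifting_property f.rangeRestrict
    (h.codRestrict (LinearMap.range f) fun v ↦ (hfg (h v)).mp (hgh v))
    f.surjective_rangeRestrict
  exact ⟨τ, fun v ↦ congrArg Subtype.val (LinearMap.congr_fun hτ v)⟩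

/-- If multiplication by `x` on the image of `d₁` lifts through `d₁`, then multiplication by `x` is
null-homotopic in the next degree of an exact complex, so that `x` lies in the ideal generated by
the entries of the two differentials involved. -/
lemma mem_minorsIdeal_sup_of_lift [Nontrivial R] {F₀ F₁ F₂ F₃ : Type u}
    [AddCommGroup F₀] [Module R F₀]
    [AddCommGroup F₁] [Module R F₁] [Module.Free R F₁] [Module.Finite R F₁]
    [AddCommGroup F₂] [Module R F₂] [Module.Free R F₂] [Module.Finite R F₂]
    [AddCommGroup F₃] [Module R F₃] [Module.Free R F₃] [Module.Finite R F₃]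
    [Nontrivial F₂] {d₁ : F₁ →ₗ[R] F₀} {d₂ : F₂ →ₗ[R] F₁} {d₃ : F₃ →ₗ[R] F₂}
    (h₁ : Function.Exact d₂ d₁) (h₂ : Function.Exact d₃ d₂) {x : R}
    (hx : ∃ σ : LinearMap.range d₁ →ₗ[R] F₁, ∀ z, d₁ (σ z) = x • (z : F₀)) :
    x ∈ minorsIdeal 1 d₂ ⊔ minorsIdeal 1 d₃ := by
  obtain ⟨σ, hσ⟩ := hx
  obtain ⟨τ, hτ⟩ := exists_comp_eq_of_exact h₁ (x • LinearMap.id - σ ∘ₗ d₁.rangeRestrict)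
    fun v ↦ by simp [hσ]
  obtain ⟨τ', hτ'⟩ := exists_comp_eq_of_exact h₂ (x • LinearMap.id - τ ∘ₗ d₂) fun v ↦ by
    have h0 : d₁.rangeRestrict (d₂ v) = 0 := Subtype.ext (h₁.apply_apply_eq_zero v)
    simp [hτ, h0]
  let b := Module.Free.chooseBasis R F₂
  obtain ⟨j⟩ : Nonempty (Module.Free.ChooseBasisIndex R F₂) := b.index_nonempty
  have hj : x = (b.coord j ∘ₗ τ) (d₂ (b j)) + b.coord j (d₃ (τ' (b j))) := by
    rw [hτ']
    simp
  rw [hj]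
  exact add_mem (Ideal.mem_sup_left (apply_mem_minorsIdeal_one d₂ _ _))
    (Ideal.mem_sup_right (apply_mem_minorsIdeal_one d₃ _ _))

end Homotopy

section Stable

variable {R : Type u} [CommRing R]

lemma exact_of_isMinimalFreeResolution [IsLocalRing R] {F M : ChainComplex (ModuleCat.{u} R) ℤ}
    (hF : IsMinimalFreeResolution F M) (j : ℤ) (h : Subsingleton (M.homology j)) {i k : ℤ}
    (hi : i = j + 1) (hk : j = k + 1) :
    Function.Exact (F.d i j).hom (F.d j k).hom := by
  obtain rfl : k = j - 1 := by lia
  subst hi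
  obtain ⟨π, hπ⟩ := hF.quasiIso
  exact exact_of_subsingleton_homology F j (subsingleton_homology_of_quasiIso π j h)

/-- An element for which multiplication on images of maps of free modules lifts is contained in
all tail ideals of a resolution of a complex with bounded homology. -/
theorem mem_stableIdeal_of_lift [IsLocalRing R] {x : R}
    (hx : ∀ (F G : Type u) [AddCommGroup F] [Module R F] [Module.Free R F] [Module.Finite R F]
      [AddCommGroup G] [Module R G] [Module.Free R G] [Module.Finite R G] (g : F →ₗ[R] G),
      ∃ σ : LinearMap.range g →ₗ[R] F, ∀ z, g (σ z) = x • (z : G))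
    (M : ChainComplex (ModuleCat.{u} R) ℤ) (hM : IsBoundedBelowFGHomologyBounded M) :
    x ∈ stableIdeal M 1 := by
  simp only [stableIdeal, Submodule.mem_iInf]
  intro F hF n hn
  obtain ⟨b, hb⟩ := hM.homology_bounded
  let i : ℤ := max n b + 1
  have hni : n ≤ i := (le_max_left n b).trans (by lia)
  have hbi : b < i := lt_of_le_of_lt (le_max_right n b) (by lia)
  have hfree := hF.free
  have hfin := hF.finite
  rcases subsingleton_or_nontrivial (F.X (i + 1)) with h | h
  · rw [tailIdeal_eq_top F 1 (by lia : n < i + 1)]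
    trivial
  · have h1 := exact_of_isMinimalFreeResolution hF i (hb i hbi) (i := i + 1) (k := i - 1)
      rfl (by lia)
    have h2 := exact_of_isMinimalFreeResolution hF (i + 1) (hb _ (by lia)) (i := i + 1 + 1)
      (k := i) rfl rfl
    refine sup_le (minorsIdeal_le_tailIdeal F 1 hni) (minorsIdeal_le_tailIdeal F 1 ?_)
      (mem_minorsIdeal_sup_of_lift h1 h2 (hx _ _ _))
    lia

lemma isBoundedBelowFGHomologyBounded_moduleComplex (N : ModuleCat.{u} R) [Module.Finite R N] :
    IsBoundedBelowFGHomologyBounded (moduleComplex N) := by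
  have h (i : ℤ) (hi : i ≠ 0) : Subsingleton ((moduleComplex N).X i) :=
    ModuleCat.subsingleton_of_isZero (HomologicalComplex.isZero_single_obj_X _ _ _ _ hi)
  refine ⟨⟨fun i ↦ ?_, 0, fun i hi ↦ h i hi.ne⟩, 0, fun i hi ↦
    subsingleton_homology_moduleComplex N i hi.ne'⟩
  by_cases hi : i = 0
  · subst hi
    exact Module.Finite.equiv
      (HomologicalComplex.singleObjXSelf (ComplexShape.down ℤ) 0 N).toLinearEquiv.symm
  · have := h i hi
    infer_instance

/-- The tails of a minimal free resolution in large degrees are minimal free resolutions of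
modules. -/
theorem stableIdealComplexes_eq_stableIdealModules [IsLocalRing R] (r : ℕ) :
    stableIdealComplexes R r = stableIdealModules R r := by
  refine le_antisymm (le_iInf₂ fun N hN ↦
    iInf₂_le _ (isBoundedBelowFGHomologyBounded_moduleComplex N)) ?_
  refine le_iInf₂ fun M hM ↦ le_iInf₂ fun F hF ↦ ?_
  obtain ⟨b, hb⟩ := hM.homology_bounded
  let n : ℤ := max (infDegree F) b + 1
  have hn : infDegree F < n := lt_of_le_of_lt (le_max_left (infDegree F) b) (by lia)
  have hbn : b < n := lt_of_le_of_lt (le_max_right (infDegree F) b) (by lia)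
  have hfree := hF.free
  have hfin := hF.finite
  rcases subsingleton_or_nontrivial (F.X n) with h | h
  · rw [tailIdeal_eq_top F r hn]
    exact le_top
  let d (k : ℕ) : F.X (n + (k + 1 : ℕ)) ⟶ F.X (n + k) := F.d _ _
  let N : ModuleCat.{u} R := ModuleCat.of R (F.X (n + (0 : ℕ)) ⧸ LinearMap.range (d 0).hom)
  have hmin (i j : ℤ) (hij : i = j + 1) : LinearMap.range (F.d i j).hom ≤
      maximalIdeal R • (⊤ : Submodule R (F.X j)) := by
    obtain rfl : j = i - 1 := by lia
    exact hF.minimal i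
  obtain ⟨F', hF', hinf, htail⟩ := exists_isMinimalFreeResolution
    (fun k ↦ F.X (n + k)) d N (ModuleCat.ofHom (Submodule.mkQ _)) (fun _ ↦ hfin _)
    (fun _ ↦ hfree _) (fun k ↦ hmin _ _ (by push_cast; ring))
    (fun k ↦ exact_of_isMinimalFreeResolution hF _ (hb _ (by lia)) (by push_cast; ring)
      (by push_cast; ring)) (Submodule.mkQ_surjective _) (LinearMap.exact_map_mkQ_range _)
    (by simpa using h)
  have hN : Module.Finite R N := inferInstanceAs (Module.Finite R (_ ⧸ _))
  calc stableIdealModules R r ≤ totalIdeal (moduleComplex N) r := iInf₂_le N hN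
    _ ≤ tailIdeal F' (infDegree F') r := iInf₂_le F' hF'
    _ ≤ ⨆ k, minorsIdeal r (d k).hom := hinf ▸ htail r
    _ ≤ tailIdeal F (infDegree F) r := iSup_le fun k ↦ ?_
  have h1 (i j : ℤ) (hij : i = j + 1) (hj : infDegree F ≤ j) :
      minorsIdeal r (F.d i j).hom ≤ tailIdeal F (infDegree F) r := by
    subst hij
    exact minorsIdeal_le_tailIdeal F r hj
  exact h1 _ _ (by push_cast; ring) (by lia)

end Stable

/-! ### Complete local rings -/

section Complete

variable {A : Type*} [CommRing A] {m : Ideal A}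

lemma eq_zero_of_forall_mem_pow [IsHausdorff m A] {a : A} (h : ∀ n, a ∈ m ^ n) : a = 0 :=
  IsHausdorff.haus' (I := m) a fun n ↦ by
    rw [SModEq.zero, smul_eq_mul, Ideal.mul_top]
    exact h n

lemma exists_forall_sub_mem_pow [IsPrecomplete m A] (f : ℕ → A)
    (hf : ∀ n, f (n + 1) - f n ∈ m ^ n) : ∃ L, ∀ n, L - f n ∈ m ^ n := by
  have h {i j : ℕ} (hij : i ≤ j) : f j - f i ∈ m ^ i := by
    induction j, hij using Nat.le_induction with
    | base => simp
    | succ j hij ih =>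
      rw [← sub_add_sub_cancel (f (j + 1)) (f j)]
      exact add_mem (Ideal.pow_le_pow_right hij (hf j)) ih
  obtain ⟨L, hL⟩ := IsPrecomplete.prec' (I := m) f fun {i j} hij ↦ by
    rw [SModEq.sub_mem, smul_eq_mul, Ideal.mul_top, ← neg_sub]
    exact neg_mem (h hij)
  refine ⟨L, fun n ↦ ?_⟩
  have := hL n
  rw [SModEq.sub_mem, smul_eq_mul, Ideal.mul_top, ← neg_sub] at this
  exact neg_mem_iff.mp this

/-- Power series in an element `x` of the ideal of definition can be evaluated; `L n` is the value
of the series with coefficients `c n, c (n + 1), …`. -/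
lemma exists_eq_add_mul_succ [IsAdicComplete m A] {x : A} (hx : x ∈ m) (c : ℕ → A) :
    ∃ L : ℕ → A, ∀ n, L n = c n + x * L (n + 1) := by
  have h (n : ℕ) : ∃ L, ∀ k, L - ∑ i ∈ Finset.range k, c (n + i) * x ^ i ∈ m ^ k :=
    exists_forall_sub_mem_pow _ fun k ↦ by
      rw [Finset.sum_range_succ, add_sub_cancel_left]
      exact Ideal.mul_mem_left _ _ (Ideal.pow_mem_pow hx k)
  choose L hL using h
  refine ⟨L, fun n ↦ sub_eq_zero.mp (eq_zero_of_forall_mem_pow (m := m) fun k ↦ ?_)⟩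
  have h1 := Ideal.pow_le_pow_right (Nat.le_succ k) (hL n (k + 1))
  have h2 := Ideal.mul_mem_left _ x (hL (n + 1) k)
  rw [Finset.sum_range_succ'] at h1
  have h3 : ∑ i ∈ Finset.range k, c (n + (i + 1)) * x ^ (i + 1) =
      x * ∑ i ∈ Finset.range k, c (n + 1 + i) * x ^ i := by
    rw [Finset.mul_sum]
    refine Finset.sum_congr rfl fun i _ ↦ ?_
    rw [show n + (i + 1) = n + 1 + i by ring]
    ring
  rw [h3] at h1
  have h4 := sub_mem h1 h2
  ring_nf at h4 ⊢
  exact h4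

/-- Nakayama's lemma for ideals of a complete ring, without finiteness assumption on the ideal. -/
lemma le_span_of_le_span_sup_mul [IsAdicComplete m A] {x : A} (hx : x ∈ m) {r : ℕ}
    (g : Fin r → A) (Q : Ideal A)
    (h : ∀ q ∈ Q, ∃ a ∈ Ideal.span (Set.range g), ∃ q' ∈ Q, q = a + x * q') :
    Q ≤ Ideal.span (Set.range g) := by
  have h' (q : Q) : ∃ (a : Fin r → A) (q' : Q), (q : A) = ∑ i, a i * g i + x * q' := by
    obtain ⟨b, hb, q', hq', e⟩ := h q q.2
    obtain ⟨a, rfl⟩ := Ideal.mem_span_range_iff_exists_fun.mp hb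
    exact ⟨a, ⟨q', hq'⟩, e⟩
  choose a t ht using h'
  intro q hq
  let s : ℕ → Q := fun n ↦ t^[n] ⟨q, hq⟩
  have hs (n : ℕ) : (s n : A) = ∑ i, a (s n) i * g i + x * s (n + 1) := by
    simp only [s, Function.iterate_succ_apply']
    exact ht _
  choose L hL using fun i ↦ exists_eq_add_mul_succ hx fun n ↦ a (s n) i
  let e (n : ℕ) : A := s n - ∑ i, L i n * g i
  have he (n : ℕ) : e n = x * e (n + 1) := by
    simp only [e]
    rw [hs n, mul_sub, Finset.mul_sum, add_sub_right_comm, ← Finset.sum_sub_distrib,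
      add_comm, ← sub_neg_eq_add, ← Finset.sum_neg_distrib]
    congr 1
    refine Finset.sum_congr rfl fun i _ ↦ ?_
    rw [hL i n]
    ring
  have he' (n : ℕ) : e 0 = x ^ n * e n := by
    induction n with
    | zero => simp
    | succ n ih => rw [ih, he n]; ring
  have h0 : e 0 = 0 := eq_zero_of_forall_mem_pow (m := m) fun n ↦ by
    rw [he' n]
    exact Ideal.mul_mem_right _ _ (Ideal.pow_mem_pow hx n)
  rw [show q = ∑ i, L i 0 * g i from sub_eq_zero.mp h0]
  exact Ideal.mem_span_range_iff_exists_fun.mpr ⟨fun i ↦ L i 0, rfl⟩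

/-- If `Q` is saturated with respect to `x`, generators of `Q` modulo `x` generate `Q`. -/
lemma le_span_of_le_span_sup_span [IsAdicComplete m A] {x : A} (hx : x ∈ m) {r : ℕ}
    (g : Fin r → A) (Q : Ideal A) (hg : ∀ i, g i ∈ Q) (hQ : ∀ q, x * q ∈ Q → q ∈ Q)
    (h : Q ≤ Ideal.span (Set.range g) ⊔ Ideal.span {x}) :
    Q ≤ Ideal.span (Set.range g) := by
  refine le_span_of_le_span_sup_mul hx g Q fun q hq ↦ ?_
  obtain ⟨a, ha, b, hb, rfl⟩ := Submodule.mem_sup.mp (h hq)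
  obtain ⟨c, rfl⟩ := Ideal.mem_span_singleton'.mp hb
  refine ⟨a, ha, c, hQ c ?_, by ring⟩
  rw [mul_comm]
  exact (Submodule.add_mem_iff_right Q (Ideal.span_le.mpr (by rintro _ ⟨i, rfl⟩; exact hg i) ha)).mp
    hq

/-- A complete ring is Noetherian if it is so modulo an element `x` of the ideal of definition: a
prime ideal contains `x` or is saturated with respect to `x`. -/
lemma isNoetherianRing_of_isAdicComplete [IsAdicComplete m A] {x : A} (hx : x ∈ m)
    (h : ∀ Q : Ideal A, ∃ (r : ℕ) (g : Fin r → A), (∀ i, g i ∈ Q) ∧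
      Q ≤ Ideal.span (Set.range g) ⊔ Ideal.span {x}) : IsNoetherianRing A := by
  refine IsNoetherianRing.of_prime fun Q hQ ↦ ?_
  obtain ⟨r, g, hg, hle⟩ := h Q
  have hge : Ideal.span (Set.range g) ≤ Q := Ideal.span_le.mpr (by rintro _ ⟨i, rfl⟩; exact hg i)
  by_cases hxQ : x ∈ Q
  · have : Q = Ideal.span (Set.range g) ⊔ Ideal.span {x} :=
      le_antisymm hle (sup_le hge (by simpa [Ideal.span_le] using hxQ))
    rw [this]
    exact Submodule.FG.sup (Submodule.fg_span (Set.finite_range g))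
      (Submodule.fg_span_singleton x)
  · have : Q = Ideal.span (Set.range g) := le_antisymm
      (le_span_of_le_span_sup_span hx g Q hg (fun q hq ↦ (hQ.mem_or_mem hq).resolve_left hxQ) hle)
      hge
    rw [this]
    exact Submodule.fg_span (Set.finite_range g)

end Complete

/-! ### Regular ideals of one-dimensional rings -/

section Regular

variable {A : Type*} [CommRing A]

lemma isMaximal_of_mem_nonZeroDivisors_of_krullDimLE [Ring.KrullDimLE 1 A] (p : Ideal A)
    (hp : p.IsPrime) (a : A) (ha : a ∈ p) (ha' : a ∈ nonZeroDivisors A) : p.IsMaximal :=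
  (Ring.krullDimLE_one_iff.mp inferInstance p hp).resolve_left fun h ↦
    Set.disjoint_left.mp (Ideal.disjoint_nonZeroDivisors_of_mem_minimalPrimes h) ha ha'

variable [IsNoetherianRing A]

lemma isArtinianRing_quotient_of_mem_nonZeroDivisors
    (hreg : ∀ p : Ideal A, p.IsPrime → ∀ a ∈ p, a ∈ nonZeroDivisors A → p.IsMaximal)
    (I : Ideal A) {s : A} (hs : s ∈ I) (hs' : s ∈ nonZeroDivisors A) : IsArtinianRing (A ⧸ I) := by
  rw [isArtinianRing_iff_isNoetherianRing_krullDimLE_zero]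
  refine ⟨inferInstance, .mk₀ fun p hp ↦ ?_⟩
  have h1 := hreg (p.comap (Ideal.Quotient.mk I)) inferInstance s
    (by rw [Ideal.mem_comap, Ideal.Quotient.eq_zero_iff_mem.mpr hs]; exact p.zero_mem) hs'
  have h2 : ((p.comap (Ideal.Quotient.mk I)).map (Ideal.Quotient.mk I)).IsMaximal :=
    Ideal.IsMaximal.map_of_surjective_of_ker_le Ideal.Quotient.mk_surjective
      (Ideal.comap_mono bot_le)
  rwa [Ideal.map_comap_of_surjective _ Ideal.Quotient.mk_surjective] at h2

omit [IsNoetherianRing A] in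
lemma exists_forall_sup_eq (I : Ideal A) [IsArtinianRing (A ⧸ I)] (J : ℕ → Ideal A)
    (hJ : Antitone J) : ∃ n, ∀ k, n ≤ k → J k ⊔ I = J n ⊔ I := by
  obtain ⟨n, hn⟩ := IsArtinian.monotone_stabilizes (R := A ⧸ I) (M := A ⧸ I)
    ⟨fun k ↦ OrderDual.toDual ((J k).map (Ideal.Quotient.mk I)),
      fun i j hij ↦ Ideal.map_mono (hJ hij)⟩
  refine ⟨n, fun k hk ↦ ?_⟩
  have h1 : (J n).map (Ideal.Quotient.mk I) = (J k).map (Ideal.Quotient.mk I) := hn k hk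
  have h2 := congrArg (Ideal.comap (Ideal.Quotient.mk I)) h1
  rw [Ideal.comap_map_of_surjective' _ Ideal.Quotient.mk_surjective,
    Ideal.comap_map_of_surjective' _ Ideal.Quotient.mk_surjective, Ideal.mk_ker] at h2
  exact h2.symm

end Regular

/-! ### Finiteness of the integral closure of analytically unramified rings -/

section Finiteness

variable {A K : Type*} [CommRing A] [IsLocalRing A] [CommRing K] [Algebra A K]

/-- An idempotent `e` with `e / x` integral over `A` vanishes, as `e` is then a multiple of `x` in
the integral closure, where `x` lies in the Jacobson radical. -/
lemma eq_zero_of_isIdempotentElem_of_isIntegral_mul {x : A} (hx : x ∈ maximalIdeal A) {e y : K}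
    (he : e * e = e) (hy : algebraMap A K x * y = 1) (hey : IsIntegral A (e * y)) : e = 0 := by
  let V := integralClosure A K
  let w : V := ⟨e * y, hey⟩
  have hw : algebraMap A K x * (w : K) = e := by
    change algebraMap A K x * (e * y) = e
    rw [mul_left_comm, hy, mul_one]
  let e' : V := algebraMap A V x * w
  have he' : (e' : K) = e := hw
  have hjac : e' ∈ Ideal.jacobson (⊥ : Ideal V) := by
    refine Ideal.mul_mem_right _ _ ?_
    rw [Ideal.jacobson, Ideal.mem_sInf]
    rintro M ⟨-, hM⟩
    have := eq_maximalIdeal (Ideal.isMaximal_comap_of_isIntegral_of_isMaximal (R := A) M)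
    rw [← this] at hx
    exact hx
  have hu := Ideal.mem_jacobson_bot.mp hjac (-1)
  have h0 : e' * (e' * -1 + 1) = 0 := Subtype.ext <| by
    push_cast
    rw [he', mul_add, ← mul_assoc, he]
    simp
  rw [← he', (hu.mul_left_eq_zero).mp h0]
  rfl

variable [IsNoetherianRing A] [IsFractionRing A K]
  (hreg : ∀ p : Ideal A, p.IsPrime → ∀ a ∈ p, a ∈ nonZeroDivisors A → p.IsMaximal)

omit [IsNoetherianRing A] in
include hreg in
lemma exists_dvd_pow_of_mem_nonZeroDivisors {x s : A} (hx : x ∈ maximalIdeal A)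
    (hs : s ∈ nonZeroDivisors A) : ∃ k, s ∣ x ^ k := by
  have h : x ∈ (Ideal.span {s}).radical := by
    rw [Ideal.radical_eq_sInf, Ideal.mem_sInf]
    rintro p ⟨hsp, hp⟩
    rwa [eq_maximalIdeal (hreg p hp s (hsp (Ideal.mem_span_singleton_self s)) hs)]
  obtain ⟨k, hk⟩ := h
  exact ⟨k, Ideal.mem_span_singleton.mp hk⟩

include hreg in
/-- In a reduced ring no nonzero element is integrally divisible by all powers of `x`. -/
lemma eq_zero_of_forall_isIntegral_mul_pow [IsReduced A] {x : A} (hx : x ∈ maximalIdeal A) {y : K}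
    (hy : algebraMap A K x * y = 1) {z : A}
    (hz : ∀ n, IsIntegral A (algebraMap A K z * y ^ n)) : z = 0 := by
  have hinj := IsFractionRing.injective A K
  obtain ⟨s, hs, hs'⟩ := exists_mem_sup_annihilator_mem_nonZeroDivisors (Ideal.span {z})
  obtain ⟨z', hz', b, hb, rfl⟩ := Submodule.mem_sup.mp hs
  obtain ⟨c, rfl⟩ := Ideal.mem_span_singleton'.mp hz'
  have hbz : b * z = 0 := Submodule.mem_annihilator.mp hb z (Ideal.mem_span_singleton_self z)
  obtain ⟨k, g, hg⟩ := exists_dvd_pow_of_mem_nonZeroDivisors hreg hx hs'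
  -- The idempotent `e` generates the same ideal of `K` as `z`.
  let e : K := algebraMap A K (c * z * g) * y ^ k
  have h1 : algebraMap A K (c * z + b) * (algebraMap A K g * y ^ k) = 1 := by
    rw [← mul_assoc, ← map_mul, ← hg, map_pow, ← mul_pow, hy, one_pow]
  have h2 : (c * z) * (c * z) = (c * z) * (c * z + b) := by linear_combination (- c) * hbz
  have he : e * e = e := by
    calc e * e = algebraMap A K ((c * z) * (c * z)) * (algebraMap A K g * y ^ k) *
          (algebraMap A K g * y ^ k) := by simp only [e, map_mul]; ring
      _ = e * (algebraMap A K (c * z + b) * (algebraMap A K g * y ^ k)) := by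
        rw [h2]; simp only [e, map_mul]; ring
      _ = e := by rw [h1, mul_one]
  have hey : IsIntegral A (e * y) := by
    have : e * y = algebraMap A K (c * g) * (algebraMap A K z * y ^ (k + 1)) := by
      simp only [e, map_mul]; ring
    rw [this]
    exact isIntegral_algebraMap.mul (hz _)
  have he0 := eq_zero_of_isIdempotentElem_of_isIntegral_mul hx he hy hey
  have hcz : c * z = 0 := hinj <| by
    calc algebraMap A K (c * z) = e * algebraMap A K (c * z + b) := by
          rw [← mul_one (algebraMap A K (c * z)), ← h1]; simp only [e, map_mul]; ring
      _ = algebraMap A K 0 := by rw [he0, zero_mul, map_zero]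
  rw [hcz, zero_add] at hs'
  exact (mem_nonZeroDivisors_iff.mp hs').1 z hbz

include hreg in
/-- Chevalley's theorem: in a complete local ring, a decreasing sequence of ideals with zero
intersection is eventually contained in a given ideal of finite colength, here `(x)`. -/
lemma exists_le_span_singleton_of_antitone [IsAdicComplete (maximalIdeal A) A] {x : A}
    (hx : x ∈ nonZeroDivisors A) (J : ℕ → Ideal A) (hJ : Antitone J)
    (hJ0 : ∀ z, (∀ n, z ∈ J n) → z = 0) : ∃ n, J n ≤ Ideal.span {x} := by
  have hart (k : ℕ) : IsArtinianRing (A ⧸ Ideal.span {x ^ k}) :=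
    isArtinianRing_quotient_of_mem_nonZeroDivisors hreg _ (Ideal.mem_span_singleton_self _)
      (pow_mem hx k)
  have hart1 : IsArtinianRing (A ⧸ Ideal.span {x}) :=
    isArtinianRing_quotient_of_mem_nonZeroDivisors hreg _ (Ideal.mem_span_singleton_self _) hx
  choose N hN using fun k ↦ exists_forall_sup_eq (Ideal.span {x ^ k}) J hJ
  let L (k : ℕ) : Ideal A := J (N k) ⊔ Ideal.span {x ^ k}
  have hL (k n : ℕ) : L k ≤ J n ⊔ Ideal.span {x ^ k} := by
    rcases le_total (N k) n with h | h
    · exact (hN k n h).ge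
    · exact sup_le_sup_right (hJ h) _
  have hstep (k : ℕ) (z : A) (hz : z ∈ L k) : ∃ z' ∈ L (k + 1), z' - z ∈ Ideal.span {x ^ k} := by
    obtain ⟨a, ha, b, hb, rfl⟩ := Submodule.mem_sup.mp (hL k (N (k + 1)) hz)
    exact ⟨a, Ideal.mem_sup_left ha, by simpa using neg_mem hb⟩
  by_contra! hne
  obtain ⟨z₁, hz₁, hz₁x⟩ := Set.not_subset.mp (hne (N 1))
  choose! f hfL hf using hstep
  let z (n : ℕ) : A := Nat.rec z₁ (fun k w ↦ f (k + 1) w) n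
  have hzL (n : ℕ) : z n ∈ L (n + 1) := by
    induction n with
    | zero => exact Ideal.mem_sup_left hz₁
    | succ n ih => exact hfL _ _ ih
  have hzs (n : ℕ) : z (n + 1) - z n ∈ Ideal.span {x ^ (n + 1)} := hf _ _ (hzL n)
  have hxm : x ∈ maximalIdeal A := by
    by_contra hxu
    refine hz₁x ?_
    rw [Ideal.span_singleton_eq_top.mpr (by simpa using hxu)]
    trivial
  have hpow (n : ℕ) : Ideal.span {x ^ (n + 1)} ≤ maximalIdeal A ^ n := by
    rw [Ideal.span_singleton_le_iff_mem]
    exact Ideal.pow_le_pow_right n.le_succ (Ideal.pow_mem_pow hxm _)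
  obtain ⟨w, hw⟩ := exists_forall_sub_mem_pow (m := maximalIdeal A) z fun n ↦ hpow n (hzs n)
  have hwJ (n : ℕ) : w ∈ J n := by
    rw [← Submodule.Quotient.mk_eq_zero]
    refine IsHausdorff.haus' (I := maximalIdeal A) _ fun k ↦ ?_
    rw [SModEq.zero]
    obtain ⟨a, ha, b, hb, hab⟩ := Submodule.mem_sup.mp (hL (k + 1) n (hzL k))
    have : w = a + ((w - z k) + b) := by rw [← hab]; ring
    rw [this, Submodule.Quotient.mk_add, (Submodule.Quotient.mk_eq_zero _).mpr ha, zero_add]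
    have h2 : (w - z k) + b ∈ maximalIdeal A ^ k := add_mem (hw k) (hpow k hb)
    rw [← mul_one ((w - z k) + b), ← smul_eq_mul, Submodule.Quotient.mk_smul]
    exact Submodule.smul_mem_smul h2 trivial
  obtain ⟨k, hk⟩ := exists_maximalIdeal_pow_le_of_isArtinianRing_quotient (Ideal.span {x})
  have hzk (n : ℕ) : z n - z₁ ∈ Ideal.span {x} := by
    induction n with
    | zero => simp [z]
    | succ n ih =>
      rw [← sub_add_sub_cancel _ (z n)]
      refine add_mem (Ideal.span_singleton_le_span_singleton.mpr ?_ (hzs n)) ih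
      exact dvd_pow_self x n.succ_ne_zero
  refine hz₁x ?_
  have := sub_mem (hk (hw k)) (neg_mem (hzk k))
  rw [hJ0 w hwJ] at this
  have h3 := neg_mem this
  ring_nf at h3
  exact h3

include hreg in
/-- In a complete reduced local ring of dimension one, the denominators of integral elements are
bounded. -/
lemma exists_forall_mem_span_pow_of_isIntegral [IsAdicComplete (maximalIdeal A) A] [IsReduced A]
    {x : A} (hx : x ∈ maximalIdeal A) {y : K} (hy : algebraMap A K x * y = 1) :
    ∃ n, ∀ k a, IsIntegral A (algebraMap A K a * y ^ (n + k)) → a ∈ Ideal.span {x ^ k} := by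
  have hinj := IsFractionRing.injective A K
  have hx0 : x ∈ nonZeroDivisors A := by
    rw [mem_nonZeroDivisors_iff_right]
    intro a ha
    refine hinj ?_
    rw [← mul_one (algebraMap A K a), ← hy, ← mul_assoc, ← map_mul, ha]
    simp
  have hxy (a : A) (k : ℕ) : algebraMap A K (x * a) * y ^ (k + 1) = algebraMap A K a * y ^ k := by
    rw [map_mul, pow_succ']
    linear_combination (algebraMap A K a * y ^ k) * hy
  let J (n : ℕ) : Ideal A :=
    { carrier := {a | IsIntegral A (algebraMap A K a * y ^ n)}
      add_mem' := fun {a b} ha hb ↦ by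
        rw [Set.mem_ofPred_eq, map_add, add_mul]
        exact IsIntegral.add ha hb
      zero_mem' := by simpa using isIntegral_zero
      smul_mem' := fun c a ha ↦ by
        rw [Set.mem_ofPred_eq, smul_eq_mul, map_mul, mul_assoc]
        exact isIntegral_algebraMap.mul ha }
  have hJ : Antitone J := antitone_nat_of_succ_le fun n a ha ↦ by
    change IsIntegral A (algebraMap A K a * y ^ n)
    rw [← hxy, map_mul, mul_assoc]
    exact isIntegral_algebraMap.mul ha
  obtain ⟨n, hn⟩ := exists_le_span_singleton_of_antitone hreg hx0 J hJ fun z hz ↦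
    eq_zero_of_forall_isIntegral_mul_pow hreg hx hy hz
  refine ⟨n, fun k ↦ ?_⟩
  induction k with
  | zero => simp
  | succ k ih =>
    intro a ha
    obtain ⟨b, rfl⟩ := Ideal.mem_span_singleton.mp (hn (hJ (Nat.le_add_right n (k + 1)) ha))
    rw [← add_assoc, hxy] at ha
    obtain ⟨c, rfl⟩ := Ideal.mem_span_singleton.mp (ih b ha)
    exact Ideal.mem_span_singleton.mpr ⟨c, by ring⟩

end Finiteness

/-! ### Completions of local rings -/

section Completion

variable {R : Type u} [CommRing R] [IsLocalRing R] [IsNoetherianRing R]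

lemma mem_pow_maximalIdeal_of_evalₐ_eq_zero {n : ℕ} {a : AdicCompletion (maximalIdeal R) R}
    (h : AdicCompletion.evalₐ (maximalIdeal R) n a = 0) :
    a ∈ maximalIdeal (AdicCompletion (maximalIdeal R) R) ^ n := by
  have h1 : a ∈ (AdicCompletion.eval (maximalIdeal R) R n).ker := by
    rw [LinearMap.mem_ker, ← AdicCompletion.factor_evalₐ_eq_eval (maximalIdeal R) a
      (by rw [smul_eq_mul, Ideal.mul_top]), h, map_zero]
  rw [← AdicCompletion.pow_smul_top_eq_ker_eval (IsNoetherian.noetherian _)] at h1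
  rw [AdicCompletion.maximalIdeal_eq_map, ← Ideal.map_pow]
  refine Submodule.smul_induction_on h1 (fun r hr b _ ↦ ?_) fun b c hb hc ↦ add_mem hb hc
  rw [Algebra.smul_def]
  exact Ideal.mul_mem_right _ _ (Ideal.mem_map_of_mem _ hr)

lemma algebraMap_adicCompletion_injective :
    Function.Injective (algebraMap R (AdicCompletion (maximalIdeal R) R)) :=
  AdicCompletion.of_injective (maximalIdeal R) R

lemma algebraMap_mem_nonZeroDivisors {x : R} (hx : x ∈ nonZeroDivisors R) :
    algebraMap R (AdicCompletion (maximalIdeal R) R) x ∈ nonZeroDivisors _ := by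
  have h := Module.Flat.isSMulRegular_of_nonZeroDivisors (M := AdicCompletion (maximalIdeal R) R) hx
  rw [mem_nonZeroDivisors_iff_right]
  intro a ha
  refine h ?_
  simp only [smul_zero]
  rw [Algebra.smul_def, mul_comm, ha]

omit [IsNoetherianRing R] in
lemma mem_of_algebraMap_mem_map {I : Ideal R} {k : ℕ} (hk : maximalIdeal R ^ k ≤ I) {r : R}
    (h : algebraMap R (AdicCompletion (maximalIdeal R) R) r ∈
      I.map (algebraMap R (AdicCompletion (maximalIdeal R) R))) : r ∈ I := by
  have h1 := Ideal.mem_map_of_mem (AdicCompletion.evalₐ (maximalIdeal R) k).toRingHom h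
  rw [Ideal.map_map, AlgHom.toRingHom_eq_coe, AlgHom.comp_algebraMap] at h1
  have h2 : (AdicCompletion.evalₐ (maximalIdeal R) k) (algebraMap R _ r) =
      Ideal.Quotient.mk _ r := AlgHom.commutes _ _
  rw [RingHom.coe_coe, h2] at h1
  have h3 : r ∈ (I.map (Ideal.Quotient.mk (maximalIdeal R ^ k))).comap (Ideal.Quotient.mk _) := h1
  rwa [Ideal.comap_map_of_surjective' _ Ideal.Quotient.mk_surjective, Ideal.mk_ker,
    sup_of_le_left hk] at h3

variable {x : R} {k : ℕ} (hx : x ∈ maximalIdeal R) (hk : maximalIdeal R ^ k ≤ Ideal.span {x})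

include hk in
lemma pow_maximalIdeal_adicCompletion_le :
    maximalIdeal (AdicCompletion (maximalIdeal R) R) ^ k ≤ Ideal.span {algebraMap R _ x} := by
  rw [AdicCompletion.maximalIdeal_eq_map, ← Ideal.map_pow, ← Set.image_singleton,
    ← Ideal.map_span]
  exact Ideal.map_mono hk

include hx hk in
lemma isNoetherianRing_adicCompletion :
    IsNoetherianRing (AdicCompletion (maximalIdeal R) R) := by
  let φ := (AdicCompletion.evalₐ (maximalIdeal R) k).toRingHom
  have hφ : Function.Surjective φ := AdicCompletion.surjective_evalₐ _ _
  refine isNoetherianRing_of_isAdicComplete (m := maximalIdeal _)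
    (x := algebraMap R (AdicCompletion (maximalIdeal R) R) x) ?_ fun Q ↦ ?_
  · rw [AdicCompletion.maximalIdeal_eq_map]
    exact Ideal.mem_map_of_mem _ hx
  · obtain ⟨r, g, hg⟩ := Submodule.fg_iff_exists_fin_generating_family.mp
      (IsNoetherian.noetherian (Q.map φ))
    have hg' (i) : ∃ q ∈ Q, φ q = g i := by
      rw [← Ideal.mem_map_iff_of_surjective φ hφ, ← hg]
      exact Submodule.subset_span ⟨i, rfl⟩
    choose f hfQ hf using hg'
    refine ⟨r, f, hfQ, fun q hq ↦ ?_⟩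
    have h1 : φ q ∈ Ideal.span (Set.range g) := by
      rw [Ideal.span, hg]
      exact Ideal.mem_map_of_mem _ hq
    obtain ⟨c, hc⟩ := Ideal.mem_span_range_iff_exists_fun.mp h1
    choose c' hc' using fun i ↦ hφ (c i)
    have h2 : φ (q - ∑ i, c' i * f i) = 0 := by
      simp [hf, hc', hc]
    rw [← add_sub_cancel (∑ i, c' i * f i) q]
    exact add_mem (Ideal.mem_sup_left (Ideal.mem_span_range_iff_exists_fun.mpr ⟨c', rfl⟩))
      (Ideal.mem_sup_right (pow_maximalIdeal_adicCompletion_le hk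
        (mem_pow_maximalIdeal_of_evalₐ_eq_zero h2)))

include hx hk in
lemma krullDimLE_adicCompletion : Ring.KrullDimLE 1 (AdicCompletion (maximalIdeal R) R) := by
  have := isNoetherianRing_adicCompletion hx hk
  rw [Ring.krullDimLE_iff, ← maximalIdeal_height_eq_ringKrullDim]
  have h : maximalIdeal (AdicCompletion (maximalIdeal R) R) ∈
      (Ideal.span {algebraMap R (AdicCompletion (maximalIdeal R) R) x}).minimalPrimes := by
    refine ⟨⟨inferInstance, ?_⟩, fun p hp _ ↦ ?_⟩
    · rw [Ideal.span_singleton_le_iff_mem, AdicCompletion.maximalIdeal_eq_map]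
      exact Ideal.mem_map_of_mem _ hx
    · have := hp.1
      exact Ideal.IsPrime.le_of_pow_le (n := k) ((pow_maximalIdeal_adicCompletion_le hk).trans hp.2)
  exact_mod_cast Ideal.height_le_one_of_isPrincipal_of_mem_minimalPrimes _ _ h

end Completion

/-! ### Analytically unramified rings of dimension one -/

section AnalyticallyUnramified

variable {R : Type u} [CommRing R] [IsLocalRing R] [IsNoetherianRing R]

lemma IsAnalyticallyUnramified.isReduced (hR : IsAnalyticallyUnramified R) : IsReduced R := by
  have : IsReduced (AdicCompletion (maximalIdeal R) R) := hR
  exact isReduced_of_injective _ algebraMap_adicCompletion_injective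

lemma exists_mem_maximalIdeal_mem_nonZeroDivisors [IsReduced R] (hdim : ringKrullDim R = 1) :
    ∃ x ∈ maximalIdeal R, x ∈ nonZeroDivisors R := by
  obtain ⟨s, hs, hs'⟩ := exists_mem_sup_annihilator_mem_nonZeroDivisors (maximalIdeal R)
  by_cases h : Submodule.annihilator (maximalIdeal R) = ⊤
  · rw [Submodule.annihilator_eq_top_iff] at h
    have : ringKrullDim R = 0 := by
      rw [← maximalIdeal_height_eq_ringKrullDim, h, Ideal.height_bot]
      rfl
    rw [this] at hdim
    exact absurd hdim (by norm_num)
  · rw [sup_of_le_left (le_maximalIdeal h)] at hs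
    exact ⟨s, hs, hs'⟩

/-- The conductor of an analytically unramified local ring of dimension one contains a
non-zero-divisor. -/
theorem exists_mem_conductorIdeal_mem_nonZeroDivisors (hdim : ringKrullDim R = 1)
    (hR : IsAnalyticallyUnramified R) :
    ∃ s ∈ conductorIdeal R, s ∈ nonZeroDivisors R := by
  have := hR.isReduced
  have : IsReduced (AdicCompletion (maximalIdeal R) R) := hR
  have : Ring.KrullDimLE 1 R := Ring.krullDimLE_iff.mpr hdim.le
  have hreg := isMaximal_of_mem_nonZeroDivisors_of_krullDimLE (A := R)
  obtain ⟨x, hx, hx'⟩ := exists_mem_maximalIdeal_mem_nonZeroDivisors hdim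
  have hpow (k : ℕ) : ∃ l, maximalIdeal R ^ l ≤ Ideal.span {x ^ k} := by
    have := isArtinianRing_quotient_of_mem_nonZeroDivisors hreg (Ideal.span {x ^ k})
      (Ideal.mem_span_singleton_self _) (pow_mem hx' k)
    exact exists_maximalIdeal_pow_le_of_isArtinianRing_quotient _
  obtain ⟨k, hk⟩ := hpow 1
  rw [pow_one] at hk
  have := isNoetherianRing_adicCompletion hx hk
  have := krullDimLE_adicCompletion hx hk
  let Rh := AdicCompletion (maximalIdeal R) R
  let φ : FractionRing R →+* FractionRing Rh :=
    IsLocalization.map (M := nonZeroDivisors R) (T := nonZeroDivisors Rh) (FractionRing Rh)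
      (algebraMap R Rh) fun s hs ↦ algebraMap_mem_nonZeroDivisors hs
  have hφ (r : R) : φ (algebraMap R _ r) = algebraMap Rh _ (algebraMap R Rh r) :=
    IsLocalization.map_eq _ r
  obtain ⟨y, hy⟩ : ∃ y, algebraMap R (FractionRing R) x * y = 1 :=
    (IsLocalization.map_units (FractionRing R) ⟨x, hx'⟩).exists_right_inv
  have hxh : algebraMap R Rh x ∈ maximalIdeal Rh := by
    rw [AdicCompletion.maximalIdeal_eq_map]
    exact Ideal.mem_map_of_mem _ hx
  obtain ⟨n, hn⟩ := exists_forall_mem_span_pow_of_isIntegral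
    (isMaximal_of_mem_nonZeroDivisors_of_krullDimLE (A := Rh)) hxh (K := FractionRing Rh)
    (y := φ y) (by rw [← hφ, ← map_mul, hy, map_one])
  refine ⟨x ^ n, fun v hv ↦ ?_, pow_mem hx' n⟩
  obtain ⟨⟨a, s⟩, has⟩ := IsLocalization.surj (nonZeroDivisors R) v
  obtain ⟨k, g, hg⟩ := exists_dvd_pow_of_mem_nonZeroDivisors hreg hx s.2
  have hxy (j : ℕ) : algebraMap R (FractionRing R) (x ^ j) * y ^ j = 1 := by
    rw [map_pow, ← mul_pow, hy, one_pow]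
  let r := a * g * x ^ n
  have hr : v = algebraMap R (FractionRing R) r * y ^ (n + k) := by
    calc v = v * (algebraMap R _ (x ^ k) * y ^ k) * (algebraMap R _ (x ^ n) * y ^ n) := by
          rw [hxy, hxy, mul_one, mul_one]
      _ = (v * algebraMap R _ s) * algebraMap R _ (g * x ^ n) * y ^ (n + k) := by
          rw [hg]; simp only [map_mul]; ring
      _ = _ := by rw [has]; simp only [r, map_mul]; ring
  have hint : IsIntegral Rh (φ v) := by
    refine IsIntegral.map_of_comp_eq (algebraMap R Rh) φ ?_ hv
    ext r
    exact (hφ r).symm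
  rw [hr, map_mul, hφ, map_pow] at hint
  have h1 := hn k _ hint
  rw [← map_pow, ← Set.image_singleton, ← Ideal.map_span] at h1
  obtain ⟨l, hl⟩ := hpow k
  obtain ⟨c, hc⟩ := Ideal.mem_span_singleton.mp (mem_of_algebraMap_mem_map hl h1)
  refine ⟨c, ?_⟩
  rw [hr, hc, Algebra.smul_def, map_mul, pow_add]
  linear_combination (- algebraMap R (FractionRing R) c) * hxy n -
    (algebraMap R (FractionRing R) c * algebraMap R (FractionRing R) (x ^ n) * y ^ n) * hxy k

omit [IsLocalRing R] in
lemma finite_integralClosure {s : R} (hs : s ∈ conductorIdeal R) (hs' : s ∈ nonZeroDivisors R) :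
    Module.Finite R (integralClosure R (FractionRing R)) := by
  have hinj := IsFractionRing.injective R (FractionRing R)
  choose h hh using fun b : integralClosure R (FractionRing R) ↦ hs b.1 b.2
  let f : integralClosure R (FractionRing R) →ₗ[R] R :=
    { toFun := h
      map_add' := fun a b ↦ hinj (by simp [hh])
      map_smul' := fun c a ↦ hinj (by simp [hh, Algebra.smul_def, mul_left_comm]) }
  refine Module.Finite.of_injective f fun a b hab ↦ Subtype.ext ?_
  have h1 : s • (a : FractionRing R) = s • (b : FractionRing R) := by
    rw [← hh, ← hh]
    exact congrArg _ hab
  rw [Algebra.smul_def, Algebra.smul_def] at h1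
  exact (IsLocalization.map_units (FractionRing R) ⟨s, hs'⟩).mul_left_cancel h1

/-- The conductor is contained in all stable ideals of entries of resolutions. -/
theorem conductorIdeal_le_stableIdeal (hdim : ringKrullDim R = 1)
    (hR : IsAnalyticallyUnramified R) (M : ChainComplex (ModuleCat.{u} R) ℤ)
    (hM : IsBoundedBelowFGHomologyBounded M) : conductorIdeal R ≤ stableIdeal M 1 := by
  obtain ⟨s, hs, hs'⟩ := exists_mem_conductorIdeal_mem_nonZeroDivisors hdim hR
  have := hR.isReduced
  have : Ring.KrullDimLE 1 R := Ring.krullDimLE_iff.mpr hdim.le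
  have := finite_integralClosure hs hs'
  have : IsNoetherianRing (integralClosure R (FractionRing R)) := 
    IsNoetherianRing.of_finite R _
  have : IsReduced (integralClosure R (FractionRing R)) :=
    isReduced_of_injective (integralClosure R (FractionRing R)).val Subtype.val_injective
  intro x hx
  refine mem_stableIdeal_of_lift (fun F G _ _ _ _ _ _ _ _ g ↦
    exists_lift_smul_of_mem_conductor (K := FractionRing R)
      (B := integralClosure R (FractionRing R))
      isMaximal_of_mem_nonZeroDivisors_of_krullDimLE (fun b ↦ ?_) g) M hM
  obtain ⟨r, hr⟩ := hx b.1 b.2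
  exact ⟨r, Subtype.ext hr⟩

end AnalyticallyUnramified

/-! ### Principal reductions over an infinite residue field -/

/-- A module over a local ring with infinite residue field is not a finite union of proper
submodules. -/
lemma exists_forall_notMem_of_infinite_residueField {R M ι : Type*} [CommRing R] [IsLocalRing R]
    [Infinite (ResidueField R)] [AddCommGroup M] [Module R M] (N : ι → Submodule R M)
    (hN : ∀ i, ∃ v, v ∉ N i) (s : Finset ι) : ∃ v, ∀ i ∈ s, v ∉ N i := by
  classical
  induction s using Finset.induction_on with
  | empty => exact ⟨0, by simp⟩
  | insert j s hj ih =>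
    obtain ⟨v, hv⟩ := ih
    by_cases hvj : v ∈ N j
    · obtain ⟨w, hw⟩ := hN j
      -- For each `i`, at most one residue class of `a` has a member with `w + a • v ∈ N i`.
      have h1 (i) (hi : i ∈ s) : {t : ResidueField R | ∃ a, residue R a = t ∧
          w + a • v ∈ N i}.Subsingleton := by
        rintro _ ⟨a, rfl, ha⟩ _ ⟨b, rfl, hb⟩
        by_contra hab
        have hu : IsUnit (a - b) := by
          rw [← residue_ne_zero_iff_isUnit, map_sub]
          exact sub_ne_zero.mpr hab
        refine hv i hi ((Submodule.smul_mem_iff_of_isUnit _ hu).mp ?_)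
        have := sub_mem ha hb
        rwa [add_sub_add_left_eq_sub, ← sub_smul] at this
      have h2 : (⋃ i ∈ s, {t : ResidueField R | ∃ a, residue R a = t ∧
          w + a • v ∈ N i}).Finite := s.finite_toSet.biUnion fun i hi ↦ (h1 i hi).finite
      obtain ⟨t, ht⟩ := h2.exists_notMem
      obtain ⟨a, rfl⟩ := residue_surjective t
      refine ⟨w + a • v, fun i hi h ↦ ?_⟩
      obtain rfl | hi := Finset.mem_insert.mp hi
      · exact hw ((Submodule.add_mem_iff_left _ (Submodule.smul_mem _ a hvj)).mp h)
      · exact ht (Set.mem_biUnion hi ⟨a, rfl, h⟩)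
    · refine ⟨v, fun i hi ↦ ?_⟩
      obtain rfl | hi := Finset.mem_insert.mp hi
      exacts [hvj, hv i hi]

lemma finite_maximalSpectrum_of_finite (R B : Type*) [CommRing R] [IsLocalRing R] [CommRing B]
    [Algebra R B] [Module.Finite R B] : Finite (MaximalSpectrum B) := by
  have h : ((maximalIdeal R).primesOver B).Finite := Algebra.QuasiFinite.finite_primesOver _
  have : Finite ((maximalIdeal R).primesOver B) := h
  refine Finite.of_injective
    (fun q : MaximalSpectrum B ↦ (⟨q.asIdeal, q.isMaximal.isPrime, ⟨?_⟩⟩ :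
      (maximalIdeal R).primesOver B)) fun p q hpq ↦ ?_
  · have := q.isMaximal
    exact (eq_maximalIdeal (Ideal.isMaximal_comap_of_isIntegral_of_isMaximal q.asIdeal)).symm
  · exact MaximalSpectrum.ext (congrArg Subtype.val hpq)

/-- A regular ideal `I` has an element that generates its extension to the integral closure: `I`
becomes invertible there, and the ring has only finitely many maximal ideals to avoid. -/
theorem exists_forall_mem_algebraMap_eq_mul {R B K : Type*} [CommRing R] [CommRing B] [CommRing K]
    [Algebra R B] [Algebra B K] [Algebra R K] [IsScalarTower R B K] [IsFractionRing R K]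
    [IsIntegralClosure B R K] [IsLocalRing R] [Infinite (ResidueField R)] [Module.Finite R B]
    [IsNoetherianRing B]
    (hreg : ∀ p : Ideal R, p.IsPrime → ∀ a ∈ p, a ∈ nonZeroDivisors R → p.IsMaximal)
    (I : Ideal R) {s : R} (hs : s ∈ I) (hs' : s ∈ nonZeroDivisors R) :
    ∃ u ∈ I, u ∈ nonZeroDivisors R ∧ ∀ a ∈ I, ∃ b : B, algebraMap R B a = algebraMap R B u * b := by
  have hinj := IsIntegralClosure.algebraMap_injective B R K
  have hRK := IsFractionRing.injective R K
  have := finite_maximalSpectrum_of_finite R B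
  obtain ⟨J, hJ⟩ := exists_coeSubmodule_mul_eq_one (R := R) (K := K) hreg (I.map (algebraMap R B))
    ⟨_, Ideal.mem_map_of_mem _ hs, by
      rw [mem_nonZeroDivisors_iff_right]
      intro z hz
      refine hinj ?_
      rw [map_zero, ← (IsLocalization.map_units K ⟨s, hs'⟩).mul_left_eq_zero,
        IsScalarTower.algebraMap_apply R B K, ← map_mul, hz, map_zero]⟩
  have hIJ {a : R} (ha : a ∈ I) {j : K} (hj : j ∈ J) :
      ∃ b : B, algebraMap B K b = algebraMap R K a * j := by
    have h : algebraMap B K (algebraMap R B a) * j ∈ (1 : Submodule B K) := by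
      rw [← hJ]
      exact Submodule.mul_mem_mul
        ((IsLocalization.mem_coeSubmodule K _).mpr ⟨_, Ideal.mem_map_of_mem _ ha, rfl⟩) hj
    obtain ⟨b, hb⟩ := Submodule.mem_one.mp h
    exact ⟨b, by rw [hb, ← IsScalarTower.algebraMap_apply]⟩
  let N (q : MaximalSpectrum B) : Submodule R I :=
    { carrier := {a | ∀ j ∈ J, ∃ b ∈ q.asIdeal, algebraMap B K b = algebraMap R K a * j}
      add_mem' := fun {a a'} ha ha' j hj ↦ by
        obtain ⟨b, hb, h⟩ := ha j hj
        obtain ⟨b', hb', h'⟩ := ha' j hj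
        exact ⟨b + b', add_mem hb hb', by
          rw [map_add, h, h', Submodule.coe_add, map_add, add_mul]⟩
      zero_mem' := fun j _ ↦ ⟨0, zero_mem _, by simp⟩
      smul_mem' := fun c a ha j hj ↦ by
        obtain ⟨b, hb, h⟩ := ha j hj
        exact ⟨algebraMap R B c * b, Ideal.mul_mem_left _ _ hb, by
          rw [map_mul, h, ← IsScalarTower.algebraMap_apply, Submodule.coe_smul, smul_eq_mul,
            map_mul, mul_assoc]⟩ }
  have hN (q : MaximalSpectrum B) : ∃ v, v ∉ N q := by
    by_contra! h
    have h1 : IsLocalization.coeSubmodule K (I.map (algebraMap R B)) * J ≤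
        IsLocalization.coeSubmodule K q.asIdeal := by
      rw [Submodule.mul_le]
      intro z hz j hj
      obtain ⟨y, hy, rfl⟩ := (IsLocalization.mem_coeSubmodule K _).mp hz
      induction hy using Submodule.span_induction with
      | mem y hy =>
        obtain ⟨a, ha, rfl⟩ := hy
        obtain ⟨b, hb, hb'⟩ := h ⟨a, ha⟩ j hj
        exact (IsLocalization.mem_coeSubmodule K _).mpr
          ⟨b, hb, by rw [hb', ← IsScalarTower.algebraMap_apply]⟩
      | zero => simp
      | add y y' hy hy' h h' =>
        rw [map_add, add_mul]
        exact add_mem (h ((IsLocalization.mem_coeSubmodule K _).mpr ⟨_, hy, rfl⟩))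
          (h' ((IsLocalization.mem_coeSubmodule K _).mpr ⟨_, hy', rfl⟩))
      | smul c y hy h =>
        rw [smul_eq_mul, map_mul, mul_assoc, ← Algebra.smul_def]
        exact Submodule.smul_mem _ c (h ((IsLocalization.mem_coeSubmodule K _).mpr ⟨_, hy, rfl⟩))
    rw [hJ] at h1
    obtain ⟨b, hb, hb'⟩ := (IsLocalization.mem_coeSubmodule K _).mp (h1 (Submodule.one_le.mp le_rfl))
    rw [← map_one (algebraMap B K)] at hb'
    exact q.isMaximal.ne_top ((Ideal.eq_top_iff_one _).mpr (hinj hb' ▸ hb))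
  have := Fintype.ofFinite (MaximalSpectrum B)
  obtain ⟨⟨u, hu⟩, hv⟩ := exists_forall_notMem_of_infinite_residueField N hN Finset.univ
  -- Now the ideal `u J` of `B` lies in no maximal ideal.
  let L : Ideal B :=
    { carrier := {b | ∃ j ∈ J, algebraMap B K b = algebraMap R K u * j}
      add_mem' := fun {b b'} ⟨j, hj, h⟩ ⟨j', hj', h'⟩ ↦
        ⟨j + j', add_mem hj hj', by rw [map_add, h, h', mul_add]⟩
      zero_mem' := ⟨0, zero_mem _, by simp⟩
      smul_mem' := fun c b ⟨j, hj, h⟩ ↦ ⟨c • j, Submodule.smul_mem _ _ hj, by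
        rw [smul_eq_mul, map_mul, h, Algebra.smul_def, mul_left_comm]⟩ }
  have hL : L = ⊤ := by
    by_contra hL
    obtain ⟨q, hq, hLq⟩ := Ideal.exists_le_maximal L hL
    refine hv ⟨q, hq⟩ (Finset.mem_univ _) fun j hj ↦ ?_
    obtain ⟨b, hb⟩ := hIJ hu hj
    exact ⟨b, hLq ⟨j, hj, hb⟩, hb⟩
  obtain ⟨j, hj, h1⟩ := (Ideal.eq_top_iff_one _).mp hL
  rw [map_one] at h1
  refine ⟨u, hu, ?_, fun a ha ↦ ?_⟩
  · rw [mem_nonZeroDivisors_iff_right]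
    intro z hz
    refine hRK ?_
    rw [map_zero, ← mul_one (algebraMap R K z), h1, ← mul_assoc, ← map_mul, hz, map_zero, zero_mul]
  · obtain ⟨b, hb⟩ := hIJ ha hj
    refine ⟨b, hinj ?_⟩
    rw [map_mul, hb, ← IsScalarTower.algebraMap_apply, ← IsScalarTower.algebraMap_apply,
      mul_left_comm, ← h1, mul_one]

/-- Every regular ideal `I` of an analytically unramified local ring of dimension one with
infinite residue field contains a non-zero-divisor `u` with `I 𝔠 = u 𝔠`, `𝔠` the conductor. -/
theorem exists_forall_mul_mem_conductorIdeal {R : Type u} [CommRing R] [IsLocalRing R]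
    [IsNoetherianRing R] [Infinite (ResidueField R)] (hdim : ringKrullDim R = 1)
    (hR : IsAnalyticallyUnramified R) (I : Ideal R) {s : R} (hs : s ∈ I)
    (hs' : s ∈ nonZeroDivisors R) :
    ∃ u ∈ I, u ∈ nonZeroDivisors R ∧
      ∀ a ∈ I, ∀ n ∈ conductorIdeal R, ∃ n' ∈ conductorIdeal R, a * n = u * n' := by
  obtain ⟨t, ht, ht'⟩ := exists_mem_conductorIdeal_mem_nonZeroDivisors hdim hR
  have : Ring.KrullDimLE 1 R := Ring.krullDimLE_iff.mpr hdim.le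
  have := finite_integralClosure ht ht'
  have : IsNoetherianRing (integralClosure R (FractionRing R)) :=
    IsNoetherianRing.of_finite R _
  obtain ⟨u, hu, hu', h⟩ := exists_forall_mem_algebraMap_eq_mul
    (B := integralClosure R (FractionRing R)) (K := FractionRing R)
    isMaximal_of_mem_nonZeroDivisors_of_krullDimLE I hs hs'
  refine ⟨u, hu, hu', fun a ha n hn ↦ ?_⟩
  obtain ⟨b, hb⟩ := h a ha
  replace hb : algebraMap R (FractionRing R) a = algebraMap R (FractionRing R) u * b :=
    congrArg Subtype.val hb
  obtain ⟨n', hn'⟩ := hn b b.2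
  rw [Algebra.smul_def] at hn'
  refine ⟨n', fun z hz ↦ ?_, IsFractionRing.injective R (FractionRing R) ?_⟩
  · rw [Algebra.smul_def, hn', mul_assoc, ← Algebra.smul_def]
    exact hn _ (mul_mem b.2 hz)
  · rw [map_mul, map_mul, hn', hb]
    ring

/-! ### Lengths and multiplicity -/

section Length

variable {R : Type*} [CommRing R]

lemma length_quotient_anti {I J : Ideal R} (h : I ≤ J) :
    Module.length R (R ⧸ J) ≤ Module.length R (R ⧸ I) :=
  Module.length_le_of_surjective (Submodule.factor h) (Submodule.factor_surjective h)

lemma length_quotient_span_singleton_mul {s : R} (hs : s ∈ nonZeroDivisors R) (I : Ideal R) :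
    Module.length R (R ⧸ Ideal.span {s} * I) =
      Module.length R (R ⧸ I) + Module.length R (R ⧸ Ideal.span {s}) := by
  have h1 : I ≤ Submodule.comap (LinearMap.mulLeft R s) (Ideal.span {s} * I) := fun a ha ↦
    Ideal.mul_mem_mul (Ideal.mem_span_singleton_self s) ha
  refine Module.length_eq_add_of_exact 
    (Submodule.mapQ I (Ideal.span {s} * I) (LinearMap.mulLeft R s) h1)
    (Submodule.factor Ideal.mul_le_left) ?_ (Submodule.factor_surjective _) ?_
  · rw [injective_iff_map_eq_zero]
    intro a ha
    obtain ⟨a, rfl⟩ := Submodule.mkQ_surjective I a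
    rw [Submodule.mkQ_apply, Submodule.mapQ_apply, Submodule.Quotient.mk_eq_zero,
      LinearMap.mulLeft_apply, Ideal.mem_span_singleton_mul] at ha
    obtain ⟨b, hb, hab⟩ := ha
    rw [Submodule.mkQ_apply, Submodule.Quotient.mk_eq_zero]
    rwa [← (mul_cancel_left_mem_nonZeroDivisors hs).mp hab]
  · intro a
    obtain ⟨a, rfl⟩ := Submodule.mkQ_surjective _ a
    constructor
    · intro h
      change (Submodule.Quotient.mk a : R ⧸ Ideal.span {s}) = 0 at h
      rw [Submodule.Quotient.mk_eq_zero] at h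
      obtain ⟨b, rfl⟩ := Ideal.mem_span_singleton'.mp h
      refine ⟨Submodule.Quotient.mk b, ?_⟩
      rw [Submodule.mapQ_apply, LinearMap.mulLeft_apply, mul_comm s b]
      rfl
    · rintro ⟨b, hb⟩
      obtain ⟨b, rfl⟩ := Submodule.mkQ_surjective _ b
      rw [← hb]
      change (Submodule.Quotient.mk (s * b) : R ⧸ Ideal.span {s}) = 0
      rw [Submodule.Quotient.mk_eq_zero]
      exact Ideal.mul_mem_right _ _ (Ideal.mem_span_singleton_self s)

lemma length_quotient_span_singleton_pow {s : R} (hs : s ∈ nonZeroDivisors R) (n : ℕ) :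
    Module.length R (R ⧸ Ideal.span {s ^ n}) = n * Module.length R (R ⧸ Ideal.span {s}) := by
  induction n with
  | zero =>
    rw [pow_zero, Ideal.span_singleton_one, Nat.cast_zero, zero_mul]
    have := Ideal.Quotient.subsingleton_iff.mpr (rfl : (⊤ : Ideal R) = ⊤)
    exact Module.length_eq_zero
  | succ n ih =>
    rw [pow_succ', ← Ideal.span_singleton_mul_span_singleton,
      length_quotient_span_singleton_mul hs, ih, Nat.cast_succ, add_mul, one_mul]

lemma length_quotient_ne_top [IsNoetherianRing R]
    (hreg : ∀ p : Ideal R, p.IsPrime → ∀ a ∈ p, a ∈ nonZeroDivisors R → p.IsMaximal)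
    (I : Ideal R) {s : R} (hs : s ∈ I) (hs' : s ∈ nonZeroDivisors R) :
    Module.length R (R ⧸ I) ≠ ⊤ := by
  have := isArtinianRing_quotient_of_mem_nonZeroDivisors hreg I hs hs'
  have : IsArtinian R (R ⧸ I) :=
    isArtinian_of_surjective_algebraMap (R := R ⧸ I) Ideal.Quotient.mk_surjective
  exact Module.length_ne_top

end Length

section Multiplicity

variable {R : Type u} [CommRing R] [IsLocalRing R] [IsNoetherianRing R]

/-- In dimension one, the multiplicity is the length of `R ⧸ (x)` when `x` is a non-zero-divisor in
the maximal ideal `𝔪` such that `s 𝔪ⁿ ⊆ (xⁿ)` for all `n` and some non-zero-divisor `s`. -/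
theorem hasMultiplicity_iff (hdim : ringKrullDim R = 1) {x s : R} (hx : x ∈ maximalIdeal R)
    (hx' : x ∈ nonZeroDivisors R) (hs : s ∈ nonZeroDivisors R)
    (h : ∀ n, ∀ a ∈ maximalIdeal R ^ n, s * a ∈ Ideal.span {x ^ n}) (e : ℕ) :
    HasMultiplicity R e ↔ Module.length R (R ⧸ Ideal.span {x}) = e := by
  have : Ring.KrullDimLE 1 R := Ring.krullDimLE_iff.mpr hdim.le
  have hreg := isMaximal_of_mem_nonZeroDivisors_of_krullDimLE (A := R)
  have hfin {t : R} (ht : t ∈ nonZeroDivisors R) {I : Ideal R} (htI : t ∈ I) :=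
    length_quotient_ne_top hreg I htI ht
  obtain ⟨E, hE⟩ := ENat.ne_top_iff_exists.mp (hfin hx' (Ideal.mem_span_singleton_self x))
  obtain ⟨C, hC⟩ := ENat.ne_top_iff_exists.mp (hfin hs (Ideal.mem_span_singleton_self s))
  have hxn (n : ℕ) : x ^ n ∈ maximalIdeal R ^ n := Ideal.pow_mem_pow hx n
  choose L hL using fun n ↦ ENat.ne_top_iff_exists.mp (hfin (pow_mem hx' n) (hxn n))
  have hle (n : ℕ) : L n ≤ n * E := by
    have h1 := length_quotient_anti ((Ideal.span_singleton_le_iff_mem _).mpr (hxn n))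
    rw [length_quotient_span_singleton_pow hx', ← hL, ← hE] at h1
    exact_mod_cast h1
  have hge (n : ℕ) : n * E ≤ L n + C := by
    have h1 : Ideal.span {s} * maximalIdeal R ^ n ≤ Ideal.span {x ^ n} := by
      rw [Ideal.span_singleton_mul_le_iff]
      exact h n
    have h2 := length_quotient_anti h1
    rw [length_quotient_span_singleton_pow hx', length_quotient_span_singleton_mul hs, ← hL, ← hE,
      ← hC] at h2
    exact_mod_cast h2
  have hlim : Tendsto (fun n : ℕ ↦ ((Nat.factorial 1 : ℝ) *
      ((Module.length R (R ⧸ (maximalIdeal R) ^ n)).toNat : ℝ)) / (n : ℝ) ^ 1) atTop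
        (𝓝 (E : ℝ)) := by
    have h1 : Tendsto (fun n : ℕ ↦ (E : ℝ) - C / n) atTop (𝓝 (E - 0)) :=
      tendsto_const_nhds.sub (tendsto_const_div_atTop_nhds_zero_nat _)
    rw [sub_zero] at h1
    refine tendsto_of_tendsto_of_tendsto_of_le_of_le' h1 tendsto_const_nhds ?_ ?_
    all_goals
      filter_upwards [eventually_gt_atTop 0] with n hn
      have hn' : (0 : ℝ) < n := by exact_mod_cast hn
      rw [← hL, ENat.toNat_natCast, Nat.factorial_one, Nat.cast_one, one_mul, pow_one]
    · rw [le_div_iff₀ hn', sub_mul, div_mul_cancel₀ _ hn'.ne', sub_le_iff_le_add, mul_comm]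
      exact_mod_cast hge n
    · rw [div_le_iff₀ hn', mul_comm]
      exact_mod_cast hle n
  rw [← hE, Nat.cast_inj]
  constructor
  · rintro ⟨d, hd, h⟩
    rw [hdim] at hd
    obtain rfl : 1 = d := by exact_mod_cast hd
    exact_mod_cast tendsto_nhds_unique hlim h
  · rintro rfl
    exact ⟨1, by rw [hdim]; rfl, hlim⟩

end Multiplicity

/-! ### Lengths modulo a regular element -/

section Resolution

variable {R : Type*} [CommRing R] {F G : Type*} [AddCommGroup F] [Module R F] [AddCommGroup G]
  [Module R G]

lemma length_quotSMulTop_eq_add {u : R} (f : F →ₗ[R] G) (hf : Function.Surjective f)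
    (hu : IsSMulRegular G u) :
    Module.length R (QuotSMulTop u F) =
      Module.length R (QuotSMulTop u (LinearMap.ker f)) + Module.length R (QuotSMulTop u G) := by
  refine Module.length_eq_add_of_exact (QuotSMulTop.map u (LinearMap.ker f).subtype)
    (QuotSMulTop.map u f) ?_ (QuotSMulTop.map_surjective u hf)
    (QuotSMulTop.map_exact u (LinearMap.exact_subtype_ker_map f) hf)
  rw [← LinearMap.ker_eq_bot, LinearMap.ker_eq_bot']
  intro a ha
  obtain ⟨a, rfl⟩ := Submodule.mkQ_surjective _ a
  rw [Submodule.mkQ_apply, QuotSMulTop.map_apply_mk, Submodule.Quotient.mk_eq_zero,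
    Submodule.mem_smul_pointwise_iff_exists] at ha
  obtain ⟨b, -, hb⟩ := ha
  rw [Submodule.mkQ_apply, Submodule.Quotient.mk_eq_zero, Submodule.mem_smul_pointwise_iff_exists]
  have h1 : u • f b = u • (0 : G) := by
    rw [smul_zero, ← map_smul, hb]
    exact a.2
  exact ⟨⟨b, hu h1⟩, trivial, Subtype.ext hb⟩

lemma length_quotient_smul_top [Module.Free R F] [Module.Finite R F] [Nontrivial R] (I : Ideal R) :
    Module.length R (F ⧸ I • (⊤ : Submodule R F)) =
      Module.finrank R F * Module.length R (R ⧸ I) := by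
  let b := Module.finBasis R F
  let f : F →ₗ[R] (Fin (Module.finrank R F) → R ⧸ I) :=
    LinearMap.pi fun i ↦ I.mkQ ∘ₗ b.coord i
  have hf : Function.Surjective f := fun v ↦ by
    choose w hw using fun i ↦ Submodule.mkQ_surjective I (v i)
    exact ⟨b.equivFun.symm w, by
      ext i
      simp only [f, LinearMap.pi_apply, LinearMap.comp_apply, Module.Basis.coord_apply]
      rw [← Module.Basis.equivFun_apply, LinearEquiv.apply_symm_apply, hw]⟩
  have hk : LinearMap.ker f = I • ⊤ := by
    refine le_antisymm (fun v hv ↦ ?_) (Submodule.smul_le.mpr fun a ha v _ ↦ ?_)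
    · rw [← b.sum_repr v]
      refine sum_mem fun i _ ↦ Submodule.smul_mem_smul ?_ trivial
      have := congrFun hv i
      simpa [f, Ideal.Quotient.eq_zero_iff_mem] using this
    · ext i
      have : a * b.repr v i ∈ I := Ideal.mul_mem_right _ _ ha
      simpa [f, Algebra.smul_def] using Ideal.Quotient.eq_zero_iff_mem.mpr this
  rw [← hk, (f.quotKerEquivOfSurjective hf).length_eq, Module.length_pi]
  simp

lemma length_quotSMulTop_eq_of_surjective (f : F →ₗ[R] G) (hf : Function.Surjective f) {u : R}
    {N : Submodule R F} (hN : ∀ v, v ∈ N ↔ ∃ w, f v = u • w) :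
    Module.length R (QuotSMulTop u G) = Module.length R (F ⧸ N) := by
  let g : F →ₗ[R] QuotSMulTop u G := Submodule.mkQ _ ∘ₗ f
  have hk : LinearMap.ker g = N := by
    ext v
    rw [hN, LinearMap.mem_ker, LinearMap.comp_apply, Submodule.mkQ_apply,
      Submodule.Quotient.mk_eq_zero, Submodule.mem_smul_pointwise_iff_exists]
    simp [eq_comm]
  rw [← hk]
  exact (g.quotKerEquivOfSurjective ((Submodule.mkQ_surjective _).comp hf)).length_eq.symm

end Resolution

/-! ### Gorenstein rings -/

section Gorenstein

open Abelian
open scoped Pointwise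

variable {R : Type u} [CommRing R]

lemma shortExact_of_function_exact {M N P : Type u} [AddCommGroup M] [Module R M] [AddCommGroup N]
    [Module R N] [AddCommGroup P] [Module R P] (f : M →ₗ[R] N) (g : N →ₗ[R] P)
    (hf : Function.Injective f) (hfg : Function.Exact f g) (hg : Function.Surjective g) :
    (ModuleCat.shortComplexOfCompEqZero f g hfg.linearMap_comp_eq_zero).ShortExact :=
  ModuleCat.shortComplex_shortExact _ hfg hf hg

lemma shortExact_mul {x : R} (hx : x ∈ nonZeroDivisors R) :
    (ModuleCat.shortComplexOfCompEqZero (x • LinearMap.id : R →ₗ[R] R)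
      (Submodule.mkQ (x • ⊤ : Submodule R R)) (by
        ext
        exact (Submodule.Quotient.mk_eq_zero _).mpr
          ((Submodule.mem_smul_pointwise_iff_exists _ _ _).mpr ⟨1, trivial, rfl⟩))).ShortExact := by
  refine ModuleCat.shortComplex_shortExact _ (fun a ↦ ?_) (fun a b hab ↦ ?_)
    (Submodule.mkQ_surjective _)
  · change Submodule.mkQ _ a = 0 ↔ ∃ b, x * b = a
    rw [Submodule.mkQ_apply, Submodule.Quotient.mk_eq_zero, Submodule.mem_smul_pointwise_iff_exists]
    simp
  · exact (mul_cancel_left_mem_nonZeroDivisors hx).mp hab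

lemma isFiniteLength_quotSMulTop [IsNoetherianRing R]
    (hreg : ∀ p : Ideal R, p.IsPrime → ∀ a ∈ p, a ∈ nonZeroDivisors R → p.IsMaximal)
    {x : R} (hx : x ∈ nonZeroDivisors R) : IsFiniteLength R (QuotSMulTop x R) := by
  rw [← Module.length_ne_top_iff]
  refine length_quotient_ne_top hreg (x • ⊤ : Submodule R R) (s := x) ?_ hx
  rw [Submodule.mem_smul_pointwise_iff_exists]
  exact ⟨1, trivial, by simp⟩

variable [IsLocalRing R] [IsNoetherianRing R]
  (hreg : ∀ p : Ideal R, p.IsPrime → ∀ a ∈ p, a ∈ nonZeroDivisors R → p.IsMaximal)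
  {x : R} (hx : x ∈ maximalIdeal R) (hx' : x ∈ nonZeroDivisors R)

omit [IsNoetherianRing R] in
include hx in
lemma nontrivial_quotSMulTop : Nontrivial (QuotSMulTop x R) := by
  refine Submodule.Quotient.nontrivial_iff.mpr fun h ↦ ?_
  have : (1 : R) ∈ x • (⊤ : Submodule R R) := by rw [h]; trivial
  obtain ⟨b, -, hb⟩ := Submodule.mem_smul_pointwise_iff_exists _ _ _ |>.mp this
  exact (mem_maximalIdeal x).mp hx (IsUnit.of_mul_eq_one b hb)

include hreg hx hx' in
/-- The residue field embeds into `R ⧸ (x)`. -/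
lemma exists_injective_quotSMulTop {T : Type u} [AddCommGroup T] [Module R T] [IsSimpleModule R T] :
    ∃ j : T →ₗ[R] QuotSMulTop x R, Function.Injective j := by
  have := nontrivial_quotSMulTop hx
  obtain ⟨p, hp⟩ := associatedPrimes.nonempty R (QuotSMulTop x R)
  have hxp : x ∈ p :=
    IsAssociatedPrime.annihilator_le hp <| by
      rw [Submodule.annihilator_top]
      exact QuotSMulTop.mem_annihilator R x
  have hpm := hreg p hp.isPrime x hxp hx'
  obtain ⟨q, hq, ⟨e⟩⟩ := isSimpleModule_iff_quot_maximal.mp ‹IsSimpleModule R T›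
  obtain rfl : p = q := (eq_maximalIdeal hpm).trans (eq_maximalIdeal hq).symm
  obtain ⟨-, f, hf⟩ := (isAssociatedPrime_iff_exists_injective_linearMap _ _).mp hp
  exact ⟨f ∘ₗ e.toLinearMap, hf.comp e.injective⟩

include hreg hx hx' in
/-- Over a Gorenstein ring of dimension one, `Ext i T R = 0` for `i ≥ 2` and `T` of finite length:
by descending induction on `i`, as simple modules embed into the module `R ⧸ (x)` of finite length,
of projective dimension one. -/
theorem ext_eq_zero_of_isFiniteLength (hR : IsGorensteinLocal R) {T : Type u} [AddCommGroup T]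
    [Module R T] (hT : IsFiniteLength R T) {i : ℕ} (hi : 2 ≤ i)
    (e : Ext (ModuleCat.of R T) (ModuleCat.of R R) i) : e = 0 := by
  obtain ⟨n, hn⟩ := hR
  -- The induction is on the distance `j` from the injective dimension.
  have key (j : ℕ) : ∀ (i : ℕ), 2 ≤ i → n + 1 ≤ i + j → ∀ (T : Type u) [AddCommGroup T]
      [Module R T], IsFiniteLength R T →
      ∀ e : Ext (ModuleCat.of R T) (ModuleCat.of R R) i, e = 0 := by
    induction j with
    | zero =>
      intro i _ hi T _ _ _ e
      have : HasInjectiveDimensionLT (ModuleCat.of R R) (n + 1) := hn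
      exact e.eq_zero_of_hasInjectiveDimensionLT (n + 1) hi
    | succ j ih =>
      intro i hi hij T _ _ hT
      induction hT with
      | of_subsingleton =>
        intro e
        rw [← e.mk₀_id_comp, (ModuleCat.isZero_of_subsingleton _).eq_zero_of_src (𝟙 _), Ext.mk₀_zero,
          Ext.zero_comp]
      | @of_simple_quotient T _ _ N hN hNl ihN =>
        have hsimple (e : Ext (ModuleCat.of R (T ⧸ N)) (ModuleCat.of R R) i) : e = 0 := by
          obtain ⟨f, hf⟩ := exists_injective_quotSMulTop hreg hx hx' (T := T ⧸ N)
          have hS := shortExact_of_function_exact f f.range.mkQ hf (LinearMap.exact_map_mkQ_range f)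
            (Submodule.mkQ_surjective _)
          obtain ⟨e', rfl⟩ := Ext.contravariant_sequence_exact₁ hS (ModuleCat.of R R) e
            (n₁ := i + 1) (add_comm 1 i) (ih (i + 1) (by lia) (by lia) _
              ((isFiniteLength_quotSMulTop hreg hx').of_surjective
                (Submodule.mkQ_surjective f.range)) _)
          have hS' := shortExact_mul hx'
          have hP : Projective (ModuleCat.of R R) :=
            (IsProjective.iff_projective (R := R) R).mp inferInstance
          have h0 : e' = 0 := by
            obtain ⟨i, rfl⟩ : ∃ k, i = k + 2 := ⟨i - 2, by lia⟩
            obtain ⟨y, hy⟩ := Ext.contravariant_sequence_exact₃ hS' (ModuleCat.of R R) e'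
              (Ext.eq_zero_of_projective (P := ModuleCat.of R R) _) (n₀ := i + 1) (by lia)
            rw [← hy, Ext.eq_zero_of_projective (P := ModuleCat.of R R) y, Ext.comp_zero]
          rw [h0, Ext.comp_zero]
        intro e
        have hS := shortExact_of_function_exact N.subtype N.mkQ N.subtype_injective
          (LinearMap.exact_subtype_mkQ N) N.mkQ_surjective
        obtain ⟨y, rfl⟩ := Ext.contravariant_sequence_exact₂ hS (ModuleCat.of R R) e (ihN _)
        rw [hsimple y, Ext.comp_zero]
  exact key (n + 1) i hi (by lia) T hT e

include hreg hx hx' in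
/-- The self-injectivity of `R ⧸ (x)` that holds for Gorenstein `R`. With `δ : Ext 1 (R ⧸ (x)) R`
the class of the multiplication by `x`, the maps `T → R ⧸ (x)` correspond to `Ext 1 T R` by
`f ↦ f δ`, for `T` killed by `x`. -/
lemma exists_comp_eq_of_isGorensteinLocal (hR : IsGorensteinLocal R) {T : Type u} [AddCommGroup T]
    [Module R T] (g f : T →ₗ[R] QuotSMulTop x R) (hg : Function.Injective g) :
    ∃ ψ : QuotSMulTop x R →ₗ[R] QuotSMulTop x R, ψ ∘ₗ g = f := by
  have hS := shortExact_of_function_exact g g.range.mkQ hg (LinearMap.exact_map_mkQ_range g)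
    (Submodule.mkQ_surjective _)
  have hU := shortExact_mul hx'
  have hx0 (a : QuotSMulTop x R) : x • a = 0 :=
    Module.mem_annihilator.mp (QuotSMulTop.mem_annihilator R x) a
  let A : ModuleCat R := ModuleCat.of R (QuotSMulTop x R)
  let δ : Ext A (ModuleCat.of R R) 1 := hU.extClass
  let gm : ModuleCat.of R T ⟶ A := ModuleCat.ofHom g
  let fm : ModuleCat.of R T ⟶ A := ModuleCat.ofHom f
  obtain ⟨y, hy⟩ := Ext.contravariant_sequence_exact₁ hS (ModuleCat.of R R)
    ((Ext.mk₀ fm).comp δ (zero_add 1)) (n₁ := 2) rfl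
    (ext_eq_zero_of_isFiniteLength hreg hx hx' hR
      ((isFiniteLength_quotSMulTop hreg hx').of_surjective (Submodule.mkQ_surjective g.range))
      le_rfl _)
  have hy0 : y.comp (Ext.mk₀ (x • 𝟙 (ModuleCat.of R R))) (add_zero 1) = 0 := by
    have h1 : x • 𝟙 A = 0 := ModuleCat.hom_ext (LinearMap.ext hx0)
    have h2 : x • y = 0 := by
      rw [← y.mk₀_id_comp, ← Ext.smul_comp, ← Ext.mk₀_smul]
      change (Ext.mk₀ (x • 𝟙 A)).comp y _ = 0
      rw [h1, Ext.mk₀_zero, Ext.zero_comp]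
    rw [← Ext.smul_eq_comp_mk₀, h2]
  obtain ⟨z, hz⟩ := Ext.covariant_sequence_exact₁ A hU y hy0 (zero_add 1)
  obtain ⟨ψ, rfl⟩ := Ext.homEquiv₀.symm.surjective z
  refine ⟨ψ.hom, ?_⟩
  have h1 : ((Ext.mk₀ gm).comp (Ext.mk₀ ψ) (zero_add 0) - Ext.mk₀ fm).comp δ (zero_add 1) = 0 := by
    rw [sub_eq_add_neg, Ext.add_comp, Ext.neg_comp, ← hy, ← hz, Ext.comp_assoc_of_second_deg_zero]
    exact add_neg_cancel _
  obtain ⟨w, hw⟩ := Ext.covariant_sequence_exact₃ _ hU _ (zero_add 1) h1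
  obtain ⟨w, rfl⟩ := Ext.homEquiv₀.symm.surjective w
  have hw0 : w = 0 := by
    refine ModuleCat.hom_ext (LinearMap.ext fun t ↦ ?_)
    have h2 : x • t = 0 := hg (by rw [map_smul, hx0, map_zero])
    have h3 : x * w.hom t = 0 := by
      rw [← smul_eq_mul, ← map_smul, h2, map_zero]
    exact (mul_left_mem_nonZeroDivisors_eq_zero_iff hx').mp h3
  rw [hw0, Ext.homEquiv₀_symm_apply, Ext.mk₀_zero, Ext.zero_comp, Ext.mk₀_comp_mk₀, eq_comm,
    sub_eq_zero] at hw
  exact congrArg ModuleCat.Hom.hom (Ext.homEquiv₀.symm.injective hw)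

include hreg hx hx' in
/-- Homomorphisms from the residue field extend to endomorphisms of `R ⧸ (x)`, so that the socle of
`R ⧸ (x)` is simple. -/
lemma length_linearMap_le_one (hR : IsGorensteinLocal R) {T : Type u} [AddCommGroup T]
    [Module R T] [IsSimpleModule R T] : Module.length R (T →ₗ[R] QuotSMulTop x R) ≤ 1 := by
  cases subsingleton_or_nontrivial (T →ₗ[R] QuotSMulTop x R)
  · simp
  refine (Module.length_eq_one_iff.mpr (isSimpleModule_iff_toSpanSingleton_surjective.mpr
    ⟨inferInstance, fun g hg f ↦ ?_⟩)).le
  obtain ⟨ψ, hψ⟩ := exists_comp_eq_of_isGorensteinLocal hreg hx hx' hR g f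
    ((LinearMap.injective_or_eq_zero g).resolve_right hg)
  -- The endomorphism `ψ` of the cyclic module `R ⧸ (x)` is the multiplication by a scalar.
  obtain ⟨a, ha⟩ := Submodule.mkQ_surjective _ (ψ (Submodule.mkQ _ (1 : R)))
  refine ⟨a, ?_⟩
  have h (z : QuotSMulTop x R) : ψ z = a • z := by
    obtain ⟨z, rfl⟩ := Submodule.mkQ_surjective _ z
    have h1 : z = z • (1 : R) := by simp
    rw [h1, map_smul, map_smul, ← ha, smul_comm, ← map_smul _ a, smul_eq_mul, mul_one]
  rw [← hψ]
  ext t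
  exact (h _).symm

include hreg hx hx' in
/-- The dual of a module of finite length with respect to `R ⧸ (x)` is at most as long as the
module. -/
lemma length_linearMap_le (hR : IsGorensteinLocal R) {T : Type u} [AddCommGroup T] [Module R T]
    (hT : IsFiniteLength R T) :
    Module.length R (T →ₗ[R] QuotSMulTop x R) ≤ Module.length R T := by
  induction hT with
  | of_subsingleton => simp
  | @of_simple_quotient T _ _ N hN hNl ih =>
    let p : (T →ₗ[R] QuotSMulTop x R) →ₗ[R] (N →ₗ[R] QuotSMulTop x R) :=
      LinearMap.lcomp R _ N.subtype
    let q : ((T ⧸ N) →ₗ[R] QuotSMulTop x R) →ₗ[R] (T →ₗ[R] QuotSMulTop x R) :=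
      LinearMap.lcomp R _ N.mkQ
    have hq : LinearMap.ker p ≤ LinearMap.range q := fun f hf ↦ by
      have hf' : N ≤ LinearMap.ker f := fun z hz ↦ LinearMap.congr_fun hf ⟨z, hz⟩
      exact ⟨N.liftQ f hf', N.liftQ_mkQ f hf'⟩
    have hex : Function.Exact (LinearMap.ker p).subtype p.rangeRestrict := by
      rw [LinearMap.exact_iff, LinearMap.ker_rangeRestrict, Submodule.range_subtype]
    have hlen : Module.length R (T →ₗ[R] QuotSMulTop x R) =
        Module.length R (LinearMap.ker p) + Module.length R (LinearMap.range p) :=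
      Module.length_eq_add_of_exact (LinearMap.ker p).subtype p.rangeRestrict
        (Submodule.subtype_injective _) (LinearMap.surjective_rangeRestrict p) hex
    rw [hlen, Module.length_eq_add_of_exact N.subtype N.mkQ N.subtype_injective N.mkQ_surjective
        (LinearMap.exact_subtype_mkQ N), add_comm, Module.length_eq_one R (T ⧸ N)]
    refine add_le_add ((Module.length_le_of_injective _
      (Submodule.subtype_injective (LinearMap.range p))).trans ih) ?_
    calc Module.length R (LinearMap.ker p) ≤ Module.length R (LinearMap.range q) :=
          Module.length_le_of_injective _ (Submodule.inclusion_injective hq)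
      _ ≤ Module.length R ((T ⧸ N) →ₗ[R] QuotSMulTop x R) :=
          Module.length_le_of_surjective _ (LinearMap.surjective_rangeRestrict q)
      _ ≤ 1 := length_linearMap_le_one hreg hx hx' hR

include hreg hx hx' in
/-- In a Gorenstein ring of dimension one, an ideal `I` with `I² ⊆ (x) ⊆ I` satisfies
`ℓ(R ⧸ (x)) ≤ 2 ℓ(R ⧸ I)`: multiplication embeds `I ⧸ (x)` into the dual of `R ⧸ I`. -/
theorem length_quotient_span_singleton_le_two_mul (hR : IsGorensteinLocal R) (I : Ideal R)
    (hxI : x ∈ I) (hI : ∀ a ∈ I, ∀ b ∈ I, a * b ∈ Ideal.span {x}) :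
    Module.length R (R ⧸ Ideal.span {x}) ≤ 2 * Module.length R (R ⧸ I) := by
  have hIf : IsFiniteLength R (R ⧸ I) :=
    Module.length_ne_top_iff.mp (length_quotient_ne_top hreg I hxI hx')
  have hmem (a : R) : a ∈ (x • ⊤ : Submodule R R) ↔ a ∈ Ideal.span {x} := by
    rw [Submodule.mem_smul_pointwise_iff_exists, Ideal.mem_span_singleton']
    simp [mul_comm]
  have hle : Ideal.span {x} ≤ I := (Ideal.span_singleton_le_iff_mem I).mpr hxI
  let f : R ⧸ Ideal.span {x} →ₗ[R] R ⧸ I := Submodule.factor hle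
  let κ : I →ₗ[R] R ⧸ Ideal.span {x} := Submodule.mkQ _ ∘ₗ I.subtype
  let ν : I →ₗ[R] ((R ⧸ I) →ₗ[R] QuotSMulTop x R) :=
    { toFun := fun a ↦ Submodule.liftQ I (Submodule.mkQ (x • ⊤) ∘ₗ LinearMap.mulLeft R (a : R))
        fun b hb ↦ (Submodule.Quotient.mk_eq_zero _).mpr ((hmem _).mpr (hI a a.2 b hb))
      map_add' := fun a b ↦ by
        refine LinearMap.ext fun z ↦ ?_
        obtain ⟨z, rfl⟩ := Submodule.mkQ_surjective I z
        exact congrArg (Submodule.mkQ (x • ⊤ : Submodule R R)) (add_mul (a : R) b z)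
      map_smul' := fun c a ↦ by
        refine LinearMap.ext fun z ↦ ?_
        obtain ⟨z, rfl⟩ := Submodule.mkQ_surjective I z
        exact congrArg (Submodule.mkQ (x • ⊤ : Submodule R R)) (mul_assoc c (a : R) z) }
  have hker : LinearMap.ker ν ≤ LinearMap.ker κ := fun a ha ↦ by
    have h1 : Submodule.mkQ (x • ⊤ : Submodule R R) (a * 1) = 0 :=
      LinearMap.congr_fun ha (Submodule.mkQ I 1)
    rw [mul_one, Submodule.mkQ_apply, Submodule.Quotient.mk_eq_zero, hmem] at h1
    exact (Submodule.Quotient.mk_eq_zero _).mpr h1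
  have hex : Function.Exact (LinearMap.range κ).subtype f := by
    intro z
    obtain ⟨z, rfl⟩ := Submodule.mkQ_surjective _ z
    rw [Submodule.coe_subtype, Subtype.range_coe]
    change Submodule.mkQ I z = 0 ↔ _
    rw [Submodule.mkQ_apply, Submodule.Quotient.mk_eq_zero]
    refine ⟨fun hz ↦ ⟨⟨z, hz⟩, rfl⟩, fun ⟨a, ha⟩ ↦ ?_⟩
    have := hle ((Submodule.Quotient.eq _).mp ha)
    exact (Submodule.sub_mem_iff_right I a.2).mp this
  rw [Module.length_eq_add_of_exact (LinearMap.range κ).subtype f (Submodule.subtype_injective _)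
    (Submodule.factor_surjective hle) hex, two_mul]
  refine add_le_add_left ?_ _
  calc Module.length R (LinearMap.range κ) = Module.length R (I ⧸ LinearMap.ker κ) :=
        κ.quotKerEquivRange.length_eq.symm
    _ ≤ Module.length R (I ⧸ LinearMap.ker ν) :=
        Module.length_le_of_surjective _ (Submodule.factor_surjective hker)
    _ = Module.length R (LinearMap.range ν) := ν.quotKerEquivRange.length_eq
    _ ≤ Module.length R ((R ⧸ I) →ₗ[R] QuotSMulTop x R) :=
        Module.length_le_of_injective _ (Submodule.subtype_injective _)
    _ ≤ Module.length R (R ⧸ I) := length_linearMap_le hreg hx hx' hR hIf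

end Gorenstein

/-! ### Uniqueness of minimal free resolutions of modules -/

section Uniqueness

variable {R : Type u} [CommRing R]

/-- A quasi-isomorphism is injective on homology, in the form of a lifting property for
projectives. -/
lemma exists_comp_d_eq_of_quasiIso {F M : ChainComplex (ModuleCat.{u} R) ℤ} (π : F ⟶ M)
    [QuasiIso π] (i : ℤ) {P : ModuleCat.{u} R} [Projective P] (k : P ⟶ F.X i)
    (hk : k ≫ F.d i (i - 1) = 0) (w : P ⟶ M.X (i + 1)) (hw : k ≫ π.f i = w ≫ M.d (i + 1) i) :
    ∃ l : P ⟶ F.X (i + 1), l ≫ F.d (i + 1) i = k := by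
  have h0 : F.liftCycles k (i - 1) (by simp) hk ≫ F.homologyπ i = 0 := by
    rw [← cancel_mono (HomologicalComplex.homologyMap π i), Category.assoc,
      HomologicalComplex.homologyπ_naturality, HomologicalComplex.liftCycles_comp_cyclesMap_assoc,
      Limits.zero_comp]
    exact M.liftCycles_homologyπ_eq_zero_of_boundary _ _ (by simp) w hw
  have hex : (ShortComplex.mk (F.toCycles (i + 1) i) (F.homologyπ i) (by simp)).Exact :=
    ShortComplex.exact_of_g_is_cokernel _ (F.homologyIsCokernel (i + 1) i (by simp))
  refine ⟨hex.liftFromProjective _ h0, ?_⟩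
  have h1 := hex.liftFromProjective_comp _ h0
  rw [← F.toCycles_i, ← Category.assoc]
  dsimp only at h1
  rw [h1, HomologicalComplex.liftCycles_i]

/-- A quasi-isomorphism is surjective on homology, in the form of a lifting property for
projectives. -/
lemma exists_comp_f_add_eq_of_quasiIso {F M : ChainComplex (ModuleCat.{u} R) ℤ} (π : F ⟶ M)
    [QuasiIso π] (i : ℤ) {P : ModuleCat.{u} R} [Projective P] (k : P ⟶ M.X i)
    (hk : k ≫ M.d i (i - 1) = 0) :
    ∃ (l : P ⟶ F.X i) (h : P ⟶ M.X (i + 1)), l ≫ π.f i + h ≫ M.d (i + 1) i = k := by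
  let c : P ⟶ F.cycles i := Projective.factorThru
    (M.liftCycles k (i - 1) (by simp) hk ≫ M.homologyπ i ≫ inv (HomologicalComplex.homologyMap π i))
    (F.homologyπ i)
  have hc : c ≫ F.homologyπ i = _ := Projective.factorThru_comp _ _
  have h0 : (M.liftCycles k (i - 1) (by simp) hk - c ≫ HomologicalComplex.cyclesMap π i) ≫
      M.homologyπ i = 0 := by
    rw [Preadditive.sub_comp, Category.assoc, ← HomologicalComplex.homologyπ_naturality,
      ← Category.assoc, hc]
    simp
  have hex : (ShortComplex.mk (M.toCycles (i + 1) i) (M.homologyπ i) (by simp)).Exact :=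
    ShortComplex.exact_of_g_is_cokernel _ (M.homologyIsCokernel (i + 1) i (by simp))
  refine ⟨c ≫ F.iCycles i, hex.liftFromProjective _ h0, ?_⟩
  have h1 := hex.liftFromProjective_comp _ h0
  rw [← M.toCycles_i, ← Category.assoc _ (M.toCycles _ _)]
  dsimp only at h1
  rw [h1, Preadditive.sub_comp, HomologicalComplex.liftCycles_i]
  simp

variable [IsLocalRing R]

/-- Nakayama: a linear map onto a submodule lifts along minimal covers. -/
lemma exists_linearEquiv_of_map_range_eq {A B A' B' : Type u} [AddCommGroup A] [Module R A]
    [AddCommGroup B] [Module R B] [AddCommGroup A'] [Module R A'] [AddCommGroup B'] [Module R B']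
    [Module.Free R A] [Module.Finite R A] [Module.Free R A'] [Module.Finite R A']
    (d : A →ₗ[R] B) (d' : A' →ₗ[R] B') (e : B ≃ₗ[R] B')
    (he : (LinearMap.range d).map e.toLinearMap = LinearMap.range d')
    (hd : LinearMap.ker d ≤ maximalIdeal R • ⊤) (hd' : LinearMap.ker d' ≤ maximalIdeal R • ⊤) :
    ∃ f : A ≃ₗ[R] A', ∀ a, d' (f a) = e (d a) := by
  -- Any lift is surjective, in both directions.
  have key {A B A' B' : Type u} [AddCommGroup A] [Module R A]
      [AddCommGroup B] [Module R B] [AddCommGroup A'] [Module R A'] [AddCommGroup B'] [Module R B']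
      [Module.Free R A] [Module.Finite R A] [Module.Free R A'] [Module.Finite R A']
      (d : A →ₗ[R] B) (d' : A' →ₗ[R] B') (e : B ≃ₗ[R] B')
      (he : (LinearMap.range d).map e.toLinearMap = LinearMap.range d')
      (hd' : LinearMap.ker d' ≤ maximalIdeal R • ⊤) :
      ∃ f : A →ₗ[R] A', (∀ a, d' (f a) = e (d a)) ∧ Function.Surjective f := by
    obtain ⟨f, hf⟩ := exists_comp_eq_of_exact (LinearMap.exact_map_mkQ_range d')
      (e.toLinearMap ∘ₗ d) fun v ↦ by
        rw [Submodule.mkQ_apply, Submodule.Quotient.mk_eq_zero, ← he]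
        exact Submodule.mem_map_of_mem ⟨v, rfl⟩
    refine ⟨f, hf, LinearMap.range_eq_top.mp ?_⟩
    have h1 : (⊤ : Submodule R A') ≤ LinearMap.range f ⊔ maximalIdeal R • ⊤ := fun a' _ ↦ by
      have h2 : d' a' ∈ (LinearMap.range d).map e.toLinearMap := he ▸ ⟨a', rfl⟩
      obtain ⟨_, ⟨a, rfl⟩, ha⟩ := h2
      rw [← add_sub_cancel (f a) a']
      refine Submodule.add_mem_sup ⟨a, rfl⟩ (hd' ?_)
      rw [LinearMap.mem_ker, map_sub, hf, sub_eq_zero]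
      exact ha.symm
    exact top_le_iff.mp (Submodule.le_of_le_smul_of_le_jacobson_bot (Module.Finite.fg_top)
      (maximalIdeal_le_jacobson _) h1)
  obtain ⟨f, hf, hfs⟩ := key d d' e he hd'
  obtain ⟨g, hg, hgs⟩ := key d' d e.symm (by
    rw [← he, ← Submodule.map_comp]
    simp) hd
  have hinj : Function.Injective (g ∘ₗ f) :=
    OrzechProperty.injective_of_surjective_endomorphism _ (hgs.comp hfs)
  exact ⟨LinearEquiv.ofBijective f ⟨Function.Injective.of_comp hinj, hfs⟩, hf⟩

omit [IsLocalRing R] in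
lemma map_range_eq_of_exact {A B C A' B' C' : Type u} [AddCommGroup A] [Module R A]
    [AddCommGroup B] [Module R B] [AddCommGroup C] [Module R C] [AddCommGroup A'] [Module R A']
    [AddCommGroup B'] [Module R B'] [AddCommGroup C'] [Module R C'] {d : A →ₗ[R] B}
    {δ : B →ₗ[R] C} {d' : A' →ₗ[R] B'} {δ' : B' →ₗ[R] C'} (h : Function.Exact d δ)
    (h' : Function.Exact d' δ') (f : B ≃ₗ[R] B') (g : C ≃ₗ[R] C') (hfg : ∀ b, δ' (f b) = g (δ b)) :
    (LinearMap.range d).map f.toLinearMap = LinearMap.range d' := by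
  rw [← LinearMap.exact_iff.mp h, ← LinearMap.exact_iff.mp h']
  ext b
  rw [Submodule.mem_map_equiv, LinearMap.mem_ker, LinearMap.mem_ker, ← f.apply_symm_apply b, hfg,
    f.symm_apply_apply, LinearEquiv.map_eq_zero_iff]

lemma minorsIdeal_one_le_of_linearEquiv {A B A' B' : Type u} [AddCommGroup A] [Module R A]
    [AddCommGroup B] [Module R B] [AddCommGroup A'] [Module R A'] [AddCommGroup B'] [Module R B']
    [Module.Free R A] [Module.Finite R A] [Module.Free R B] [Module.Finite R B]
    (d : A →ₗ[R] B) (d' : A' →ₗ[R] B') (f : A ≃ₗ[R] A') (e : B ≃ₗ[R] B')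
    (h : ∀ a, d' (f a) = e (d a)) : minorsIdeal 1 d' ≤ minorsIdeal 1 d := by
  cases subsingleton_or_nontrivial A
  · rw [minorsIdeal_eq_top 1 d (.inl inferInstance)]
    exact le_top
  cases subsingleton_or_nontrivial B
  · rw [minorsIdeal_eq_top 1 d (.inr inferInstance)]
    exact le_top
  have := f.symm.toEquiv.nontrivial
  have := e.symm.toEquiv.nontrivial
  refine minorsIdeal_one_le d' _ fun φ v ↦ ?_
  rw [← f.apply_symm_apply v, h]
  exact apply_mem_minorsIdeal_one d (φ ∘ₗ e.toLinearMap) _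

/-- The augmentation of a minimal free resolution of a module. -/
lemma exists_exact_of_isMinimalFreeResolution {F : ChainComplex (ModuleCat.{u} R) ℤ}
    {N : ModuleCat.{u} R} (hF : IsMinimalFreeResolution F (moduleComplex N)) :
    ∃ ε : F.X 0 →ₗ[R] N, Function.Surjective ε ∧ Function.Exact (F.d 1 0).hom ε := by
  have hneg (i : ℕ) : Subsingleton (F.X (-1 - i)) := by
    obtain ⟨a, ha⟩ := hF.bounded
    -- Going up from the lowest degree, `F` vanishes below degree zero by Nakayama's lemma.
    have key (j : ℕ) : a + j ≤ 0 → Subsingleton (F.X (a + j - 1)) := by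
      induction j with
      | zero => exact fun _ ↦ ha _ (by simp)
      | succ j ih =>
        intro hj
        push_cast at hj ⊢
        have h1 := ih (by lia)
        have h2 := exact_of_isMinimalFreeResolution hF (a + j) (subsingleton_homology_moduleComplex N _
          (by lia)) (i := a + j + 1) (k := a + j - 1) rfl (by ring)
        have h3 := hF.minimal (a + j + 1)
        rw [add_sub_cancel_right, ← LinearMap.exact_iff.mp h2] at h3
        have := hF.finite (a + j)
        have h4 : (⊤ : Submodule R (F.X (a + j))) = ⊥ :=
          Submodule.eq_bot_of_le_smul_of_le_jacobson_bot (maximalIdeal R) _ Module.Finite.fg_top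
            (le_trans (fun v _ ↦ Subsingleton.elim _ _) h3) (maximalIdeal_le_jacobson _)
        have h5 : a + (j + 1) - 1 = a + (j : ℤ) := by ring
        rw [h5]
        exact (Submodule.subsingleton_iff R).mp (subsingleton_iff_bot_eq_top.mp h4.symm)
    by_cases h : -1 - (i : ℤ) < a
    · exact ha _ h
    · have := key (-1 - i - a + 1).toNat (by lia)
      rwa [show a + ((-1 - i - a + 1).toNat : ℤ) - 1 = -1 - i by lia] at this
  have hm1 : Subsingleton (F.X (0 - 1)) := by simpa using hneg 0
  obtain ⟨π, hπ⟩ := hF.quasiIso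
  have hM1 : Limits.IsZero ((moduleComplex N).X (0 + 1)) :=
    HomologicalComplex.isZero_single_obj_X _ _ _ _ (by simp)
  have hMm1 : Limits.IsZero ((moduleComplex N).X (0 - 1)) :=
    HomologicalComplex.isZero_single_obj_X _ _ _ _ (by simp)
  let e := HomologicalComplex.singleObjXSelf (ComplexShape.down ℤ) 0 N
  have hP : Projective (ModuleCat.of R R) :=
    (IsProjective.iff_projective (R := R) R).mp inferInstance
  have hwz (w : F.X 1) : (π.f 0).hom ((F.d 1 0).hom w) = 0 := by
    have h1 : F.d 1 0 ≫ π.f 0 = 0 := by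
      rw [← π.comm 1 0, hM1.eq_zero_of_tgt (π.f 1), Limits.zero_comp]
    exact congrArg (fun f ↦ f.hom w) h1
  refine ⟨(π.f 0 ≫ e.hom).hom, fun y ↦ ?_, fun z ↦ ⟨fun hz ↦ ?_, ?_⟩⟩
  · let k : ModuleCat.of R R ⟶ (moduleComplex N).X 0 :=
      ModuleCat.ofHom (LinearMap.toSpanSingleton R _ (e.inv.hom y))
    obtain ⟨l, h, hl⟩ := exists_comp_f_add_eq_of_quasiIso π 0 k (hMm1.eq_zero_of_tgt _)
    rw [hM1.eq_zero_of_tgt h, Limits.zero_comp, add_zero] at hl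
    refine ⟨l.hom 1, ?_⟩
    have h1 : (π.f 0).hom (l.hom 1) = e.inv.hom y := by
      exact (congrArg (fun f ↦ f.hom (1 : R)) hl).trans (one_smul R _)
    rw [ModuleCat.hom_comp, LinearMap.comp_apply, h1]
    exact congrArg (fun f ↦ f.hom y) e.inv_hom_id
  · let k : ModuleCat.of R R ⟶ F.X 0 := ModuleCat.ofHom (LinearMap.toSpanSingleton R _ z)
    have h1 : (π.f 0).hom z = 0 := by
      have h2 := congrArg e.inv.hom hz
      rw [map_zero] at h2
      exact (congrArg (fun f ↦ f.hom ((π.f 0).hom z)) e.hom_inv_id).symm.trans h2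
    obtain ⟨l, hl⟩ := exists_comp_d_eq_of_quasiIso π 0 k
      ((ModuleCat.isZero_of_subsingleton _).eq_zero_of_tgt _) 0 (by
        rw [Limits.zero_comp]
        refine ModuleCat.hom_ext (LinearMap.ext_ring ?_)
        simp [k, h1])
    refine ⟨l.hom 1, (congrArg (fun f ↦ f.hom (1 : R)) hl).trans ?_⟩
    simp [k]
  · rintro ⟨w, rfl⟩
    rw [ModuleCat.hom_comp, LinearMap.comp_apply, hwz, map_zero]

lemma ker_le_of_exact_of_isMinimalFreeResolution {F M : ChainComplex (ModuleCat.{u} R) ℤ}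
    (hF : IsMinimalFreeResolution F M) (i : ℤ) {C : Type u} [AddCommGroup C] [Module R C]
    {δ : F.X i →ₗ[R] C} (h : Function.Exact (F.d (i + 1) i).hom δ) :
    LinearMap.ker δ ≤ maximalIdeal R • ⊤ := by
  rw [LinearMap.exact_iff.mp h]
  have := hF.minimal (i + 1)
  rwa [add_sub_cancel_right] at this

/-- Two minimal free resolutions of a module have isomorphic differentials. -/
lemma exists_linearEquiv_of_isMinimalFreeResolution {F F' : ChainComplex (ModuleCat.{u} R) ℤ}
    {N : ModuleCat.{u} R} (hF : IsMinimalFreeResolution F (moduleComplex N))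
    (hF' : IsMinimalFreeResolution F' (moduleComplex N)) (i : ℤ) (hi : 0 ≤ i) :
    ∃ (e : F.X i ≃ₗ[R] F'.X i) (f : F.X (i + 1) ≃ₗ[R] F'.X (i + 1)),
      ∀ a, (F'.d (i + 1) i).hom (f a) = e ((F.d (i + 1) i).hom a) := by
  have := hF.free
  have := hF.finite
  have := hF'.free
  have := hF'.finite
  have hex (i : ℤ) (hi : 0 ≤ i) : Function.Exact (F.d (i + 1 + 1) (i + 1)).hom (F.d (i + 1) i).hom :=
    exact_of_isMinimalFreeResolution hF _ (subsingleton_homology_moduleComplex N _ (by lia)) rfl rfl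
  have hex' (i : ℤ) (hi : 0 ≤ i) :
      Function.Exact (F'.d (i + 1 + 1) (i + 1)).hom (F'.d (i + 1) i).hom :=
    exact_of_isMinimalFreeResolution hF' _ (subsingleton_homology_moduleComplex N _ (by lia)) rfl rfl
  have step (i : ℤ) (hi : 0 ≤ i) (e : F.X i ≃ₗ[R] F'.X i)
      (he : (LinearMap.range (F.d (i + 1) i).hom).map e.toLinearMap =
        LinearMap.range (F'.d (i + 1) i).hom) :
      ∃ f : F.X (i + 1) ≃ₗ[R] F'.X (i + 1),
        ∀ a, (F'.d (i + 1) i).hom (f a) = e ((F.d (i + 1) i).hom a) :=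
    exists_linearEquiv_of_map_range_eq _ _ e he
      (ker_le_of_exact_of_isMinimalFreeResolution hF _ (hex i hi))
      (ker_le_of_exact_of_isMinimalFreeResolution hF' _ (hex' i hi))
  induction i, hi using Int.leInduction with
  | base =>
    obtain ⟨ε, hε, hε0⟩ := exists_exact_of_isMinimalFreeResolution hF
    obtain ⟨ε', hε', hε0'⟩ := exists_exact_of_isMinimalFreeResolution hF'
    obtain ⟨e, he⟩ := exists_linearEquiv_of_map_range_eq ε ε' (.refl R N)
      (by rw [LinearMap.range_eq_top.mpr hε, LinearMap.range_eq_top.mpr hε']; simp)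
      (ker_le_of_exact_of_isMinimalFreeResolution hF 0 hε0)
      (ker_le_of_exact_of_isMinimalFreeResolution hF' 0 hε0')
    exact ⟨e, step 0 le_rfl e (map_range_eq_of_exact hε0 hε0' e (.refl R N) he)⟩
  | succ i hi ih =>
    obtain ⟨e, f, hef⟩ := ih
    exact ⟨f, step (i + 1) (by lia) f (map_range_eq_of_exact (hex i hi) (hex' i hi) f e hef)⟩

lemma tailIdeal_le_tailIdeal {F F' : ChainComplex (ModuleCat.{u} R) ℤ}
    {N : ModuleCat.{u} R} (hF : IsMinimalFreeResolution F (moduleComplex N))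
    (hF' : IsMinimalFreeResolution F' (moduleComplex N)) (n : ℤ) (hn : 0 ≤ n) :
    tailIdeal F' n 1 ≤ tailIdeal F n 1 := by
  have := hF.free
  have := hF.finite
  refine tailIdeal_le F' 1 n _ fun i hi ↦ le_trans ?_ (minorsIdeal_le_tailIdeal F 1 hi)
  obtain ⟨e, f, hef⟩ := exists_linearEquiv_of_isMinimalFreeResolution hF hF' i (by lia)
  exact minorsIdeal_one_le_of_linearEquiv _ _ f e hef

/-- When `R` is Artinian modulo the stable ideal of a module, the ideals of the tails of its minimal
free resolution eventually equal the stable ideal. -/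
theorem exists_tailIdeal_eq_stableIdeal [IsNoetherianRing R] {N : ModuleCat.{u} R}
    (h : stableIdeal (moduleComplex N) 1 ≠ ⊤)
    [IsArtinianRing (R ⧸ stableIdeal (moduleComplex N) 1)] :
    ∃ F, IsMinimalFreeResolution F (moduleComplex N) ∧ ∃ n : ℤ, 0 ≤ n ∧ ∀ k, n ≤ k →
      tailIdeal F k 1 = stableIdeal (moduleComplex N) 1 := by
  obtain ⟨F, hF⟩ : ∃ F, IsMinimalFreeResolution F (moduleComplex N) := by
    by_contra! h'
    exact h (by simp [stableIdeal, h'])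
  have hle (k : ℤ) (hk : infDegree F ≤ k) : stableIdeal (moduleComplex N) 1 ≤ tailIdeal F k 1 :=
    iInf₂_le_of_le F hF (iInf₂_le k hk)
  let a : ℤ := max 0 (infDegree F)
  obtain ⟨n, hn⟩ := exists_forall_sup_eq (stableIdeal (moduleComplex N) 1)
    (fun k : ℕ ↦ tailIdeal F (a + k) 1) fun i j hij ↦ tailIdeal_anti F 1 (by lia)
  have hn' (k : ℤ) (hk : a + n ≤ k) : tailIdeal F k 1 = tailIdeal F (a + n) 1 := by
    have h1 := hn (k - a).toNat (by lia)
    rw [sup_of_le_left (hle _ (by lia)), sup_of_le_left (hle _ (by lia))] at h1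
    rwa [show a + ((k - a).toNat : ℤ) = k by lia] at h1
  refine ⟨F, hF, a + n, by lia, fun k hk ↦ le_antisymm ?_ (hle k (by lia))⟩
  rw [hn' k hk]
  refine le_iInf₂ fun F' hF' ↦ le_iInf₂ fun m hm ↦ ?_
  calc tailIdeal F (a + n) 1 = tailIdeal F (max m (a + n)) 1 := (hn' _ (le_max_right _ _)).symm
    _ ≤ tailIdeal F' (max m (a + n)) 1 := tailIdeal_le_tailIdeal hF' hF _ (by lia)
    _ ≤ tailIdeal F' m 1 := tailIdeal_anti F' 1 (le_max_left _ _)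

end Uniqueness

/-! ### Counting lengths in resolutions with entries in the conductor -/

section Counting

variable {R : Type*} [CommRing R]

/-- Let `c` and `I` be ideals with `I c = u c`, for a non-zero-divisor `u` of `I`. For an exact
sequence `A → B → C → D` of free modules whose maps `A → B` and `B → C` have entries in `I` and in
`c`, the image `L` of `B → C` satisfies `L ⧸ u L ≃ B ⧸ I B`. -/
lemma length_quotSMulTop_range [Nontrivial R] {A B C D : Type*} [AddCommGroup A] [Module R A]
    [AddCommGroup B] [Module R B] [AddCommGroup C] [Module R C] [AddCommGroup D] [Module R D]
    [Module.Free R B] [Module.Finite R B] [Module.Free R D]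
    {d₃ : A →ₗ[R] B} {d₂ : B →ₗ[R] C} {d₁ : C →ₗ[R] D} (h₃ : Function.Exact d₃ d₂)
    (h₂ : Function.Exact d₂ d₁) {I c : Ideal R} {u : R} (hu : u ∈ I) (hu' : u ∈ nonZeroDivisors R)
    (hc : ∀ a ∈ I, ∀ n ∈ c, ∃ n' ∈ c, a * n = u * n')
    (hr₃ : LinearMap.range d₃ ≤ I • ⊤) (hr₂ : LinearMap.range d₂ ≤ c • ⊤) :
    Module.length R (QuotSMulTop u (LinearMap.range d₂)) =
      Module.finrank R B * Module.length R (R ⧸ I) := by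
  have hmul (a : R) (ha : a ∈ I) (v : C) (hv : v ∈ c • (⊤ : Submodule R C)) :
      ∃ w, a • v = u • w := by
    refine Submodule.smul_induction_on hv (fun n hn v _ ↦ ?_) ?_
    · obtain ⟨n', -, h⟩ := hc a ha n hn
      exact ⟨n' • v, by rw [smul_smul, smul_smul, h]⟩
    · rintro v v' ⟨w, hw⟩ ⟨w', hw'⟩
      exact ⟨w + w', by rw [smul_add, smul_add, hw, hw']⟩
  rw [← length_quotient_smul_top,
    length_quotSMulTop_eq_of_surjective d₂.rangeRestrict d₂.surjective_rangeRestrict]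
  intro v
  constructor
  · refine fun hv ↦ Submodule.smul_induction_on hv (fun a ha b _ ↦ ?_) ?_
    · obtain ⟨w, hw⟩ := hmul a ha (d₂ b) (hr₂ ⟨b, rfl⟩)
      have h0 : d₁ w = 0 := by
        refine Module.Flat.isSMulRegular_of_nonZeroDivisors (M := D) hu' ?_
        dsimp only
        rw [← map_smul, ← hw, map_smul, h₂.apply_apply_eq_zero, smul_zero, smul_zero]
      obtain ⟨b', rfl⟩ := (h₂ w).mp h0
      exact ⟨⟨_, b', rfl⟩, Subtype.ext (by simpa using hw)⟩
    · rintro v v' ⟨w, hw⟩ ⟨w', hw'⟩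
      exact ⟨w + w', by rw [map_add, smul_add, hw, hw']⟩
  · rintro ⟨⟨_, b, rfl⟩, hw⟩
    have h1 : d₂ (v - u • b) = 0 := by
      rw [map_sub, map_smul, sub_eq_zero]
      exact congrArg Subtype.val hw
    rw [← sub_add_cancel v (u • b)]
    exact add_mem (hr₃ ((h₃ _).mp h1)) (Submodule.smul_mem_smul hu trivial)

/-- The count of lengths in an exact sequence `Z → A → B → C → D` of free modules as in
`length_quotSMulTop_range`. -/
lemma finrank_add_finrank_mul_length [Nontrivial R] {Z A B C D : Type*} [AddCommGroup Z]
    [Module R Z] [AddCommGroup A] [Module R A]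
    [AddCommGroup B] [Module R B] [AddCommGroup C] [Module R C] [AddCommGroup D] [Module R D]
    [Module.Free R A] [Module.Finite R A] [Module.Free R B] [Module.Finite R B] [Module.Free R C]
    [Module.Free R D] {d₄ : Z →ₗ[R] A}
    {d₃ : A →ₗ[R] B} {d₂ : B →ₗ[R] C} {d₁ : C →ₗ[R] D} (h₄ : Function.Exact d₄ d₃)
    (h₃ : Function.Exact d₃ d₂)
    (h₂ : Function.Exact d₂ d₁) {I c : Ideal R} {u : R} (hu : u ∈ I) (hu' : u ∈ nonZeroDivisors R)
    (hc : ∀ a ∈ I, ∀ n ∈ c, ∃ n' ∈ c, a * n = u * n') (hcI : c ≤ I)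
    (hr₄ : LinearMap.range d₄ ≤ c • ⊤) (hr₃ : LinearMap.range d₃ ≤ c • ⊤)
    (hr₂ : LinearMap.range d₂ ≤ c • ⊤) :
    (Module.finrank R A + Module.finrank R B : ℕ) * Module.length R (R ⧸ I) =
      Module.finrank R B * Module.length R (R ⧸ Ideal.span {u}) := by
  have h6 : Module.length R (QuotSMulTop u B) =
      Module.finrank R B * Module.length R (R ⧸ Ideal.span {u}) := by
    rw [← length_quotient_smul_top, Submodule.ideal_span_singleton_smul]
  have h5 := length_quotSMulTop_eq_add (u := u) d₂.rangeRestrict d₂.surjective_rangeRestrict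
    (Module.Flat.isSMulRegular_of_nonZeroDivisors (M := C) hu' |>.submodule _ _)
  rw [LinearMap.ker_rangeRestrict, LinearMap.exact_iff.mp h₃,
    length_quotSMulTop_range h₄ h₃ hu hu' hc (hr₄.trans (Submodule.smul_mono_left hcI)) hr₃,
    length_quotSMulTop_range h₃ h₂ hu hu' hc (hr₃.trans (Submodule.smul_mono_left hcI)) hr₂, h6] at h5
  rw [h5, Nat.cast_add, add_mul]

end Counting

section Bound

variable {R : Type u} [CommRing R] [IsLocalRing R]

lemma range_le_smul_top_of_minorsIdeal_le {F G : Type u} [AddCommGroup F] [Module R F]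
    [AddCommGroup G] [Module R G] [Module.Free R F] [Module.Finite R F] [Module.Free R G]
    [Module.Finite R G] (g : F →ₗ[R] G) {I : Ideal R} (h : minorsIdeal 1 g ≤ I) :
    LinearMap.range g ≤ I • ⊤ := by
  rintro _ ⟨v, rfl⟩
  let b := Module.finBasis R G
  rw [← b.sum_repr (g v)]
  exact sum_mem fun i _ ↦ Submodule.smul_mem_smul (h (apply_mem_minorsIdeal_one g (b.coord i) v))
    trivial

variable [IsNoetherianRing R] [Infinite (ResidueField R)]

/-- If the conductor is a stable ideal of entries, then the multiplicity of a Gorenstein ring is at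
most two. -/
theorem maximalIdeal_eq_span_or_length_eq_two (hdim : ringKrullDim R = 1)
    (hR : IsAnalyticallyUnramified R) (hG : IsGorensteinLocal R) {x : R} (hx : x ∈ maximalIdeal R)
    (hx' : x ∈ nonZeroDivisors R)
    (hxc : ∀ a ∈ maximalIdeal R, ∀ n ∈ conductorIdeal R, ∃ n' ∈ conductorIdeal R, a * n = x * n')
    (N : ModuleCat.{u} R) (hN : stableIdeal (moduleComplex N) 1 = conductorIdeal R) :
    maximalIdeal R = Ideal.span {x} ∨ Module.length R (R ⧸ Ideal.span {x}) = 2 := by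
  obtain ⟨s, hs, hs'⟩ := exists_mem_conductorIdeal_mem_nonZeroDivisors hdim hR
  have : Ring.KrullDimLE 1 R := Ring.krullDimLE_iff.mpr hdim.le
  have hreg := isMaximal_of_mem_nonZeroDivisors_of_krullDimLE (A := R)
  by_cases hc : conductorIdeal R = ⊤
  · refine .inl (le_antisymm (fun a ha ↦ ?_) ((Ideal.span_singleton_le_iff_mem _).mpr hx))
    obtain ⟨n, -, hn⟩ := hxc a ha 1 (hc ▸ trivial)
    rw [mul_one] at hn
    rw [hn]
    exact Ideal.mul_mem_right _ _ (Ideal.mem_span_singleton_self x)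
  obtain ⟨u, hu, hu', huc⟩ := exists_forall_mul_mem_conductorIdeal hdim hR (conductorIdeal R) hs hs'
  have hcm := le_maximalIdeal hc
  have hart := isArtinianRing_quotient_of_mem_nonZeroDivisors hreg (conductorIdeal R) hs hs'
  rw [← hN] at hart
  obtain ⟨F, hF, n, hn, hFn⟩ := exists_tailIdeal_eq_stableIdeal (hN ▸ hc)
  rw [hN] at hFn
  have := hF.free
  have := hF.finite
  have hnt (i : ℤ) (hi : n < i) : Nontrivial (F.X i) := by
    by_contra hnt
    rw [not_nontrivial_iff_subsingleton] at hnt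
    exact hc (by rw [← hFn n le_rfl, tailIdeal_eq_top F 1 hi])
  have hex (i : ℤ) (hi : 0 ≤ i) : Function.Exact (F.d (i + 1 + 1) (i + 1)).hom (F.d (i + 1) i).hom :=
    exact_of_isMinimalFreeResolution hF _ (subsingleton_homology_moduleComplex N _ (by lia)) rfl rfl
  have hran (i : ℤ) (hi : n ≤ i) : LinearMap.range (F.d (i + 1) i).hom ≤ conductorIdeal R • ⊤ :=
    range_le_smul_top_of_minorsIdeal_le _
      ((minorsIdeal_le_tailIdeal F 1 hi).trans (hFn n le_rfl).le)
  have count {I : Ideal R} {v : R} (hv : v ∈ I) (hv' : v ∈ nonZeroDivisors R)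
      (hvc : ∀ a ∈ I, ∀ n ∈ conductorIdeal R, ∃ n' ∈ conductorIdeal R, a * n = v * n')
      (hcI : conductorIdeal R ≤ I) :=
    finrank_add_finrank_mul_length (hex _ (by lia)) (hex _ (by lia)) (hex n hn) hv hv' hvc hcI
      (hran _ (by lia)) (hran _ (by lia)) (hran _ (by lia))
  have h1 := count hx hx' hxc hcm
  have h2 := count hu hu' huc le_rfl
  have h3 := length_quotient_span_singleton_le_two_mul hreg (hcm hu) hu' hG (conductorIdeal R) hu
    fun a ha b hb ↦ by
      obtain ⟨n', -, h⟩ := huc a ha b hb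
      rw [h]
      exact Ideal.mul_mem_right _ _ (Ideal.mem_span_singleton_self u)
  have hm1 : Module.length R (R ⧸ maximalIdeal R) = 1 :=
    Module.length_eq_one_iff.mpr (isSimpleModule_iff_quot_maximal.mpr
      ⟨_, inferInstance, ⟨.refl R _⟩⟩)
  have hb : 0 < Module.finrank R (F.X (n + 1 + 1)) := by
    have := hnt (n + 1 + 1) (by lia)
    exact Nat.pos_of_ne_zero fun h ↦ not_subsingleton (F.X (n + 1 + 1))
      ((Module.finrank_eq_zero_iff_of_free R _).mp h)
  have hcpos : 0 < Module.length R (R ⧸ conductorIdeal R) := by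
    have := Ideal.Quotient.nontrivial_iff.mpr hc
    exact Module.length_pos
  obtain ⟨E, hE⟩ := ENat.ne_top_iff_exists.mp
    (length_quotient_ne_top hreg _ (Ideal.mem_span_singleton_self x) hx')
  obtain ⟨U, hU⟩ := ENat.ne_top_iff_exists.mp
    (length_quotient_ne_top hreg _ (Ideal.mem_span_singleton_self u) hu')
  obtain ⟨L, hL⟩ := ENat.ne_top_iff_exists.mp (length_quotient_ne_top hreg _ hs hs')
  rw [hm1, ← hE, mul_one] at h1
  rw [← hU, ← hL] at h2
  rw [← hU, ← hL] at h3
  rw [← hL] at hcpos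
  rw [← hE]
  norm_cast at h1 h2 h3 hcpos ⊢
  have hEL : U = E * L := by
    refine Nat.eq_of_mul_eq_mul_left hb ?_
    rw [← h2, h1, mul_assoc]
  have hE2 : E ≤ 2 := Nat.le_of_mul_le_mul_right (hEL ▸ h3) hcpos
  have hE0 : E ≠ 0 := by
    rintro rfl
    have := Module.length_eq_zero_iff.mp hE.symm
    rw [Ideal.Quotient.subsingleton_iff] at this
    exact (maximalIdeal.isMaximal R).ne_top
      (top_le_iff.mp (this ▸ (Ideal.span_singleton_le_iff_mem _).mpr hx))
  by_cases hE1 : E = 1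
  · left
    rw [hE1] at hE
    have := isSimpleModule_iff_isCoatom.mp (Module.length_eq_one_iff.mp hE.symm)
    exact (eq_maximalIdeal ⟨this⟩).symm
  · right
    lia

end Bound

/-! ### The conductor of regular rings and of rings of multiplicity two -/

section Conductor

variable {R : Type u} [CommRing R]

lemma exists_mem_conductorIdeal_eq_smul {r : R} (hr : r ∈ conductorIdeal R) {z : FractionRing R}
    (hz : z ∈ integralClosure R (FractionRing R)) :
    ∃ p ∈ conductorIdeal R, algebraMap R (FractionRing R) p = r • z := by
  obtain ⟨p, hp⟩ := hr z hz
  refine ⟨p, fun y hy ↦ ?_, hp⟩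
  rw [Algebra.smul_def, hp, smul_mul_assoc]
  exact hr _ (mul_mem hz hy)

variable [IsLocalRing R] [IsNoetherianRing R]

lemma conductorIdeal_eq_top_of_maximalIdeal_eq_span {x s : R} (hx' : x ∈ nonZeroDivisors R)
    (hm : maximalIdeal R = Ideal.span {x}) (hs : s ∈ conductorIdeal R)
    (hs' : s ∈ nonZeroDivisors R) : conductorIdeal R = ⊤ := by
  have hs0 : s ≠ 0 := nonZeroDivisors.ne_zero hs'
  -- The conductor is a power `(xᵏ)`; as it is an ideal of the integral closure, so is `(1)`.
  have hex : ∃ k, ¬ conductorIdeal R ≤ maximalIdeal R ^ k := by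
    by_contra! h
    have : s ∈ (⨅ k, maximalIdeal R ^ k : Ideal R) := Submodule.mem_iInf _ |>.mpr fun k ↦ h k hs
    rw [Ideal.iInf_pow_eq_bot_of_isLocalRing _ (maximalIdeal.isMaximal R).ne_top] at this
    exact hs0 this
  classical
  have hk0 : Nat.find hex ≠ 0 := fun h ↦ by
    have := Nat.find_spec hex
    rw [h, pow_zero, Ideal.one_eq_top] at this
    exact this le_top
  obtain ⟨j, hj⟩ := Nat.exists_eq_succ_of_ne_zero hk0
  have h1 : conductorIdeal R ≤ Ideal.span {x ^ j} := by
    rw [← Ideal.span_singleton_pow, ← hm]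
    exact not_not.mp (Nat.find_min hex (hj ▸ Nat.lt_succ_self j))
  have h2 := Nat.find_spec hex
  rw [hj, hm, Ideal.span_singleton_pow, SetLike.not_le_iff_exists] at h2
  obtain ⟨r, hr, hrj⟩ := h2
  obtain ⟨t, rfl⟩ := Ideal.mem_span_singleton.mp (h1 hr)
  have ht : IsUnit t := by
    by_contra ht
    rw [← mem_nonunits_iff, ← mem_maximalIdeal, hm] at ht
    obtain ⟨t', rfl⟩ := Ideal.mem_span_singleton.mp ht
    exact hrj (Ideal.mem_span_singleton.mpr ⟨t', by rw [pow_succ]; ring⟩)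
  have hxj : x ^ j ∈ conductorIdeal R := (Ideal.mul_unit_mem_iff_mem _ ht).mp hr
  rw [Ideal.eq_top_iff_one]
  intro z hz
  obtain ⟨p, hp, hpz⟩ := exists_mem_conductorIdeal_eq_smul hxj hz
  obtain ⟨t, rfl⟩ := Ideal.mem_span_singleton.mp (h1 hp)
  refine ⟨t, (IsLocalization.map_units (FractionRing R)
    (⟨x ^ j, pow_mem hx' j⟩ : nonZeroDivisors R)).mul_left_cancel ?_⟩
  rw [one_smul, ← map_mul, hpz, Algebra.smul_def]

lemma exists_maximalIdeal_eq_span_of_isRegularLocalRing (hdim : ringKrullDim R = 1)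
    (hreg : IsRegularLocalRing R) : ∃ x, maximalIdeal R = Ideal.span {x} := by
  have h := (isRegularLocalRing_iff R).mp hreg
  rw [hdim] at h
  obtain ⟨s, hs, hs'⟩ := Submodule.FG.exists_span_finset_card_eq_spanFinrank
    (IsNoetherian.noetherian (maximalIdeal R))
  have h1 : (maximalIdeal R).spanFinrank = 1 := by exact_mod_cast h
  rw [h1] at hs
  obtain ⟨x, rfl⟩ := Finset.card_eq_one.mp hs
  exact ⟨x, by rw [← hs', Finset.coe_singleton]⟩

lemma isRegularLocalRing_of_maximalIdeal_eq_span (hdim : ringKrullDim R = 1) {x : R}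
    (hm : maximalIdeal R = Ideal.span {x}) : IsRegularLocalRing R := by
  refine IsRegularLocalRing.of_spanFinrank_maximalIdeal_le R ?_
  rw [hdim, hm]
  have := Submodule.spanFinrank_span_le_ncard_of_finite (R := R) (Set.finite_singleton x)
  rw [Set.ncard_singleton] at this
  exact_mod_cast this

omit [IsLocalRing R] [IsNoetherianRing R] in
lemma length_quotient_add_one_le {I J : Ideal R} (h : I < J) :
    Module.length R (R ⧸ J) + 1 ≤ Module.length R (R ⧸ I) := by
  rw [Module.length_quotient, Module.length_quotient]
  exact Order.coheight_add_one_le h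

/-- In multiplicity two the conductor `𝔠` is generated by two elements, as `𝔠 ⧸ x 𝔠` has the same
length as `R ⧸ (x)`. One of them can be any `u` with `𝔠² = u 𝔠`. -/
lemma exists_conductorIdeal_le_span_pair {x u s : R} (hx : x ∈ maximalIdeal R)
    (hx' : x ∈ nonZeroDivisors R)
    (hreg : ∀ p : Ideal R, p.IsPrime → ∀ a ∈ p, a ∈ nonZeroDivisors R → p.IsMaximal)
    (hs : s ∈ conductorIdeal R) (hs' : s ∈ nonZeroDivisors R)
    (hu : u ∈ conductorIdeal R) (hu' : u ∈ nonZeroDivisors R)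
    (huc : ∀ a ∈ conductorIdeal R, ∀ n ∈ conductorIdeal R, ∃ n' ∈ conductorIdeal R, a * n = u * n')
    (hlen : Module.length R (R ⧸ Ideal.span {x}) = 2) :
    ∃ v ∈ conductorIdeal R, conductorIdeal R ≤ Ideal.span {u, v} := by
  set c := conductorIdeal R with hc
  have hmem (a : R) : a ∈ Ideal.span {x} * c ↔ ∃ n ∈ c, x * n = a := Ideal.mem_span_singleton_mul
  have hxcc : Ideal.span {x} * c ≤ c := Ideal.mul_le_right
  -- By Nakayama's lemma it suffices to generate `c` modulo `x c`.
  have nak (J : Ideal R) (hJ : c ≤ J ⊔ Ideal.span {x} * c) : c ≤ J :=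
    Submodule.le_of_le_smul_of_le_jacobson_bot (IsNoetherian.noetherian c)
      (((Ideal.span_singleton_le_iff_mem _).mpr hx).trans (maximalIdeal_le_jacobson _)) hJ
  have hu0 : u ∉ Ideal.span {x} * c := fun h ↦ by
    obtain ⟨u', hu'c, rfl⟩ := (hmem u).mp h
    have hu'0 : u' ∈ nonZeroDivisors R := (mul_mem_nonZeroDivisors.mp hu').2
    have h1 : c ≤ ⊥ := nak ⊥ fun n hn ↦ by
      obtain ⟨n', hn', h⟩ := huc u' hu'c n hn
      refine Submodule.mem_sup_right ((hmem n).mpr ⟨n', hn', ?_⟩)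
      refine (mul_cancel_left_mem_nonZeroDivisors hu'0).mp ?_
      rw [h]; ring
    exact nonZeroDivisors.ne_zero hs' ((Submodule.mem_bot R).mp (h1 hs))
  let J := Ideal.span {x} * c ⊔ Ideal.span {u}
  have hJc : J ≤ c := sup_le hxcc ((Ideal.span_singleton_le_iff_mem _).mpr hu)
  by_cases hJ : c ≤ J
  · refine ⟨0, zero_mem _, nak _ (hJ.trans (sup_le le_sup_right (le_sup_of_le_left ?_)))⟩
    exact Ideal.span_mono (by simp)
  obtain ⟨v, hv, hvJ⟩ := SetLike.not_le_iff_exists.mp hJ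
  refine ⟨v, hv, nak _ ?_⟩
  let J' := J ⊔ Ideal.span {v}
  have hJ'c : J' ≤ c := sup_le hJc ((Ideal.span_singleton_le_iff_mem _).mpr hv)
  have hJ' : J' = c := by
    by_contra h
    have h1 := length_quotient_add_one_le (lt_of_le_of_ne hJ'c h)
    have h2 := length_quotient_add_one_le (I := J) (J := J') (lt_of_le_not_ge le_sup_left fun h ↦
      hvJ (h (Ideal.mem_sup_right (Ideal.mem_span_singleton_self v))))
    have h3 := length_quotient_add_one_le (I := Ideal.span {x} * c) (J := J)
      (lt_of_le_not_ge le_sup_left fun h ↦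
        hu0 (h (Ideal.mem_sup_right (Ideal.mem_span_singleton_self u))))
    rw [length_quotient_span_singleton_mul hx', hlen] at h3
    obtain ⟨L, hL⟩ := ENat.ne_top_iff_exists.mp (length_quotient_ne_top hreg c hs hs')
    have h4 : Module.length R (R ⧸ c) + 1 + 1 + 1 ≤ Module.length R (R ⧸ c) + 2 :=
      le_trans (by gcongr; exact le_trans (by gcongr) h2) h3
    rw [← hL] at h4
    norm_cast at h4
    lia
  rw [← hJ']
  refine sup_le (sup_le ?_ ?_) ?_
  · rw [hJ']
    exact le_sup_right
  · exact le_sup_of_le_left (Ideal.span_mono (by simp))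
  · exact le_sup_of_le_left (Ideal.span_mono (by simp))

omit [IsNoetherianRing R] in
/-- If the conductor `𝔠` is generated by `u, v` with `v² = u w`, `u` a non-zero-divisor and
`w ∈ 𝔠`, then its minimal resolution is periodic of period one, with entries `u, v, w`. -/
theorem stableIdeal_conductorIdeal_le (hc : conductorIdeal R ≠ ⊤) {u v w : R}
    (hu : u ∈ conductorIdeal R) (hv : v ∈ conductorIdeal R) (hw : w ∈ conductorIdeal R)
    (hu' : u ∈ nonZeroDivisors R) (huv : conductorIdeal R ≤ Ideal.span {u, v})
    (h : v * v = u * w) :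
    stableIdeal (moduleComplex (ModuleCat.of R (conductorIdeal R))) 1 ≤ conductorIdeal R := by
  have hcm := le_maximalIdeal hc
  let ε : (Fin 2 → R) →ₗ[R] R := Fintype.linearCombination R ![u, v]
  have hε (p : Fin 2 → R) : ε p = p 0 * u + p 1 * v := by
    simp [ε, Fintype.linearCombination_apply, Fin.sum_univ_two]
  have hεc (p : Fin 2 → R) : ε p ∈ conductorIdeal R := by
    rw [hε]
    exact add_mem (Ideal.mul_mem_left _ _ hu) (Ideal.mul_mem_left _ _ hv)
  let D : (Fin 2 → R) →ₗ[R] (Fin 2 → R) := Matrix.toLin' !![-v, -w; u, v]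
  have hD0 (p : Fin 2 → R) : D p 0 = -v * p 0 - w * p 1 := by
    simp [D, Matrix.mulVec, dotProduct, Fin.sum_univ_two]; ring
  have hD1 (p : Fin 2 → R) : D p 1 = u * p 0 + v * p 1 := by
    simp [D, Matrix.mulVec, dotProduct, Fin.sum_univ_two]
  have hDc (p : Fin 2 → R) (i : Fin 2) : D p i ∈ conductorIdeal R := by
    fin_cases i
    · change D p 0 ∈ _
      rw [hD0]
      exact sub_mem (Ideal.mul_mem_right _ _ (neg_mem hv)) (Ideal.mul_mem_right _ _ hw)
    · change D p 1 ∈ _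
      rw [hD1]
      exact add_mem (Ideal.mul_mem_right _ _ hu) (Ideal.mul_mem_right _ _ hv)
  -- The relations between `u` and `v` have entries in the conductor.
  have hb {a b : R} (hab : a * u + b * v = 0) : b ∈ conductorIdeal R := fun z hz ↦ by
    obtain ⟨r, hr, hrz⟩ := exists_mem_conductorIdeal_eq_smul hu hz
    obtain ⟨p, q, rfl⟩ := Ideal.mem_span_pair.mp (huv hr)
    refine ⟨b * p - q * a, (IsLocalization.map_units (FractionRing R)
      (⟨u, hu'⟩ : nonZeroDivisors R)).mul_left_cancel ?_⟩
    rw [Algebra.smul_def, ← map_mul, mul_left_comm, ← Algebra.smul_def u, ← hrz, ← map_mul]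
    congr 1
    linear_combination (- q) * hab
  have hrange {p : Fin 2 → R} (hp : ε p = 0) : p ∈ Set.range D := by
    rw [hε] at hp
    obtain ⟨a, b, hab⟩ := Ideal.mem_span_pair.mp (huv (hb hp))
    have hp0 : p 0 = -v * a - w * b := by
      refine (mul_cancel_left_mem_nonZeroDivisors hu').mp ?_
      linear_combination hp + v * hab - b * h
    refine ⟨![a, b], funext fun i ↦ ?_⟩
    fin_cases i
    · change D _ 0 = p 0
      rw [hD0, hp0]
      simp
    · change D _ 1 = p 1
      rw [hD1, ← hab]
      simp [mul_comm]
  have hεD (p : Fin 2 → R) : ε (D p) = 0 := by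
    rw [hε, hD0, hD1]
    linear_combination p 1 * h
  have hDD : Function.Exact D D := fun p ↦ by
    refine ⟨fun hp ↦ hrange ?_, ?_⟩
    · rw [hε]
      have := congrFun hp 1
      rw [hD1] at this
      rw [mul_comm, mul_comm (p 1)]
      exact this
    · rintro ⟨q, rfl⟩
      funext i
      fin_cases i
      · change D (D q) 0 = 0
        rw [hD0, hD0, hD1]
        linear_combination q 0 * h
      · change D (D q) 1 = 0
        rw [hD1, hD0, hD1]
        linear_combination q 1 * h
  have hmin : LinearMap.range D ≤ maximalIdeal R • (⊤ : Submodule R (Fin 2 → R)) := by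
    rintro _ ⟨p, rfl⟩
    rw [← (Pi.basisFun R (Fin 2)).sum_repr (D p)]
    refine sum_mem fun i _ ↦ Submodule.smul_mem_smul ?_ trivial
    rw [Pi.basisFun_repr]
    exact hcm (hDc p i)
  let ε' : (Fin 2 → R) →ₗ[R] conductorIdeal R := ε.codRestrict (conductorIdeal R) hεc
  have hε' : Function.Surjective ε' := fun z ↦ by
    obtain ⟨a, b, hab⟩ := Ideal.mem_span_pair.mp (huv z.2)
    refine ⟨![a, b], Subtype.ext ?_⟩
    change ε ![a, b] = z
    rw [hε, ← hab]
    simp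
  have hDε' : Function.Exact D ε' := fun p ↦ by
    refine ⟨fun hp ↦ hrange (congrArg Subtype.val hp), ?_⟩
    rintro ⟨q, rfl⟩
    exact Subtype.ext (hεD q)
  obtain ⟨F, hF, hF0, hFt⟩ := exists_isMinimalFreeResolution (fun _ ↦ ModuleCat.of R (Fin 2 → R))
    (fun _ ↦ ModuleCat.ofHom D) (ModuleCat.of R (conductorIdeal R)) (ModuleCat.ofHom ε')
    (fun _ ↦ inferInstanceAs (Module.Finite R (Fin 2 → R)))
    (fun _ ↦ inferInstanceAs (Module.Free R (Fin 2 → R))) (fun _ ↦ hmin) (fun _ ↦ hDD) hε' hDε'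
    (inferInstanceAs (Nontrivial (Fin 2 → R)))
  refine iInf₂_le_of_le F hF (iInf₂_le_of_le 0 hF0.le ((hFt 1).trans (iSup_le fun _ ↦ ?_)))
  refine minorsIdeal_one_le (F := Fin 2 → R) (G := Fin 2 → R) D _ fun φ p ↦ ?_
  rw [← (Pi.basisFun R (Fin 2)).sum_repr (D p), map_sum]
  refine sum_mem fun i _ ↦ ?_
  rw [map_smul, smul_eq_mul, Pi.basisFun_repr]
  exact Ideal.mul_mem_right _ _ (hDc p i)

end Conductor

/-! ### Independence of forms in regular local rings -/

section TwoDimensional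

variable {E : Type*} [CommRing E]

lemma span_pair_pow_succ_le (X Y : E) (n : ℕ) :
    Ideal.span {X, Y} ^ (n + 1) ≤ Ideal.span {X} * Ideal.span {X, Y} ^ n ⊔ Ideal.span {Y ^ (n + 1)} := by
  induction n with
  | zero => simp [Ideal.span_insert]
  | succ n ih =>
    have h1 : Ideal.span {X, Y} ^ (n + 2) = Ideal.span {X} * Ideal.span {X, Y} ^ (n + 1) ⊔
        Ideal.span {Y} * Ideal.span {X, Y} ^ (n + 1) := by
      rw [pow_succ' _ (n + 1), ← Ideal.sup_mul, ← Ideal.span_insert]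
    rw [h1]
    refine sup_le le_sup_left ((Ideal.mul_mono_right ih).trans ?_)
    rw [Ideal.mul_sup]
    refine sup_le (le_sup_of_le_left ?_) (le_sup_of_le_right ?_)
    · rw [mul_left_comm, pow_succ']
      exact Ideal.mul_mono_right (Ideal.mul_mono_left (Ideal.span_mono (by simp)))
    · rw [Ideal.span_singleton_mul_span_singleton, ← pow_succ']

lemma exists_sum_eq_of_mem_span_pair_pow {X Y : E} {n : ℕ} {z : E} (hz : z ∈ Ideal.span {X, Y} ^ n) :
    ∃ u : ℕ → E, z = ∑ i ∈ Finset.range (n + 1), u i * (X ^ i * Y ^ (n - i)) := by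
  induction n generalizing z with
  | zero => exact ⟨fun _ ↦ z, by simp⟩
  | succ n ih =>
    obtain ⟨a, ha, b, hb, rfl⟩ := Submodule.mem_sup.mp (span_pair_pow_succ_le X Y n hz)
    obtain ⟨w, hw, rfl⟩ := Ideal.mem_span_singleton_mul.mp ha
    obtain ⟨v, rfl⟩ := Ideal.mem_span_singleton'.mp hb
    obtain ⟨u, rfl⟩ := ih hw
    refine ⟨fun i ↦ if i = 0 then v else u (i - 1), ?_⟩
    rw [Finset.sum_range_succ' _ (n + 1), Finset.mul_sum]
    congr 1
    · refine Finset.sum_congr rfl fun i _ ↦ ?_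
      simp only [Nat.add_eq_zero_iff, one_ne_zero, and_false, if_false, Nat.add_sub_cancel,
        Nat.add_sub_add_right]
      ring
    · simp

variable [IsLocalRing E] [IsNoetherianRing E] {X Y : E}

lemma ringKrullDim_le_one_of_forall_isPrime {t : E} (ht : t ∈ maximalIdeal E)
    (h : ∀ p : Ideal E, p.IsPrime → t ∈ p → maximalIdeal E ≤ p) : ringKrullDim E ≤ 1 := by
  rw [← maximalIdeal_height_eq_ringKrullDim]
  have h1 : maximalIdeal E ∈ (Ideal.span {t}).minimalPrimes :=
    ⟨⟨inferInstance, (Ideal.span_singleton_le_iff_mem _).mpr ht⟩, fun p hp _ ↦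
      h p hp.1 (hp.2 (Ideal.mem_span_singleton_self t))⟩
  exact_mod_cast Ideal.height_le_one_of_isPrincipal_of_mem_minimalPrimes _ _ h1

variable (hm : maximalIdeal E = Ideal.span {X, Y}) (hdim : 2 ≤ ringKrullDim E)

include hm hdim

lemma pow_notMem_span_singleton (k : ℕ) : Y ^ k ∉ Ideal.span {X} := by
  intro h
  have := ringKrullDim_le_one_of_forall_isPrime (t := X) (hm ▸ Ideal.subset_span (by simp))
    fun p hp hX ↦ by
      rw [hm, Ideal.span_le, Set.pair_subset_iff]
      exact ⟨hX, hp.mem_of_pow_mem k ((Ideal.span_singleton_le_iff_mem _).mpr hX h)⟩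
  exact absurd (hdim.trans this) (by norm_num)

lemma ne_zero_of_two_le_ringKrullDim : X ≠ 0 := by
  rintro rfl
  have := ringKrullDim_le_one_of_forall_isPrime (t := Y) (hm ▸ Ideal.subset_span (by simp))
    fun p _ hY ↦ by
      rw [hm, Ideal.span_le, Set.pair_subset_iff]
      exact ⟨p.zero_mem, hY⟩
  exact absurd (hdim.trans this) (by norm_num)

/-- If `X` and `Y` generate the maximal ideal of a local ring of dimension at least two, then `Y` is
regular modulo `X`. -/
lemma mem_span_singleton_of_pow_mul_mem {k : ℕ} {a : E} (h : Y ^ k * a ∈ Ideal.span {X}) :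
    a ∈ Ideal.span {X} := by
  -- The saturation `I` of `(X)` with respect to `Y` satisfies `I = (X) + Y I`.
  let I : Ideal E :=
    { carrier := {a | ∃ k, Y ^ k * a ∈ Ideal.span {X}}
      add_mem' := fun {a b} ⟨k, hk⟩ ⟨l, hl⟩ ↦ ⟨k + l, by
        have h1 := add_mem (Ideal.mul_mem_left _ (Y ^ l) hk) (Ideal.mul_mem_left _ (Y ^ k) hl)
        convert h1 using 1
        ring⟩
      zero_mem' := ⟨0, by simp⟩
      smul_mem' := fun c a ⟨k, hk⟩ ↦ ⟨k, by
        rw [smul_eq_mul, mul_left_comm]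
        exact Ideal.mul_mem_left _ c hk⟩ }
  have hI : I ≤ Ideal.span {X} ⊔ maximalIdeal E • I := fun a ⟨k, hk⟩ ↦ by
    have ha : a ∈ maximalIdeal E := by
      by_contra ha
      exact pow_notMem_span_singleton hm hdim k
        ((Ideal.mul_unit_mem_iff_mem _ (notMem_maximalIdeal.mp ha)).mp hk)
    rw [hm] at ha
    obtain ⟨s, t, rfl⟩ := Ideal.mem_span_pair.mp ha
    refine Submodule.add_mem_sup (Ideal.mem_span_singleton'.mpr ⟨s, rfl⟩) ?_
    rw [mul_comm]
    refine Submodule.smul_mem_smul (hm ▸ Ideal.subset_span (by simp)) ⟨k + 1, ?_⟩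
    have h1 := sub_mem hk (Ideal.mem_span_singleton'.mpr ⟨Y ^ k * s, rfl⟩ : _ ∈ Ideal.span {X})
    convert h1 using 1
    ring
  exact Submodule.le_of_le_smul_of_le_jacobson_bot (IsNoetherian.noetherian I)
    (maximalIdeal_le_jacobson _) hI ⟨k, h⟩

/-- The forms in two generators of the maximal ideal of a local domain of dimension at least two
are independent: a form of degree `d` that lies in the next power of the maximal ideal has all
coefficients in the maximal ideal. -/
lemma mem_maximalIdeal_of_sum_mem_of_isDomain [IsDomain E] {d : ℕ} {u : ℕ → E}
    (h : ∑ i ∈ Finset.range (d + 1), u i * (X ^ i * Y ^ (d - i)) ∈ maximalIdeal E ^ (d + 1)) :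
    ∀ i ≤ d, u i ∈ maximalIdeal E := by
  induction d generalizing u with
  | zero => simpa using h
  | succ d ih =>
    rw [Finset.sum_range_succ', hm] at h
    obtain ⟨a, ha, b, hb, hab⟩ := Submodule.mem_sup.mp (span_pair_pow_succ_le X Y (d + 1) h)
    obtain ⟨w, hw, rfl⟩ := Ideal.mem_span_singleton_mul.mp ha
    obtain ⟨v, rfl⟩ := Ideal.mem_span_singleton'.mp hb
    simp only [Nat.add_sub_add_right, pow_zero, one_mul, Nat.sub_zero] at hab
    have h1 : ∑ i ∈ Finset.range (d + 1), u (i + 1) * (X ^ (i + 1) * Y ^ (d - i)) =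
        X * ∑ i ∈ Finset.range (d + 1), u (i + 1) * (X ^ i * Y ^ (d - i)) := by
      rw [Finset.mul_sum]
      exact Finset.sum_congr rfl fun i _ ↦ by ring
    rw [h1] at hab
    set s := ∑ i ∈ Finset.range (d + 1), u (i + 1) * (X ^ i * Y ^ (d - i)) with hs
    -- The coefficient of `Y ^ (d + 1)` is found modulo `X`.
    have h2 : Y ^ (d + 1) * (u 0 - v * Y) ∈ Ideal.span {X} :=
      Ideal.mem_span_singleton.mpr ⟨w - s, by linear_combination -hab⟩
    obtain ⟨t, ht⟩ := Ideal.mem_span_singleton'.mp (mem_span_singleton_of_pow_mul_mem hm hdim h2)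
    have hXm : X ∈ maximalIdeal E := hm ▸ Ideal.subset_span (by simp)
    have hYm : Y ∈ maximalIdeal E := hm ▸ Ideal.subset_span (by simp)
    have hs' : s = w - t * Y ^ (d + 1) := by
      refine mul_left_cancel₀ (ne_zero_of_two_le_ringKrullDim hm hdim) ?_
      linear_combination -hab + Y ^ (d + 1) * ht
    have h3 := ih (u := fun i ↦ u (i + 1)) (by
      rw [← hs, hs']
      exact sub_mem (hm ▸ hw) (Ideal.mul_mem_left _ _ (Ideal.pow_mem_pow hYm _)))
    rintro (_ | i) hi
    · rw [← sub_add_cancel (u 0) (v * Y), ← ht]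
      exact add_mem (Ideal.mul_mem_left _ _ hXm) (Ideal.mul_mem_left _ _ hYm)
    · exact h3 i (by lia)

/-- The independence of forms without the assumption that `E` is a domain, by passing to the
quotient by a prime with quotient of dimension at least two. -/
lemma mem_maximalIdeal_of_sum_mem {d : ℕ} {u : ℕ → E}
    (h : ∑ i ∈ Finset.range (d + 1), u i * (X ^ i * Y ^ (d - i)) ∈ maximalIdeal E ^ (d + 1)) :
    ∀ i ≤ d, u i ∈ maximalIdeal E := by
  obtain ⟨l, hl⟩ := Order.le_krullDim_iff.mp hdim
  let p := l.head.asIdeal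
  have : p.IsPrime := l.head.isPrime
  have : Nontrivial (E ⧸ p) := Ideal.Quotient.nontrivial_iff.mpr this.ne_top
  have hloc : IsLocalRing (E ⧸ p) := .of_surjective' (Ideal.Quotient.mk p) Ideal.Quotient.mk_surjective
  have hmap : maximalIdeal (E ⧸ p) = (maximalIdeal E).map (Ideal.Quotient.mk p) :=
    (IsLocalRing.map_maximalIdeal_of_surjective _ Ideal.Quotient.mk_surjective).symm
  have hd : 2 ≤ ringKrullDim (E ⧸ p) := by
    rw [ringKrullDim_quotient]
    refine Order.le_krullDim_iff.mpr ⟨⟨l.length, fun i ↦ ⟨l i, ?_⟩, l.step⟩, hl⟩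
    exact l.head_le i
  intro i hi
  have h1 := mem_maximalIdeal_of_sum_mem_of_isDomain (E := E ⧸ p) (X := Ideal.Quotient.mk p X)
    (Y := Ideal.Quotient.mk p Y) (d := d) (u := fun i ↦ Ideal.Quotient.mk p (u i))
    (by rw [hmap, hm, Ideal.map_span, Set.image_pair]) hd (by
      have := Ideal.mem_map_of_mem (Ideal.Quotient.mk p) h
      rw [Ideal.map_pow, ← hmap] at this
      simpa using this) i hi
  rw [mem_maximalIdeal, mem_nonunits_iff] at h1 ⊢
  exact fun h ↦ h1 (h.map _)

end TwoDimensional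

section Regular

/-- If the classes of `X`, `Y` and of the `k i` in the cotangent space of a regular local ring are
linearly independent, then the forms in `X` and `Y` are independent modulo the `k i`: extending
the `k i` by further elements to a family `𝔟` that generates the maximal ideal together with `X`
and `Y` leaves a ring of dimension at least `2` modulo `𝔟`. -/
lemma mem_maximalIdeal_of_sum_mem_sup {L : Type*} [CommRing L] [IsRegularLocalRing L]
    {ι : Type*} [Fintype ι] {X Y : L} {k : ι → L} (hX : X ∈ maximalIdeal L)
    (hY : Y ∈ maximalIdeal L) (hk : ∀ i, k i ∈ maximalIdeal L)
    (hind : ∀ (a b : L) (c : ι → L), a * X + b * Y + ∑ i, c i * k i ∈ maximalIdeal L ^ 2 →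
      a ∈ maximalIdeal L ∧ b ∈ maximalIdeal L ∧ ∀ i, c i ∈ maximalIdeal L)
    {d : ℕ} {u : ℕ → L}
    (h : ∑ i ∈ Finset.range (d + 1), u i * (X ^ i * Y ^ (d - i)) ∈
      Ideal.span (Set.range k) ⊔ maximalIdeal L ^ (d + 1)) :
    ∀ i ≤ d, u i ∈ maximalIdeal L := by
  let f : Fin 2 ⊕ ι → maximalIdeal L := Sum.elim ![⟨X, hX⟩, ⟨Y, hY⟩] fun i ↦ ⟨k i, hk i⟩
  have hli : LinearIndependent (ResidueField L)
      fun j ↦ ((maximalIdeal L).toCotangent (f j) : CotangentSpace L) := by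
    rw [Fintype.linearIndependent_iff]
    intro g hg
    choose c hc using fun j ↦ residue_surjective (g j)
    have h1 : (maximalIdeal L).toCotangent (∑ j, c j • f j) = 0 := by
      rw [map_sum, ← hg]
      refine Finset.sum_congr rfl fun j _ ↦ ?_
      rw [map_smul, ← hc j]
      rfl
    rw [Ideal.toCotangent_eq_zero] at h1
    have h2 := hind (c (.inl 0)) (c (.inl 1)) (fun i ↦ c (.inr i)) (by
      simpa [f, Fintype.sum_sum_type, Fin.sum_univ_two] using h1)
    have h3 : ∀ j, c j ∈ maximalIdeal L := by
      rintro (j | j)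
      · fin_cases j
        exacts [h2.1, h2.2.1]
      · exact h2.2.2 j
    intro j
    rw [← hc, residue_eq_zero_iff]
    exact h3 j
  obtain ⟨κ, b, hb⟩ : ∃ (κ : Type _)
      (b : Module.Basis ((Fin 2 ⊕ ι) ⊕ κ) (ResidueField L) (CotangentSpace L)),
      ∀ j, b (.inl j) = (maximalIdeal L).toCotangent (f j) := by
    refine ⟨Module.Basis.sumExtendIndex hli, Module.Basis.sumExtend hli, fun j ↦ ?_⟩
    simp only [Module.Basis.sumExtend, Module.Basis.reindex_apply, Module.Basis.extend_apply_self]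
    rfl
  have hfin : Finite ((Fin 2 ⊕ ι) ⊕ κ) := Module.Finite.finite_basis b
  have : Finite κ := Finite.of_injective _ (Sum.inr_injective (α := Fin 2 ⊕ ι))
  have : Fintype κ := Fintype.ofFinite κ
  choose w hw using fun j : κ ↦ (maximalIdeal L).toCotangent_surjective (b (.inr j))
  let F : (Fin 2 ⊕ ι) ⊕ κ → maximalIdeal L := Sum.elim f w
  have hF : ∀ j, (maximalIdeal L).toCotangent (F j) = b j := by
    rintro (j | j)
    · exact (hb j).symm
    · exact hw j
  have hspan : Submodule.span L (Set.range F) = ⊤ := by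
    rw [← CotangentSpace.span_image_eq_top_iff, ← Set.range_comp, ← b.span_eq]
    congr 2
    exact funext hF
  -- The images of `X` and `Y` generate the maximal ideal of `L ⧸ B`, and as many elements of a
  -- regular system of parameters are killed as to leave a ring of dimension at least two.
  let B : Ideal L := Ideal.span (Set.range (Sum.elim k fun j ↦ (w j : L)))
  have hm : maximalIdeal L = Ideal.span {X, Y} ⊔ B := by
    refine le_antisymm (fun z hz ↦ ?_) (sup_le (Ideal.span_le.mpr (Set.pair_subset hX hY))
      (Ideal.span_le.mpr ?_))
    · have h1 := Submodule.mem_map_of_mem (f := (maximalIdeal L).subtype)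
        (hspan.ge (Submodule.mem_top (x := ⟨z, hz⟩)))
      rw [Submodule.map_span, ← Set.range_comp] at h1
      refine Submodule.span_le.mpr ?_ h1
      rintro _ ⟨(j | j) | j, rfl⟩
      · refine Submodule.mem_sup_left (Ideal.subset_span ?_)
        fin_cases j <;> simp [F, f]
      · exact Submodule.mem_sup_right (Ideal.subset_span ⟨.inl j, rfl⟩)
      · exact Submodule.mem_sup_right (Ideal.subset_span ⟨.inr j, rfl⟩)
    · rintro _ ⟨j | j, rfl⟩
      exacts [hk j, (w j).2]
  have hcard : ringKrullDim L = (2 + Fintype.card ι + Fintype.card κ : ℕ) := by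
    rw [← (IsRegularLocalRing.iff_finrank_cotangentSpace L).mp inferInstance,
      Module.finrank_eq_nat_card_basis b]
    simp only [Nat.card_eq_fintype_card, Fintype.card_fin,
      Fintype.card_sum]
  have hBm : B ≤ maximalIdeal L := hm ▸ le_sup_right
  have : Nontrivial (L ⧸ B) :=
    Ideal.Quotient.nontrivial_iff.mpr (ne_top_of_le_ne_top (maximalIdeal.isMaximal L).ne_top hBm)
  have hloc : IsLocalRing (L ⧸ B) :=
    .of_surjective' (Ideal.Quotient.mk B) Ideal.Quotient.mk_surjective
  have hmap : maximalIdeal (L ⧸ B) = (maximalIdeal L).map (Ideal.Quotient.mk B) :=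
    (IsLocalRing.map_maximalIdeal_of_surjective _ Ideal.Quotient.mk_surjective).symm
  have hd : 2 ≤ ringKrullDim (L ⧸ B) := by
    have h1 := ringKrullDim_le_ringKrullDim_quotient_add_spanFinrank B
      (hBm.trans (IsLocalRing.ringJacobson_eq_maximalIdeal L).ge)
    have h2 : B.spanFinrank ≤ Fintype.card ι + Fintype.card κ := by
      refine (Submodule.spanFinrank_span_le_ncard_of_finite (Set.finite_range _)).trans ?_
      rw [← Set.image_univ]
      refine (Set.ncard_image_le).trans ?_
      simp [Set.ncard_univ]
    rw [hcard] at h1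
    generalize ringKrullDim (L ⧸ B) = D at h1 ⊢
    induction D with
    | bot => simp at h1
    | coe D =>
      induction D with
      | top => exact le_top
      | coe D =>
        have h3 : 2 + Fintype.card ι + Fintype.card κ ≤ D + B.spanFinrank :=
          ENat.natCast_le_natCast.mp (WithBot.coe_le_coe.mp h1)
        exact WithBot.coe_le_coe.mpr (ENat.natCast_le_natCast.mpr (show 2 ≤ D by omega))
  intro i hi
  have h1 := mem_maximalIdeal_of_sum_mem (E := L ⧸ B) (X := Ideal.Quotient.mk B X)
    (Y := Ideal.Quotient.mk B Y) (d := d) (u := fun i ↦ Ideal.Quotient.mk B (u i))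
    (by
      rw [hmap, hm, Ideal.map_sup, Ideal.map_quotient_self, sup_bot_eq, Ideal.map_span,
        Set.image_pair]) hd (by
      have hkB : Ideal.span (Set.range k) ≤ B := Ideal.span_mono (by
        rintro _ ⟨i, rfl⟩
        exact ⟨.inl i, rfl⟩)
      have := Ideal.mem_map_of_mem (Ideal.Quotient.mk B) (sup_le_sup_right hkB _ h)
      rw [Ideal.map_sup, Ideal.map_quotient_self, bot_sup_eq, Ideal.map_pow, ← hmap] at this
      simpa using this) i hi
  rw [mem_maximalIdeal, mem_nonunits_iff] at h1 ⊢
  exact fun h ↦ h1 (h.map _)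

end Regular

section Polynomials

/-- Independence of forms at a prime ideal `q` with regular localization, for elements of `q` that
are independent modulo `q²`. -/
lemma mem_of_sum_mem_sup_of_isRegularLocalRing_localization {B : Type*} [CommRing B] (q : Ideal B)
    [q.IsPrime] [IsRegularLocalRing (Localization.AtPrime q)] {ι : Type*} [Fintype ι] {X Y : B}
    {k : ι → B} (hX : X ∈ q) (hY : Y ∈ q) (hk : ∀ i, k i ∈ q)
    (hind : ∀ (a b : B) (c : ι → B), a * X + b * Y + ∑ i, c i * k i ∈ q ^ 2 →
      a ∈ q ∧ b ∈ q ∧ ∀ i, c i ∈ q) {d : ℕ} {u : ℕ → B}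
    (h : ∑ i ∈ Finset.range (d + 1), u i * (X ^ i * Y ^ (d - i)) ∈
      Ideal.span (Set.range k) ⊔ q ^ (d + 1)) :
    ∀ i ≤ d, u i ∈ q := by
  let L := Localization.AtPrime q
  have hmem (x : B) : algebraMap B L x ∈ maximalIdeal L ↔ x ∈ q :=
    IsLocalization.AtPrime.to_map_mem_maximal_iff L q x
  have hmap : q.map (algebraMap B L) = maximalIdeal L := Localization.AtPrime.map_eq_maximalIdeal
  intro i hi
  refine (hmem _).mp (mem_maximalIdeal_of_sum_mem_sup (L := L) (X := algebraMap B L X)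
    (Y := algebraMap B L Y) (k := fun i ↦ algebraMap B L (k i))
    (u := fun i ↦ algebraMap B L (u i)) (d := d) ((hmem _).mpr hX) ((hmem _).mpr hY)
    (fun i ↦ (hmem _).mpr (hk i)) (fun a b c habc ↦ ?_) ?_ i hi)
  -- Independence is inherited by the localization, by clearing denominators.
  · obtain ⟨s, hs⟩ := IsLocalization.exist_integer_multiples_of_finite q.primeCompl
      (Sum.elim ![a, b] c : Fin 2 ⊕ ι → L)
    obtain ⟨a', ha'⟩ := hs (.inl 0)
    obtain ⟨b', hb'⟩ := hs (.inl 1)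
    choose c' hc' using fun i ↦ hs (.inr i)
    simp only [Sum.elim_inl, Sum.elim_inr, Matrix.cons_val_zero, Matrix.cons_val_one,
      Algebra.smul_def] at ha' hb' hc'
    have h1 : algebraMap B L (a' * X + b' * Y + ∑ i, c' i * k i) ∈ (q ^ 2).map (algebraMap B L) := by
      rw [Ideal.map_pow, hmap]
      convert Ideal.mul_mem_left _ (algebraMap B L s) habc using 1
      simp only [map_add, map_mul, map_sum, ha', hb', hc', mul_add, Finset.mul_sum, mul_assoc]
    obtain ⟨t, ht, h2⟩ :=
      (IsLocalization.algebraMap_mem_map_algebraMap_iff q.primeCompl _ _ _).mp h1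
    have h3 := hind (t * a') (t * b') (fun i ↦ t * c' i) (by
      convert h2 using 1
      simp only [mul_add, Finset.mul_sum, mul_assoc])
    have h4 {x : L} {x' : B} (hx : algebraMap B L x' = algebraMap B L s * x) (hx' : t * x' ∈ q) :
        x ∈ maximalIdeal L := by
      have h5 := (hmem x').mpr ((Ideal.IsPrime.mem_or_mem ‹_› hx').resolve_left ht)
      rw [hx] at h5
      exact (Ideal.IsPrime.mem_or_mem inferInstance h5).resolve_left fun h6 ↦
        s.2 ((hmem _).mp h6)
    exact ⟨h4 ha' h3.1, h4 hb' h3.2.1, fun i ↦ h4 (hc' i) (h3.2.2 i)⟩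
  · have h1 := Ideal.mem_map_of_mem (algebraMap B L) h
    rw [Ideal.map_sup, Ideal.map_pow, hmap, Ideal.map_span, ← Set.range_comp] at h1
    simpa [Function.comp_def] using h1

variable {σ : Type*} (q : Ideal (MvPolynomial σ ℤ))

open MvPolynomial in
/-- An element of the `n`-th power of an ideal `q` comes from the `n`-th power of the restriction
of `q` to the polynomials in finitely many variables, once these are sufficiently many. -/
lemma eventually_exists_rename_eq {n : ℕ} {z : MvPolynomial σ ℤ} (hz : z ∈ q ^ n) :
    ∀ᶠ T : Finset σ in atTop, ∃ y ∈ (q.comap (rename (Subtype.val : T → σ))) ^ n,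
      rename Subtype.val y = z := by
  have h0 (z : MvPolynomial σ ℤ) :
      ∀ᶠ T : Finset σ in atTop, ∃ y, rename (Subtype.val : T → σ) y = z := by
    obtain ⟨s, y, rfl⟩ := exists_finset_rename z
    filter_upwards [eventually_ge_atTop s] with T hT
    exact ⟨rename (Set.inclusion hT) y, by rw [rename_rename]; rfl⟩
  induction n generalizing z with
  | zero => simpa using h0 z
  | succ n ih =>
    rw [pow_succ] at hz
    refine Submodule.mul_induction_on hz (fun a ha b hb ↦ ?_) fun a b ha hb ↦ ?_
    · filter_upwards [ih ha, h0 b] with T ⟨y, hy, hya⟩ ⟨w, hwb⟩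
      refine ⟨y * w, ?_, by simp [hya, hwb]⟩
      rw [pow_succ]
      exact Ideal.mul_mem_mul hy (by rwa [Ideal.mem_comap, hwb])
    · filter_upwards [ha, hb] with T ⟨y, hy, hya⟩ ⟨w, hw, hwb⟩
      exact ⟨y + w, add_mem hy hw, by simp [hya, hwb]⟩

open MvPolynomial in
/-- Independence of forms in a polynomial ring over `ℤ` in arbitrarily many variables; a relation
involves finitely many of them, and polynomial rings in finitely many variables are regular. -/
lemma mem_of_sum_mem_sup_pow [q.IsPrime] {β : Type*} {X Y : MvPolynomial σ ℤ}
    {k : β → MvPolynomial σ ℤ} (hX : X ∈ q) (hY : Y ∈ q) (hk : ∀ i, k i ∈ q)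
    (hind : ∀ (a b : MvPolynomial σ ℤ) (s : Finset β) (c : β → MvPolynomial σ ℤ),
      a * X + b * Y + ∑ i ∈ s, c i * k i ∈ q ^ 2 → a ∈ q ∧ b ∈ q ∧ ∀ i ∈ s, c i ∈ q)
    {d : ℕ} {u : ℕ → MvPolynomial σ ℤ}
    (h : ∑ i ∈ Finset.range (d + 1), u i * (X ^ i * Y ^ (d - i)) ∈
      Ideal.span (Set.range k) ⊔ q ^ (d + 1)) :
    ∀ i ≤ d, u i ∈ q := by
  classical
  obtain ⟨w, hw, z, hz, hwz⟩ := Submodule.mem_sup.mp h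
  obtain ⟨c, rfl⟩ := Finsupp.mem_ideal_span_range_iff_exists_finsupp.mp hw
  have h0 (z : MvPolynomial σ ℤ) :
      ∀ᶠ T : Finset σ in atTop, ∃ y, rename (Subtype.val : T → σ) y = z := by
    simpa using eventually_exists_rename_eq q (n := 0) (z := z) (by simp)
  have h1 := (Finset.range (d + 1)).eventually_all.mpr fun i _ ↦ h0 (u i)
  have h2 := c.support.eventually_all.mpr fun i _ ↦ (h0 (c i)).and (h0 (k i))
  obtain ⟨T, hzT, hXT, hYT, huT, hcT⟩ :=
    ((eventually_exists_rename_eq q hz).and ((h0 X).and ((h0 Y).and (h1.and h2)))).exists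
  obtain ⟨z', hz', rfl⟩ := hzT
  obtain ⟨X', rfl⟩ := hXT
  obtain ⟨Y', rfl⟩ := hYT
  choose! u' hu' using huT
  choose c' hc' using fun i : c.support ↦ (hcT i i.2).1
  choose k' hk' using fun i : c.support ↦ (hcT i i.2).2
  intro i hi
  rw [← hu' i (by simpa [Nat.lt_succ_iff] using hi)]
  refine mem_of_sum_mem_sup_of_isRegularLocalRing_localization (u := u') (d := d) (X := X')
    (Y := Y') (k := k') (q.comap (rename (Subtype.val : T → σ))) hX hY
    (fun i ↦ by rw [Ideal.mem_comap, hk']; exact hk i) (fun a b e he ↦ ?_) ?_ i hi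
  · have h3 := hind (rename Subtype.val a) (rename Subtype.val b) c.support
      (fun i ↦ if hi : i ∈ c.support then rename Subtype.val (e ⟨i, hi⟩) else 0) (by
        have h4 := Ideal.mem_map_of_mem (rename (Subtype.val : T → σ)) he
        rw [Ideal.map_pow] at h4
        convert Ideal.pow_right_mono Ideal.map_comap_le 2 h4 using 1
        rw [← Finset.sum_attach]
        simp [hk'])
    refine ⟨h3.1, h3.2.1, fun i ↦ ?_⟩
    have h4 := h3.2.2 i i.2
    rwa [dif_pos i.2] at h4
  · refine Submodule.mem_sup.mpr ⟨∑ i, c' i * k' i, ?_, z', hz', ?_⟩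
    · exact sum_mem fun i _ ↦ Ideal.mul_mem_left _ _ (Ideal.subset_span ⟨i, rfl⟩)
    · apply rename_injective _ Subtype.val_injective
      simp only [map_add, map_sum, map_mul, map_pow, hc', hk']
      rw [Finset.sum_coe_sort c.support (fun i ↦ c i * k i)]
      rw [Finsupp.sum] at hwz
      rw [hwz]
      exact Finset.sum_congr rfl fun i hi ↦ by rw [hu' i hi]

end Polynomials

/-! ### Completion at an ideal that is finitely generated modulo its square -/

section CompletionModSquare

variable {B : Type*} [CommRing B] (n : Ideal B)

lemma ker_evalₐ_antitone : Antitone fun k ↦ RingHom.ker (AdicCompletion.evalₐ n k) := by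
  intro k l hkl z hz
  obtain ⟨r, rfl⟩ := AdicCompletion.mk_surjective n B z
  simp only [RingHom.mem_ker, AdicCompletion.evalₐ_mk] at hz ⊢
  rw [← AdicCompletion.Ideal.mk_eq_mk n hkl]
  exact Ideal.Quotient.eq_zero_iff_mem.mpr
    (Ideal.pow_le_pow_right hkl (Ideal.Quotient.eq_zero_iff_mem.mp hz))

lemma algebraMap_mem_ker_evalₐ_iff {k : ℕ} {p : B} :
    algebraMap B (AdicCompletion n B) p ∈ RingHom.ker (AdicCompletion.evalₐ n k) ↔ p ∈ n ^ k := by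
  rw [RingHom.mem_ker, AlgHom.commutes]
  exact Ideal.Quotient.eq_zero_iff_mem

lemma exists_sub_algebraMap_mem_ker_evalₐ (k : ℕ) (z : AdicCompletion n B) :
    ∃ p, z - algebraMap B (AdicCompletion n B) p ∈ RingHom.ker (AdicCompletion.evalₐ n k) := by
  obtain ⟨p, hp⟩ := Ideal.Quotient.mk_surjective (AdicCompletion.evalₐ n k z)
  refine ⟨p, ?_⟩
  rw [RingHom.mem_ker, map_sub, AlgHom.commutes, ← hp]
  exact sub_self _

lemma eq_zero_of_forall_mem_ker_evalₐ {z : AdicCompletion n B}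
    (h : ∀ k, z ∈ RingHom.ker (AdicCompletion.evalₐ n k)) : z = 0 :=
  AdicCompletion.ext_evalₐ fun k ↦ by rw [map_zero]; exact h k

lemma exists_forall_sub_mem_ker_evalₐ (f : ℕ → AdicCompletion n B)
    (hf : ∀ k, f (k + 1) - f k ∈ RingHom.ker (AdicCompletion.evalₐ n k)) :
    ∃ L, ∀ k, L - f k ∈ RingHom.ker (AdicCompletion.evalₐ n k) := by
  choose p hp using fun k ↦ exists_sub_algebraMap_mem_ker_evalₐ n k (f k)
  have h (k : ℕ) : p (k + 1) - p k ∈ n ^ k := by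
    rw [← algebraMap_mem_ker_evalₐ_iff, map_sub]
    have h1 := ker_evalₐ_antitone n (Nat.le_succ k) (hp (k + 1))
    have h2 := add_mem (sub_mem (hf k) h1) (hp k)
    convert h2 using 1
    ring
  let r : AdicCompletion.AdicCauchySequence n B := AdicCompletion.AdicCauchySequence.mk n B p
    fun k ↦ by
      rw [SModEq.sub_mem, smul_eq_mul, Ideal.mul_top, ← neg_sub]
      exact neg_mem (h k)
  refine ⟨AdicCompletion.mk n B r, fun k ↦ ?_⟩
  have h1 : AdicCompletion.mk n B r - algebraMap B _ (p k) ∈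
      RingHom.ker (AdicCompletion.evalₐ n k) := by
    rw [RingHom.mem_ker, map_sub, AdicCompletion.evalₐ_mk, AlgHom.commutes]
    exact sub_self _
  have h2 := sub_mem h1 (hp k)
  convert h2 using 1
  ring

variable {n} {a : Ideal B} (ha : a.FG) (han : a ≤ n) (hna : n ≤ a ⊔ n ^ 2)

include han hna in
lemma pow_le_sup_pow_succ (k : ℕ) : n ^ k ≤ a ^ k ⊔ n ^ (k + 1) := by
  induction k with
  | zero => simp
  | succ k ih =>
    rw [pow_succ n k]
    refine (Ideal.mul_mono ih hna).trans ?_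
    rw [Ideal.sup_mul, Ideal.mul_sup]
    refine sup_le (sup_le ?_ ?_) ?_
    · exact le_sup_of_le_left (pow_succ a k).ge
    · refine le_sup_of_le_right ((Ideal.mul_mono_left (Ideal.pow_right_mono han k)).trans ?_)
      rw [← pow_add]
    · refine le_sup_of_le_right ?_
      calc n ^ (k + 1) * (a ⊔ n ^ 2) ≤ n ^ (k + 1) * n :=
            Ideal.mul_mono_right (sup_le han (Ideal.pow_le_self two_ne_zero))
        _ = n ^ (k + 1 + 1) := (pow_succ _ _).symm

include ha han hna

/-- An ideal of definition of the completion is generated by finitely many elements of `n` that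
generate `n` modulo its square, even if `n` is not finitely generated. -/
lemma ker_evalₐ_eq_pow_map (k : ℕ) : RingHom.ker (AdicCompletion.evalₐ n k) =
    a.map (algebraMap B (AdicCompletion n B)) ^ k := by
  let K (k : ℕ) := RingHom.ker (AdicCompletion.evalₐ n k)
  let φ := algebraMap B (AdicCompletion n B)
  refine le_antisymm (fun z hz ↦ ?_) ?_
  · obtain ⟨r, g, hg⟩ := Submodule.fg_iff_exists_fin_generating_family.mp (ha.pow (n := k))
    -- An element of the `k`-th ideal is the sum of a series of multiples of the generators `g i` of
    -- `a ^ k` with coefficients tending to zero; the series of coefficients converge.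
    have step (j : ℕ) (z : K (k + j)) : ∃ (h : Fin r → AdicCompletion n B) (z' : K (k + (j + 1))),
        (∀ i, h i ∈ K j) ∧ (z : AdicCompletion n B) = ∑ i, h i * φ (g i) + z' := by
      obtain ⟨p, hp⟩ := exists_sub_algebraMap_mem_ker_evalₐ n (k + (j + 1)) (z : AdicCompletion n B)
      have h1 : p ∈ n ^ (k + j) := by
        rw [← algebraMap_mem_ker_evalₐ_iff]
        have := sub_mem z.2 (ker_evalₐ_antitone n (show k + j ≤ k + (j + 1) by lia) hp)
        rwa [sub_sub_cancel] at this
      obtain ⟨p₁, h₁, p₂, h₂, rfl⟩ := Submodule.mem_sup.mp (pow_le_sup_pow_succ han hna _ h1)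
      rw [add_comm, pow_add, ← smul_eq_mul, ← hg,
        Submodule.mem_ideal_smul_span_iff_exists_sum] at h₁
      obtain ⟨e, he, he'⟩ := h₁
      rw [Finsupp.sum_fintype _ _ (by simp)] at he'
      subst he'
      refine ⟨fun i ↦ φ (e i), ⟨_, add_mem hp ((algebraMap_mem_ker_evalₐ_iff n).mpr h₂)⟩,
        fun i ↦ (algebraMap_mem_ker_evalₐ_iff n).mpr (Ideal.pow_right_mono han j (he i)), ?_⟩
      simp [φ]
      ring
    choose h t ht hs using step
    let s : (j : ℕ) → K (k + j) := fun j ↦ Nat.rec (⟨z, hz⟩ : K (k + 0)) (fun j s ↦ t j s) j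
    choose L hL using fun i ↦ exists_forall_sub_mem_ker_evalₐ n
      (fun j ↦ ∑ l ∈ Finset.range j, h l (s l) i) fun j ↦ by
        rw [Finset.sum_range_succ, add_sub_cancel_left]
        exact ht _ _ i
    have h1 (j : ℕ) : z = ∑ i, (∑ l ∈ Finset.range j, h l (s l) i) * φ (g i) + (s j).1 := by
      induction j with
      | zero => simp [s]
      | succ j ih =>
        rw [ih, hs j (s j)]
        simp only [Finset.sum_range_succ, add_mul, Finset.sum_add_distrib, add_assoc]
        rfl
    have h2 : z = ∑ i, L i * φ (g i) := by
      refine sub_eq_zero.mp (eq_zero_of_forall_mem_ker_evalₐ n fun j ↦ ?_)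
      rw [h1 j, add_sub_right_comm, ← Finset.sum_sub_distrib]
      refine add_mem (sum_mem fun i _ ↦ ?_) (ker_evalₐ_antitone n (Nat.le_add_left j k) (s j).2)
      rw [← sub_mul, ← neg_sub, neg_mul]
      exact neg_mem (Ideal.mul_mem_right _ _ (hL i j))
    rw [h2, ← Ideal.map_pow]
    refine sum_mem fun i _ ↦ Ideal.mul_mem_left _ _ (Ideal.mem_map_of_mem _ ?_)
    rw [← hg]
    exact Submodule.subset_span ⟨i, rfl⟩
  · rw [← Ideal.map_pow, Ideal.map_le_iff_le_comap]
    exact fun p hp ↦ (algebraMap_mem_ker_evalₐ_iff n).mpr (Ideal.pow_right_mono han k hp)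

lemma isAdicComplete_map_adicCompletion :
    IsAdicComplete (a.map (algebraMap B (AdicCompletion n B))) (AdicCompletion n B) where
  haus' z hz := eq_zero_of_forall_mem_ker_evalₐ n fun k ↦ by
    rw [ker_evalₐ_eq_pow_map ha han hna]
    simpa [SModEq.zero] using hz k
  prec' f hf := by
    obtain ⟨L, hL⟩ := exists_forall_sub_mem_ker_evalₐ n f fun k ↦ by
      have := hf (Nat.le_succ k)
      rw [SModEq.sub_mem, smul_eq_mul, Ideal.mul_top, ← ker_evalₐ_eq_pow_map ha han hna] at this
      rw [← neg_sub]
      exact neg_mem this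
    refine ⟨L, fun k ↦ ?_⟩
    rw [SModEq.sub_mem, smul_eq_mul, Ideal.mul_top, ← ker_evalₐ_eq_pow_map ha han hna, ← neg_sub]
    exact neg_mem (hL k)

end CompletionModSquare

/-! ### Complete rings with two parameters and independent forms -/

section TwoParameters

variable {S : Type*} [CommRing S] [IsLocalRing S] {X Y : S} [IsAdicComplete (Ideal.span {X, Y}) S]
  (hm : maximalIdeal S = Ideal.span {X, Y})

include hm

/-- Expansion of an element with respect to `X` and `Y`. -/
lemma mem_span_singleton_or_exists_isUnit (t : S) :
    t ∈ Ideal.span {X} ∨ ∃ (j : ℕ) (s v : S), IsUnit v ∧ t = X * s + v * Y ^ j := by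
  refine or_iff_not_imp_right.mpr fun h ↦ ?_
  have h' (j : ℕ) (s v : S) (e : t = X * s + v * Y ^ j) :
      ∃ a b, v = a * X + b * Y := by
    have h1 : v ∈ maximalIdeal S := fun hv ↦ h ⟨j, s, v, hv, e⟩
    rw [hm, Ideal.mem_span_pair] at h1
    obtain ⟨a, b, e⟩ := h1
    exact ⟨a, b, e.symm⟩
  choose! a b hab using h'
  -- If no unit turns up, then `t = X * s + v * Y ^ j` for all `j`, and the `s` converge.
  let f : ℕ → S × S := fun j ↦ Nat.rec (0, t)
    (fun j p ↦ (p.1 + a j p.1 p.2 * Y ^ j, b j p.1 p.2)) j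
  have hf (j : ℕ) : t = X * (f j).1 + (f j).2 * Y ^ j := by
    induction j with
    | zero => simp [f]
    | succ j ih =>
      have h1 := hab j _ _ ih
      change t = X * ((f j).1 + a j (f j).1 (f j).2 * Y ^ j) + b j (f j).1 (f j).2 * Y ^ (j + 1)
      linear_combination ih + Y ^ j * h1
  have hY (j : ℕ) : Y ^ j ∈ Ideal.span {X, Y} ^ j :=
    Ideal.pow_mem_pow (Ideal.subset_span (by simp)) j
  obtain ⟨L, hL⟩ := exists_forall_sub_mem_pow (m := Ideal.span {X, Y}) (fun j ↦ (f j).1) fun j ↦ by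
    change (f j).1 + a j (f j).1 (f j).2 * Y ^ j - (f j).1 ∈ _
    rw [add_sub_cancel_left]
    exact Ideal.mul_mem_left _ _ (hY j)
  refine Ideal.mem_span_singleton.mpr ⟨L, sub_eq_zero.mp
    (eq_zero_of_forall_mem_pow (m := Ideal.span {X, Y}) fun j ↦ ?_)⟩
  have h1 := sub_mem (Ideal.mul_mem_left _ (f j).2 (hY j)) (Ideal.mul_mem_left _ X (hL j))
  convert h1 using 1
  linear_combination hf j

/-- Modulo `X`, every nonzero element is a unit times a power of `Y`, and every ideal is principal.
-/
lemma exists_mem_le_span_singleton_sup_span_singleton (Q : Ideal S) :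
    ∃ g ∈ Q, Q ≤ Ideal.span {g} ⊔ Ideal.span {X} := by
  classical
  by_cases h : ∃ j, ∃ t ∈ Q, ∃ s v : S, IsUnit v ∧ t = X * s + v * Y ^ j
  -- An element of least order in `Y` modulo `X` generates `Q` modulo `X`.
  · obtain ⟨g, hg, s, v, hv, e⟩ := Nat.find_spec h
    refine ⟨g, hg, fun t ht ↦ ?_⟩
    obtain h1 | ⟨j, s', v', hv', e'⟩ := mem_span_singleton_or_exists_isUnit hm t
    · exact Submodule.mem_sup_right h1
    · obtain ⟨k, hk⟩ := Nat.exists_eq_add_of_le (Nat.find_le (h := h) ⟨t, ht, s', v', hv', e'⟩)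
      obtain ⟨w, hw⟩ := hv.exists_right_inv
      rw [hk, pow_add] at e'
      rw [Ideal.mem_span_singleton_sup]
      refine ⟨v' * w * Y ^ k, X * (s' - v' * w * Y ^ k * s),
        Ideal.mul_mem_right _ _ (Ideal.mem_span_singleton_self X), ?_⟩
      linear_combination v' * w * Y ^ k * e - e' + v' * Y ^ k * Y ^ (Nat.find h) * hw
  · refine ⟨0, Q.zero_mem, fun t ht ↦ Submodule.mem_sup_right ?_⟩
    exact (mem_span_singleton_or_exists_isUnit hm t).resolve_right
      fun ⟨j, s, v, hv, e⟩ ↦ h ⟨j, t, ht, s, v, hv, e⟩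

lemma isNoetherianRing_of_maximalIdeal_eq_span_pair : IsNoetherianRing S :=
  isNoetherianRing_of_isAdicComplete (m := Ideal.span {X, Y}) (x := X)
    (Ideal.subset_span (by simp)) fun Q ↦ by
      obtain ⟨g, hg, h⟩ := exists_mem_le_span_singleton_sup_span_singleton hm Q
      exact ⟨1, fun _ ↦ g, fun _ ↦ hg, by rwa [Set.range_const]⟩

variable (hforms : ∀ (d : ℕ) (u : ℕ → S),
  ∑ i ∈ Finset.range (d + 1), u i * (X ^ i * Y ^ (d - i)) ∈ maximalIdeal S ^ (d + 1) →
    ∀ i ≤ d, u i ∈ maximalIdeal S)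

include hforms

omit [IsAdicComplete (Ideal.span {X, Y}) S] in
/-- The initial form of `X * s` is `X` times that of `s`. -/
lemma mem_pow_succ_of_mul_mem_pow {s : S} {e : ℕ} (hs : s ∈ maximalIdeal S ^ e)
    (h : X * s ∈ maximalIdeal S ^ (e + 2)) : s ∈ maximalIdeal S ^ (e + 1) := by
  rw [hm] at hs
  obtain ⟨u, rfl⟩ := exists_sum_eq_of_mem_span_pair_pow hs
  have h1 := hforms (e + 1) (fun i ↦ if i = 0 then 0 else u (i - 1)) (by
    rw [Finset.sum_range_succ']
    convert h using 1
    rw [Finset.mul_sum]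
    simp only [Nat.add_eq_zero_iff, one_ne_zero, and_false, if_false, Nat.add_sub_cancel,
      Nat.add_sub_add_right, if_true, zero_mul, add_zero]
    exact Finset.sum_congr rfl fun i _ ↦ by ring)
  refine sum_mem fun i hi ↦ ?_
  have hi' : i ≤ e := by simpa [Nat.lt_succ_iff] using hi
  have h2 : u i ∈ maximalIdeal S := by simpa using h1 (i + 1) (by lia)
  have h3 : X ^ i * Y ^ (e - i) ∈ maximalIdeal S ^ e := by
    rw [← Nat.add_sub_cancel' hi', pow_add, Nat.add_sub_cancel_left, hm]
    exact Ideal.mul_mem_mul (Ideal.pow_mem_pow (Ideal.subset_span (by simp)) _)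
      (Ideal.pow_mem_pow (Ideal.subset_span (by simp)) _)
  rw [pow_succ']
  exact Ideal.mul_mem_mul h2 h3

lemma mem_nonZeroDivisors_of_forms : X ∈ nonZeroDivisors S := by
  rw [mem_nonZeroDivisors_iff_right]
  intro s hs
  have h (e : ℕ) : s ∈ maximalIdeal S ^ e := by
    induction e with
    | zero => simp
    | succ e ih =>
      exact mem_pow_succ_of_mul_mem_pow hm hforms ih (by rw [mul_comm, hs]; exact zero_mem _)
  exact eq_zero_of_forall_mem_pow (m := Ideal.span {X, Y}) (hm ▸ h)

omit [IsAdicComplete (Ideal.span {X, Y}) S] in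
lemma pow_notMem_span_singleton_of_forms (k : ℕ) : Y ^ k ∉ Ideal.span {X} := by
  have hX : X ∈ maximalIdeal S := hm ▸ Ideal.subset_span (by simp)
  have hY : Y ∈ maximalIdeal S := hm ▸ Ideal.subset_span (by simp)
  intro h
  obtain _ | k := k
  · rw [pow_zero] at h
    exact (mem_maximalIdeal _).mp ((Ideal.span_singleton_le_iff_mem _).mpr hX h) isUnit_one
  obtain ⟨s, hs⟩ := Ideal.mem_span_singleton.mp h
  have h1 (e : ℕ) (he : e ≤ k) : s ∈ maximalIdeal S ^ e := by
    induction e with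
    | zero => simp
    | succ e ih =>
      refine mem_pow_succ_of_mul_mem_pow hm hforms (ih (by lia)) ?_
      rw [← hs]
      exact Ideal.pow_le_pow_right (by lia) (Ideal.pow_mem_pow hY _)
  have h2 := h1 k le_rfl
  rw [hm] at h2
  obtain ⟨u, rfl⟩ := exists_sum_eq_of_mem_span_pair_pow h2
  have h3 := hforms (k + 1) (fun i ↦ if i = 0 then 1 else -u (i - 1)) (by
    rw [Finset.sum_range_succ']
    convert zero_mem (maximalIdeal S ^ (k + 1 + 1)) using 1
    rw [Finset.mul_sum] at hs
    simp only [Nat.add_eq_zero_iff, one_ne_zero, and_false, if_false, Nat.add_sub_cancel,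
      Nat.add_sub_add_right, if_true, pow_zero, one_mul, Nat.sub_zero]
    rw [hs, ← Finset.sum_add_distrib]
    exact Finset.sum_eq_zero fun i _ ↦ by ring) 0 (Nat.zero_le _)
  simp at h3

/-- Independence of forms makes `X` regular and `Y` not nilpotent modulo `X`, so that the dimension
is at least two. -/
lemma isRegularLocalRing_of_forms : IsRegularLocalRing S := by
  have := isNoetherianRing_of_maximalIdeal_eq_span_pair hm
  have hX : X ∈ maximalIdeal S := hm ▸ Ideal.subset_span (by simp)
  have hY : Y ∈ maximalIdeal S := hm ▸ Ideal.subset_span (by simp)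
  have : Nontrivial (S ⧸ Ideal.span {X}) := Ideal.Quotient.nontrivial_iff.mpr
    (ne_top_of_le_ne_top (maximalIdeal.isMaximal S).ne_top
      ((Ideal.span_singleton_le_iff_mem _).mpr hX))
  have : IsLocalRing (S ⧸ Ideal.span {X}) :=
    .of_surjective' (Ideal.Quotient.mk _) Ideal.Quotient.mk_surjective
  have h1 : 1 ≤ ringKrullDim (S ⧸ Ideal.span {X}) := by
    by_contra! h
    have h2 : Ring.KrullDimLE 0 (S ⧸ Ideal.span {X}) :=
      Ring.krullDimLE_iff.mpr (ENat.WithBot.lt_add_one_iff.mp (by simpa using h))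
    have h3 : IsNilpotent (Ideal.Quotient.mk (Ideal.span {X}) Y) :=
      Ring.KrullDimLE.isNilpotent_iff_mem_maximalIdeal.mpr (by
        rw [← IsLocalRing.map_maximalIdeal_of_surjective _ Ideal.Quotient.mk_surjective]
        exact Ideal.mem_map_of_mem _ hY)
    obtain ⟨k, hk⟩ := h3
    rw [← map_pow, Ideal.Quotient.eq_zero_iff_mem] at hk
    exact pow_notMem_span_singleton_of_forms hm hforms k hk
  have h2 := ringKrullDim_quotient_succ_le_of_nonZeroDivisor
    (mem_nonZeroDivisors_of_forms hm hforms)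
  refine .of_spanFinrank_maximalIdeal_le S ?_
  have h3 : (maximalIdeal S).spanFinrank ≤ 2 := by
    rw [hm]
    exact (Submodule.spanFinrank_span_le_ncard_of_finite (Set.toFinite _)).trans
      ((Set.ncard_insert_le X {Y}).trans (by simp))
  calc ((maximalIdeal S).spanFinrank : WithBot ℕ∞) ≤ (2 : ℕ) := by exact_mod_cast h3
    _ = 1 + 1 := by norm_num
    _ ≤ ringKrullDim (S ⧸ Ideal.span {X}) + 1 := by gcongr
    _ ≤ ringKrullDim S := h2

/-- A surjection onto a ring in which the image of `X` is regular and divides a power of the image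
of `Y` has a principal kernel: it is generated by one element modulo `X`, and is saturated with
respect to `X`. -/
lemma exists_ker_eq_span_singleton {A : Type*} [CommRing A] [Nontrivial A] (f : S →+* A)
    (hf : Function.Surjective f) (hX : f X ∈ nonZeroDivisors A) {k : ℕ}
    (hY : f Y ^ k ∈ Ideal.span {f X}) :
    ∃ g ∈ maximalIdeal S, g ≠ 0 ∧ RingHom.ker f = Ideal.span {g} := by
  obtain ⟨g, hg, hle⟩ := exists_mem_le_span_singleton_sup_span_singleton hm (RingHom.ker f)
  have h1 : RingHom.ker f = Ideal.span {g} := by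
    refine le_antisymm ?_ ((Ideal.span_singleton_le_iff_mem _).mpr hg)
    have h2 := le_span_of_le_span_sup_span (m := Ideal.span {X, Y}) (x := X)
      (Ideal.subset_span (by simp)) (fun _ : Fin 1 ↦ g) (RingHom.ker f) (fun _ ↦ hg)
      (fun q hq ↦ by
        rw [RingHom.mem_ker, map_mul] at hq
        exact (mul_left_mem_nonZeroDivisors_eq_zero_iff hX).mp hq)
      (by rwa [Set.range_const])
    rwa [Set.range_const] at h2
  refine ⟨g, fun h ↦ ?_, ?_, h1⟩
  · have h2 := h.map f
    rw [(RingHom.mem_ker).mp hg] at h2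
    exact not_isUnit_zero h2
  · rintro rfl
    obtain ⟨a, ha⟩ := Ideal.mem_span_singleton.mp hY
    obtain ⟨s, rfl⟩ := hf a
    have h2 : Y ^ k - X * s ∈ RingHom.ker f := by
      rw [RingHom.mem_ker, map_sub, map_pow, map_mul, ha, sub_self]
    rw [h1, Ideal.mem_span_singleton, zero_dvd_iff, sub_eq_zero] at h2
    exact pow_notMem_span_singleton_of_forms hm hforms k
      (h2 ▸ Ideal.mul_mem_right _ _ (Ideal.mem_span_singleton_self X))

end TwoParameters

/-! ### Presentation of complete rings of embedding dimension two -/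

section Presentation

/-- An ideal `K` inside a maximal ideal `q` is generated modulo `q²` by a family of elements of `K`
that is independent modulo `q²`: lift a basis of the span of the classes of `K` in the cotangent
space. -/
lemma exists_family_span_sup_sq {P : Type u} [CommRing P] (q K : Ideal P) [q.IsMaximal]
    (hK : K ≤ q) : ∃ (β : Type u) (k : β → P), (∀ i, k i ∈ K) ∧
      K ≤ Ideal.span (Set.range k) ⊔ q ^ 2 ∧
      ∀ (s : Finset β) (c : β → P), ∑ i ∈ s, c i * k i ∈ q ^ 2 → ∀ i ∈ s, c i ∈ q := by
  let _ : Field (P ⧸ q) := Ideal.Quotient.field q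
  let v : K → q.Cotangent := fun z ↦ q.toCotangent ⟨z, hK z.2⟩
  obtain ⟨β, a, -, hspan, hli⟩ := exists_linearIndependent' (P ⧸ q) v
  have hsum (s : Finset β) (c : β → P) (h : ∑ i ∈ s, c i * a i ∈ q) :
      q.toCotangent ⟨∑ i ∈ s, c i * a i, h⟩ =
        ∑ i ∈ s, Ideal.Quotient.mk q (c i) • v (a i) := by
    have h1 (i : β) : Ideal.Quotient.mk q (c i) • v (a i) = c i • v (a i) := rfl
    simp only [h1, v, ← map_smul, ← map_sum]
    congr 1
    ext
    simp
  refine ⟨β, fun i ↦ a i, fun i ↦ (a i).2, fun z hz ↦ ?_, fun s c h i hi ↦ ?_⟩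
  · have h1 : v ⟨z, hz⟩ ∈ Submodule.span (P ⧸ q) (Set.range (v ∘ a)) :=
      hspan ▸ Submodule.subset_span ⟨_, rfl⟩
    obtain ⟨c, hc⟩ := Finsupp.mem_span_range_iff_exists_finsupp.mp h1
    choose p hp using fun i ↦ Ideal.Quotient.mk_surjective (c i)
    have h2 : ∑ i ∈ c.support, p i * a i ∈ q :=
      sum_mem fun i _ ↦ Ideal.mul_mem_left _ _ (hK (a i).2)
    have h3 : z - ∑ i ∈ c.support, p i * a i ∈ q ^ 2 := by
      refine (Ideal.toCotangent_eq (x := ⟨z, hK hz⟩) (y := ⟨_, h2⟩) q).mp ?_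
      rw [hsum]
      simp only [hp]
      exact hc.symm
    rw [← add_sub_cancel (∑ i ∈ c.support, p i * a i) z]
    exact add_mem (Submodule.mem_sup_left (sum_mem fun i _ ↦
      Ideal.mul_mem_left _ _ (Ideal.subset_span ⟨i, rfl⟩))) (Submodule.mem_sup_right h3)
  · have h1 := (Ideal.toCotangent_eq_zero q ⟨_, Ideal.pow_le_self two_ne_zero h⟩).mpr h
    rw [hsum] at h1
    exact Ideal.Quotient.eq_zero_iff_mem.mp (linearIndependent_iff'.mp hli s _ h1 i hi)

variable {B : Type u} [CommRing B] {n : Ideal B} {A : Type u} [CommRing A] {m : Ideal A}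

lemma exists_ringHom_adicCompletion [IsAdicComplete m A] (f : B →+* A) (hf : n ≤ m.comap f) :
    ∃ g : AdicCompletion n B →+* A, ∀ b, g (algebraMap B _ b) = f b := by
  have h (j : ℕ) : n ^ j ≤ (m ^ j).comap f :=
    (Ideal.pow_right_mono hf j).trans (Ideal.le_comap_pow f j)
  let F (j : ℕ) : AdicCompletion n B →+* A ⧸ m ^ j :=
    (Ideal.quotientMap (m ^ j) f (h j)).comp (AdicCompletion.evalₐ n j).toRingHom
  have hF {j l : ℕ} (hle : j ≤ l) : (Ideal.Quotient.factorPow m hle).comp (F l) = F j := by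
    ext s
    obtain ⟨r, rfl⟩ := AdicCompletion.mk_surjective n B s
    have h1 : Ideal.Quotient.mk (n ^ j) (r.val l) = Ideal.Quotient.mk (n ^ j) (r.val j) :=
      AdicCompletion.Ideal.mk_eq_mk n hle r
    have h2 := congrArg (Ideal.quotientMap (m ^ j) f (h j)) h1
    simpa [F] using h2
  refine ⟨IsAdicComplete.liftRingHom m F hF, fun b ↦ sub_eq_zero.mp
    (eq_zero_of_forall_mem_pow (m := m) fun j ↦ ?_)⟩
  rw [← Ideal.Quotient.eq_zero_iff_mem, map_sub, IsAdicComplete.mk_liftRingHom]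
  have h3 : AdicCompletion.evalₐ n j (algebraMap B _ b) = Ideal.Quotient.mk _ b :=
    AlgHom.commutes _ _
  simp [F, h3]

/-- A complete local ring whose maximal ideal is generated by two elements `x`, `y` that are
independent modulo its square, with `x` regular and dividing a power of `y`, is the quotient of a
regular local ring by one nonzero element. This avoids coefficient rings: the regular ring is the
completion of `ℤ[X_a : a ∈ A] / J`, with `J` generated by lifts of a basis of the kernel of the map
induced on cotangent spaces by `ℤ[X_a] → A`. -/
theorem exists_ringEquiv_quotient_span_singleton [IsLocalRing A]
    [IsAdicComplete (maximalIdeal A) A] {x y : A} (hm : maximalIdeal A = Ideal.span {x, y})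
    (hind : ∀ a b : A, a * x + b * y ∈ maximalIdeal A ^ 2 →
      a ∈ maximalIdeal A ∧ b ∈ maximalIdeal A)
    (hx : x ∈ nonZeroDivisors A) {k : ℕ} (hy : y ^ k ∈ Ideal.span {x}) :
    ∃ (S : Type u) (_ : CommRing S) (_ : IsRegularLocalRing S) (f : S),
      f ∈ maximalIdeal S ∧ f ≠ 0 ∧ Nonempty (A ≃+* S ⧸ Ideal.span {f}) := by
  let P := MvPolynomial A ℤ
  let θ : P →+* A := (MvPolynomial.aeval (R := ℤ) (id : A → A)).toRingHom
  have hθ (a : A) : θ (MvPolynomial.X a) = a := MvPolynomial.aeval_X _ _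
  have hθ' : Function.Surjective θ := fun a ↦ ⟨_, hθ a⟩
  let q : Ideal P := (maximalIdeal A).comap θ
  have hq : q.IsMaximal := Ideal.comap_isMaximal_of_surjective θ hθ'
  have hxm : x ∈ maximalIdeal A := hm ▸ Ideal.subset_span (by simp)
  have hym : y ∈ maximalIdeal A := hm ▸ Ideal.subset_span (by simp)
  let X : P := MvPolynomial.X x
  let Y : P := MvPolynomial.X y
  have hX : X ∈ q := by simpa [q, X, hθ] using hxm
  have hY : Y ∈ q := by simpa [q, Y, hθ] using hym
  obtain ⟨β, c, hc, hspan, hli⟩ := exists_family_span_sup_sq q (RingHom.ker θ)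
    (Ideal.comap_mono bot_le)
  let J : Ideal P := Ideal.span (Set.range c)
  have hJ : J ≤ RingHom.ker θ := Ideal.span_le.mpr (by rintro _ ⟨i, rfl⟩; exact hc i)
  -- The forms in `X` and `Y` are independent modulo `J`: relations between `X`, `Y` and the `c i`
  -- modulo `q²` map to relations between `x` and `y` modulo the square of the maximal ideal.
  have hPforms {d : ℕ} {u : ℕ → P}
      (h : ∑ i ∈ Finset.range (d + 1), u i * (X ^ i * Y ^ (d - i)) ∈ J ⊔ q ^ (d + 1)) :
      ∀ i ≤ d, u i ∈ q := by
    refine mem_of_sum_mem_sup_pow q hX hY (fun i ↦ hJ.trans (Ideal.comap_mono bot_le)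
      (Ideal.subset_span ⟨i, rfl⟩)) (fun a b s e h ↦ ?_) h
    have h1 := Ideal.mem_map_of_mem θ h
    rw [Ideal.map_pow, Ideal.map_comap_of_surjective θ hθ'] at h1
    have h2 : θ (∑ i ∈ s, e i * c i) = 0 := by
      rw [map_sum]
      exact Finset.sum_eq_zero fun i _ ↦ by rw [map_mul, (RingHom.mem_ker).mp (hc i), mul_zero]
    rw [map_add, h2, add_zero, map_add, map_mul, map_mul, hθ, hθ] at h1
    have h3 := hind _ _ h1
    refine ⟨h3.1, h3.2, hli s e ?_⟩
    refine (Submodule.add_mem_iff_right _ ?_).mp h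
    rw [pow_two]
    exact add_mem (Ideal.mul_mem_mul h3.1 hX) (Ideal.mul_mem_mul h3.2 hY)
  let B := P ⧸ J
  let π : P →+* B := Ideal.Quotient.mk J
  have hπ : Function.Surjective π := Ideal.Quotient.mk_surjective
  let θB : B →+* A := Ideal.Quotient.lift J θ hJ
  have hθB (p : P) : θB (π p) = θ p := Ideal.Quotient.lift_mk _ _ _
  have hθB' : Function.Surjective θB := fun a ↦ ⟨π (MvPolynomial.X a), by rw [hθB, hθ]⟩
  let n : Ideal B := (maximalIdeal A).comap θB
  have hn : n.IsMaximal := Ideal.comap_isMaximal_of_surjective θB hθB'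
  have hnq : n = q.map π := by
    rw [← Ideal.map_comap_of_surjective π hπ n]
    rfl
  have hmem (j : ℕ) (p : P) : π p ∈ n ^ j ↔ p ∈ J ⊔ q ^ j := by
    rw [hnq, ← Ideal.map_pow, ← Ideal.mem_comap, Ideal.comap_map_of_surjective' π hπ,
      Ideal.mk_ker, sup_comm]
  let a : Ideal B := Ideal.span {π X, π Y}
  have ha : a.FG := Submodule.fg_span (Set.toFinite _)
  have han : a ≤ n := by
    rw [Ideal.span_le, Set.pair_subset_iff, hnq]
    exact ⟨Ideal.mem_map_of_mem π hX, Ideal.mem_map_of_mem π hY⟩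
  have hna : n ≤ a ⊔ n ^ 2 := by
    intro b hb
    obtain ⟨p, rfl⟩ := hπ b
    have h1 : θ p ∈ maximalIdeal A := by rw [← hθB]; exact hb
    rw [hm, Ideal.mem_span_pair] at h1
    obtain ⟨α, β, e⟩ := h1
    have h2 : p - (MvPolynomial.X α * X + MvPolynomial.X β * Y) ∈ RingHom.ker θ := by
      rw [RingHom.mem_ker, map_sub, map_add, map_mul, map_mul, hθ, hθ, hθ, hθ, e, sub_self]
    have h3 := (hmem 2 _).mpr (hspan h2)
    rw [← add_sub_cancel (MvPolynomial.X α * X + MvPolynomial.X β * Y) p, map_add, map_add,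
      map_mul, map_mul]
    exact add_mem (Submodule.mem_sup_left (Ideal.mem_span_pair.mpr ⟨_, _, rfl⟩))
      (Submodule.mem_sup_right h3)
  -- The ideal `n` is generated by `X` and `Y` modulo its square, but it need not be finitely
  -- generated; its completion is nevertheless the one at the ideal `M` below.
  let S := AdicCompletion n B
  let φ : B →+* S := algebraMap B S
  let K (j : ℕ) : Ideal S := RingHom.ker (AdicCompletion.evalₐ n j)
  let M : Ideal S := Ideal.span {φ (π X), φ (π Y)}
  have haM : a.map φ = M := by rw [Ideal.map_span, Set.image_pair]
  have hK (j : ℕ) : K j = M ^ j := by rw [← haM]; exact ker_evalₐ_eq_pow_map ha han hna j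
  have hKM : K 1 = M := by rw [hK, pow_one]
  have hcomp : IsAdicComplete M S := haM ▸ isAdicComplete_map_adicCompletion ha han hna
  have hM : M.IsMaximal := by
    have h1 : (⊥ : Ideal (B ⧸ n ^ 1)).IsMaximal :=
      (Ideal.bot_quotient_isMaximal_iff _).mpr (by rwa [pow_one])
    rw [← hKM]
    exact Ideal.comap_isMaximal_of_surjective _ (AdicCompletion.surjective_evalₐ n 1)
  have hS : IsLocalRing S := isLocalRing_of_isAdicComplete_maximal M
  have hMS : maximalIdeal S = M := (IsLocalRing.eq_maximalIdeal hM).symm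
  have hforms (d : ℕ) (u : ℕ → S)
      (h : ∑ i ∈ Finset.range (d + 1), u i * (φ (π X) ^ i * φ (π Y) ^ (d - i)) ∈
        maximalIdeal S ^ (d + 1)) : ∀ i ≤ d, u i ∈ maximalIdeal S := by
    rw [hMS, ← hK] at h
    choose p hp using fun i ↦ exists_sub_algebraMap_mem_ker_evalₐ n (d + 1) (u i)
    choose p' hp' using fun i ↦ hπ (p i)
    have h1 : φ (π (∑ i ∈ Finset.range (d + 1), p' i * (X ^ i * Y ^ (d - i)))) ∈ K (d + 1) := by
      have h2 : ∑ i ∈ Finset.range (d + 1), (u i - φ (p i)) * (φ (π X) ^ i * φ (π Y) ^ (d - i)) ∈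
          K (d + 1) := sum_mem fun i _ ↦ Ideal.mul_mem_right _ _ (hp i)
      have h3 := sub_mem h h2
      rw [← Finset.sum_sub_distrib] at h3
      simpa [← sub_mul, hp'] using h3
    rw [algebraMap_mem_ker_evalₐ_iff, hmem] at h1
    intro i hi
    have h4 : φ (p i) ∈ K 1 := by
      rw [algebraMap_mem_ker_evalₐ_iff, pow_one, ← hp', hnq]
      exact Ideal.mem_map_of_mem π (hPforms h1 i hi)
    rw [hMS, ← hKM, ← sub_add_cancel (u i) (φ (p i))]
    exact add_mem (ker_evalₐ_antitone n (Nat.le_add_left 1 d) (hp i)) h4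
  obtain ⟨f, hf⟩ := exists_ringHom_adicCompletion (n := n) (m := maximalIdeal A) θB le_rfl
  have hf' : Function.Surjective f := fun a ↦ by
    obtain ⟨b, rfl⟩ := hθB' a
    exact ⟨_, hf b⟩
  have hfX : f (φ (π X)) = x := by rw [hf, hθB, hθ]
  have hfY : f (φ (π Y)) = y := by rw [hf, hθB, hθ]
  obtain ⟨g, hg, hg0, hker⟩ := exists_ker_eq_span_singleton hMS hforms f hf' (by rwa [hfX])
    (k := k) (by rwa [hfX, hfY])
  refine ⟨S, inferInstance, isRegularLocalRing_of_forms hMS hforms, g, hg, hg0, ⟨?_⟩⟩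
  exact (RingHom.quotientKerEquivOfSurjective hf').symm.trans (Ideal.quotEquivOfEq hker)

end Presentation

/-! ### Rings of multiplicity two -/

section MultiplicityTwo

lemma exists_eq_span_singleton_of_spanFinrank_le_one {A : Type*} [CommRing A] {I : Ideal A}
    (hI : I.FG) (h : I.spanFinrank ≤ 1) : ∃ z, I = Ideal.span {z} := by
  obtain ⟨s, hs, rfl⟩ := Submodule.FG.exists_span_finset_card_eq_spanFinrank hI
  rw [← hs, Finset.card_le_one_iff_subset_singleton] at h
  obtain ⟨z, hz⟩ := h
  obtain rfl | rfl := Finset.subset_singleton_iff.mp hz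
  · exact ⟨0, by simp⟩
  · exact ⟨z, by rw [Finset.coe_singleton]⟩

/-- Generators `x`, `y` of a maximal ideal that is not principal are independent modulo its square.
-/
lemma mem_maximalIdeal_of_mul_add_mul_mem_sq {A : Type*} [CommRing A] [IsLocalRing A] {x y : A}
    (hm : maximalIdeal A = Ideal.span {x, y}) (h : ∀ z, maximalIdeal A ≠ Ideal.span {z})
    {a b : A} (hab : a * x + b * y ∈ maximalIdeal A ^ 2) : a ∈ maximalIdeal A := by
  by_contra ha
  obtain ⟨a', ha'⟩ := (notMem_maximalIdeal.mp ha).exists_left_inv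
  have hx : x ∈ Ideal.span {y} ⊔ maximalIdeal A • maximalIdeal A := by
    rw [Ideal.mem_span_singleton_sup]
    refine ⟨-(a' * b), _, by rw [smul_eq_mul, ← pow_two]; exact Ideal.mul_mem_left _ a' hab, ?_⟩
    linear_combination x * ha'
  refine h y (le_antisymm ?_ (hm ▸ Ideal.span_mono (by simp)))
  refine Submodule.le_of_le_smul_of_le_jacobson_bot ?_ (maximalIdeal_le_jacobson ⊥) (?_ : _ ≤ _)
  · rw [hm]
    exact Submodule.fg_span (Set.toFinite _)
  · conv_lhs => rw [hm]
    rw [Ideal.span_le, Set.pair_subset_iff]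
    exact ⟨hx, Submodule.mem_sup_left (Ideal.mem_span_singleton_self y)⟩

variable {R : Type u} [CommRing R] [IsLocalRing R] [IsNoetherianRing R]

/-- If `R ⧸ (x)` has length two and the maximal ideal is not principal, then it is generated by `x`
and one more element, and the presentation of complete rings of embedding dimension two applies to
the completion. -/
theorem isAbstractHypersurface_of_length_eq_two (hdim : ringKrullDim R = 1) {x : R}
    (hx : x ∈ maximalIdeal R) (hx' : x ∈ nonZeroDivisors R)
    (hlen : Module.length R (R ⧸ Ideal.span {x}) = 2)
    (h : ∀ z, maximalIdeal R ≠ Ideal.span {z}) : IsAbstractHypersurface R := by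
  have hxm : Ideal.span {x} < maximalIdeal R :=
    lt_of_le_of_ne ((Ideal.span_singleton_le_iff_mem _).mpr hx) (h x).symm
  obtain ⟨y, hy, hyx⟩ := Set.exists_of_ssubset hxm
  -- Otherwise `(x) < (x, y) < 𝔪 < R`, and `R ⧸ (x)` has length at least three.
  have hm : maximalIdeal R = Ideal.span {x, y} := by
    by_contra hne
    have hle : Ideal.span {x, y} ≤ maximalIdeal R := Ideal.span_le.mpr (Set.pair_subset hx hy)
    have h1 : Ideal.span {x} < Ideal.span {x, y} := lt_of_le_of_ne (Ideal.span_mono (by simp))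
      fun e ↦ hyx (by rw [e]; exact Ideal.subset_span (by simp))
    have h2 := length_quotient_add_one_le h1
    have h3 := length_quotient_add_one_le (lt_of_le_of_ne hle fun e ↦ hne e.symm)
    have h4 := length_quotient_add_one_le (lt_top_iff_ne_top.mpr (maximalIdeal.isMaximal R).ne_top)
    rw [hlen] at h2
    have h5 := (add_le_add_left (add_le_add_left h4 1) 1).trans
      ((add_le_add_left h3 1).trans h2)
    have h6 : (3 : ℕ∞) ≤ 2 := le_trans (by rw [add_assoc, add_assoc]; exact le_add_self) h5
    exact absurd h6 (by decide)
  let A := AdicCompletion (maximalIdeal R) R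
  let φ : R →+* A := algebraMap R A
  have hmA : maximalIdeal A = Ideal.span {φ x, φ y} := by
    rw [AdicCompletion.maximalIdeal_eq_map, ← Set.image_pair, ← Ideal.map_span, ← hm]
  have hA (z : A) : maximalIdeal A ≠ Ideal.span {z} := fun e ↦ by
    have h1 : (maximalIdeal A).spanFinrank ≤ 1 := by
      rw [e]
      exact (Submodule.spanFinrank_span_le_ncard_of_finite (Set.toFinite _)).trans
        (Set.ncard_singleton z).le
    rw [AdicCompletion.spanFinrank_maximalIdeal_eq] at h1
    obtain ⟨w, hw⟩ := exists_eq_span_singleton_of_spanFinrank_le_one (IsNoetherian.noetherian _) h1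
    exact h w hw
  have : Ring.KrullDimLE 1 R := Ring.krullDimLE_iff.mpr hdim.le
  have : IsArtinianRing (R ⧸ Ideal.span {x}) := isArtinianRing_quotient_of_mem_nonZeroDivisors
    isMaximal_of_mem_nonZeroDivisors_of_krullDimLE _ (Ideal.mem_span_singleton_self x) hx'
  obtain ⟨k, hk⟩ := exists_maximalIdeal_pow_le_of_isArtinianRing_quotient (Ideal.span {x})
  have hyA : φ y ∈ maximalIdeal A := hmA ▸ Ideal.subset_span (by simp)
  exact exists_ringEquiv_quotient_span_singleton hmA
    (fun a b hab ↦ ⟨mem_maximalIdeal_of_mul_add_mul_mem_sq hmA hA hab,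
      mem_maximalIdeal_of_mul_add_mul_mem_sq (hmA.trans (by rw [Set.pair_comm])) hA
        (x := φ y) (y := φ x) (by rwa [add_comm])⟩)
    (algebraMap_mem_nonZeroDivisors hx')
    (pow_maximalIdeal_adicCompletion_le hk (Ideal.pow_mem_pow hyA k))

/-- If `𝔪 𝔠 = x 𝔠` for the conductor `𝔠`, the multiplicity is the length of `R ⧸ (x)`. -/
lemma hasMultiplicity_iff_of_mul_conductorIdeal (hdim : ringKrullDim R = 1)
    (hR : IsAnalyticallyUnramified R) {x : R} (hx : x ∈ maximalIdeal R)
    (hx' : x ∈ nonZeroDivisors R)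
    (hxc : ∀ a ∈ maximalIdeal R, ∀ n ∈ conductorIdeal R, ∃ n' ∈ conductorIdeal R, a * n = x * n')
    (e : ℕ) : HasMultiplicity R e ↔ Module.length R (R ⧸ Ideal.span {x}) = e := by
  obtain ⟨s, hs, hs'⟩ := exists_mem_conductorIdeal_mem_nonZeroDivisors hdim hR
  have h (n : ℕ) : maximalIdeal R ^ n * conductorIdeal R ≤
      Ideal.span {x ^ n} * conductorIdeal R := by
    have h1 : maximalIdeal R * conductorIdeal R ≤ Ideal.span {x} * conductorIdeal R := by
      rw [Ideal.mul_le]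
      intro a ha t ht
      obtain ⟨t', ht', e⟩ := hxc a ha t ht
      exact Ideal.mem_span_singleton_mul.mpr ⟨t', ht', e.symm⟩
    induction n with
    | zero => simp
    | succ n ih =>
      rw [pow_succ, mul_assoc, pow_succ, ← Ideal.span_singleton_mul_span_singleton]
      refine (Ideal.mul_mono_right h1).trans ?_
      rw [mul_left_comm, mul_comm (Ideal.span {x ^ n}), mul_assoc]
      exact Ideal.mul_mono_right ih
  refine hasMultiplicity_iff hdim hx hx' hs' (fun n a ha ↦ ?_) e
  have h1 : a * s ∈ Ideal.span {x ^ n} * conductorIdeal R := h n (Ideal.mul_mem_mul ha hs)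
  rw [mul_comm]
  exact Ideal.mul_le_left h1

end MultiplicityTwo

end StableMinors

end

theorem mainTheorem7 {R : Type u} [CommRing R] [IsLocalRing R] [IsNoetherianRing R]
    (hdim : ringKrullDim R = 1) (hR : StableMinors.IsAnalyticallyUnramified R) :
    ((∀ M : ChainComplex (ModuleCat.{u} R) ℤ, StableMinors.IsBoundedBelowFGHomologyBounded M →
        StableMinors.conductorIdeal R ≤ StableMinors.stableIdeal M 1) ∧
      StableMinors.conductorIdeal R ≤ StableMinors.stableIdealComplexes R 1 ∧
      StableMinors.stableIdealComplexes R 1 = StableMinors.stableIdealModules R 1) ∧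
    (StableMinors.IsGorensteinLocal R → Infinite (IsLocalRing.ResidueField R) →
      ((∃ N : ModuleCat.{u} R, Module.Finite R N ∧
          StableMinors.stableIdeal (StableMinors.moduleComplex N) 1 =
            StableMinors.conductorIdeal R) ↔
        (IsRegularLocalRing R ∨
          (StableMinors.IsAbstractHypersurface R ∧ StableMinors.HasMultiplicity R 2)))) := by
  open StableMinors in
  have hstable := conductorIdeal_le_stableIdeal hdim hR
  refine ⟨⟨hstable, le_iInf₂ fun M hM ↦ (hstable M hM).trans (stableIdeal_le_totalIdeal M 1),
    stableIdealComplexes_eq_stableIdealModules 1⟩, fun hG hinf ↦ ?_⟩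
  have := hR.isReduced
  obtain ⟨s, hs, hs'⟩ := exists_mem_conductorIdeal_mem_nonZeroDivisors hdim hR
  obtain ⟨t, ht, ht'⟩ := exists_mem_maximalIdeal_mem_nonZeroDivisors hdim
  -- A principal reduction `x` of the maximal ideal, in the form `𝔪 𝔠 = x 𝔠`.
  obtain ⟨x, hx, hx', hxc⟩ :=
    exists_forall_mul_mem_conductorIdeal hdim hR (IsLocalRing.maximalIdeal R) ht ht'
  have hmult := hasMultiplicity_iff_of_mul_conductorIdeal hdim hR hx hx' hxc 2
  have htop (hc : conductorIdeal R = ⊤) : ∃ N : ModuleCat.{u} R, Module.Finite R N ∧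
      stableIdeal (moduleComplex N) 1 = conductorIdeal R := by
    have hfin : Module.Finite R (ModuleCat.of R R) := inferInstanceAs (Module.Finite R R)
    refine ⟨ModuleCat.of R R, hfin, le_antisymm (hc ▸ le_top) (hstable _ ?_)⟩
    exact isBoundedBelowFGHomologyBounded_moduleComplex _
  constructor
  · rintro ⟨N, -, hN⟩
    by_cases hm : ∃ z, IsLocalRing.maximalIdeal R = Ideal.span {z}
    · obtain ⟨z, hz⟩ := hm
      exact .inl (isRegularLocalRing_of_maximalIdeal_eq_span hdim hz)
    · push Not at hm
      have hlen := (maximalIdeal_eq_span_or_length_eq_two hdim hR hG hx hx' hxc N hN).resolve_left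
        (hm x)
      exact .inr ⟨isAbstractHypersurface_of_length_eq_two hdim hx hx' hlen hm, hmult.mpr hlen⟩
  · rintro (hreg | ⟨-, h2⟩)
    · obtain ⟨z, hz⟩ := exists_maximalIdeal_eq_span_of_isRegularLocalRing hdim hreg
      obtain ⟨r, rfl⟩ := Ideal.mem_span_singleton.mp (hz ▸ ht)
      exact htop (conductorIdeal_eq_top_of_maximalIdeal_eq_span (mul_mem_nonZeroDivisors.mp ht').1
        hz hs hs')
    -- In multiplicity two the conductor itself has the required stable ideal.
    · by_cases hc : conductorIdeal R = ⊤
      · exact htop hc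
      obtain ⟨u, hu, hu', huc⟩ :=
        exists_forall_mul_mem_conductorIdeal hdim hR (conductorIdeal R) hs hs'
      have : Ring.KrullDimLE 1 R := Ring.krullDimLE_iff.mpr hdim.le
      obtain ⟨v, hv, huv⟩ := exists_conductorIdeal_le_span_pair hx hx'
        isMaximal_of_mem_nonZeroDivisors_of_krullDimLE hs hs' hu hu' huc (hmult.mp h2)
      obtain ⟨w, hw, h⟩ := huc v hv v hv
      have hfin : Module.Finite R (ModuleCat.of R (conductorIdeal R)) :=
        inferInstanceAs (Module.Finite R (conductorIdeal R))
      exact ⟨_, hfin, le_antisymm (stableIdeal_conductorIdeal_le hc hu hv hw hu' huv h)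
        (hstable _ (isBoundedBelowFGHomologyBounded_moduleComplex _))⟩
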